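/- A \emph{blind $m$-tape non-deterministic Turing machine} ($m\ge 1$) consists of a finite alphabet $\Sigma$ containing a blank symbol, a finite set $Q$ of states with an initial state and a set of accepting states, and a finite set of transitions $\Delta \subseteq \underline\Sigma^m \times Q \times \underline\Sigma^m \times Q \times \{-1,0,1\}^m$, where $\underline\Sigma=\Sigma\cup\{\_\}$ and $\_$ is a neutral symbol not in $\Sigma$. The transition $\langle a_1,\dots,a_m,q,b_1,\dots,b_m,q',d_1,\dots,d_m\rangle$ can be applied in state $q$ if for every tape $t$ either $a_t=\_$ or $a_t$ is the symbol under the head of tape $t$; it then writes $b_t$ on tape $t$ (and keeps the symbol if $b_t=\_$), moves the head of tape $t$ by $d_t$, and changes the state to $q'$. The tapes are infinite in both directions; initially the input word $w\in\Sigma^*$ is written on the first tape starting at cell $0$, all other cells are blank, and all heads are at cell $0$. \emph{Short Blind Multi-Tape Non-Deterministic Turing Machine Computation} is the following parameterized problem. Input: a blind multi-tape non-deterministic Turing machine $M$ (the number $m$ of tapes is part of the input), a word $w$ on its alphabet, and an integer $k\ge 0$. Parameter: $k$. Question: is there a computation of $M$ on $w$ that reaches an accepting state in at most $k$ steps? An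 \emph{fpt-reduction} from a parameterized problem $A$ to a parameterized problem $B$ is an algorithm that maps every instance $(x,k)$ of $A$ to an instance $(y,l)$ of $B$ such that $(x,k)$ is a yes-instance of $A$ if and only if $(y,l)$ is a yes-instance of $B$, that $l\le g(k)$, and that the running time is at most $f(k)\cdot|(x,k)|^{c}$, for some computable functions $f,g:\mathbb N\to\mathbb N$ and some constant $c$. For a Boolean circuit with NOT gates and AND and OR gates of arbitrary fan-in, the \emph{depth} is the maximum number of gates, and the \emph{weft} the maximum number of gates of fan-in greater than $2$, on a path from an input to the output. A parameterized problem belongs to $\mathrm W[2]$ if for some constant $h$ it has an fpt-reduction to the problem of deciding, given a Boolean circuit of weft at most $2$ and depth at most $h$ and the parameter $k$, whether the circuit accepts some input vector of Hamming weight exactly $k$. A problem is $\mathrm W[2]$-hard if every problem in $\mathrm W[2]$ has an fpt-reduction to it, and $\mathrm W[2]$-complete if moreover it belongs to $\mathrm W[2]$. \textbf{Theorem.} Short Blind Multi-Tape Non-Deterministic Turing Machine Computation is $\mathrm W[2]$-complete. -/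

import Mathlib

namespace ParamW

/-! ### Data, programs and running time

The model of computation is the one-variable WHILE language over binary trees (pure LISP with the
single atom `nil`), written as a language of unary functions on trees, with one time unit for every
operation. It is deterministic, and polynomially equivalent to Turing machines. -/

/-- Binary trees with one atom, the data of programs. -/
inductive Val : Type
  | nil : Val
  | cons : Val → Val → Val

/-- The number of nodes of a tree; the size of an encoded input or output. -/
def Val.size : Val → ℕ
  | .nil => 1
  | .cons a b => a.size + b.size + 1

/-- First component (`nil` for the atom). -/
def Val.hd : Val → Val
  | .nil => .nil
  | .cons a _ => a

/-- Second component (`nil` for the atom). -/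
def Val.tl : Val → Val
  | .nil => .nil
  | .cons _ b => b

/-- Programs. `nil` counts as false and every other tree as true in `ite` and `loop`. -/
inductive Prog : Type
  /-- return the input -/
  | id : Prog
  /-- return the atom -/
  | nil : Prog
  /-- first component of the input -/
  | hd : Prog
  /-- second component of the input -/
  | tl : Prog
  /-- run both programs on the input and pair the results -/
  | cons : Prog → Prog → Prog
  /-- `seq f g`: run `f`, then run `g` on the result -/
  | seq : Prog → Prog → Prog
  /-- `ite c f g`: run `f` or `g` on the input, according to the result of `c` on it -/
  | ite : Prog → Prog → Prog → Prog
  /-- `loop c f`: while `c` returns true on the current value, replace this value by the result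
  of `f` on it -/
  | loop : Prog → Prog → Prog

/-- `Runs p v w t`: the program `p` on input `v` halts with output `w` after exactly `t` steps. -/
inductive Runs : Prog → Val → Val → ℕ → Prop
  | id (v : Val) : Runs .id v v 1
  | nil (v : Val) : Runs .nil v .nil 1
  | hd (v : Val) : Runs .hd v v.hd 1
  | tl (v : Val) : Runs .tl v v.tl 1
  | cons {f g : Prog} {v a b : Val} {s t : ℕ} :
      Runs f v a s → Runs g v b t → Runs (.cons f g) v (.cons a b) (s + t + 1)
  | seq {f g : Prog} {v a b : Val} {s t : ℕ} :
      Runs f v a s → Runs g a b t → Runs (.seq f g) v b (s + t + 1)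
  | ite_true {c f g : Prog} {v d a : Val} {s t : ℕ} :
      Runs c v d s → d ≠ .nil → Runs f v a t → Runs (.ite c f g) v a (s + t + 1)
  | ite_false {c f g : Prog} {v a : Val} {s t : ℕ} :
      Runs c v .nil s → Runs g v a t → Runs (.ite c f g) v a (s + t + 1)
  | loop_done {c f : Prog} {v : Val} {s : ℕ} :
      Runs c v .nil s → Runs (.loop c f) v v (s + 1)
  | loop_step {c f : Prog} {v d v' w : Val} {s t u : ℕ} :
      Runs c v d s → d ≠ .nil → Runs f v v' t → Runs (.loop c f) v' w u →
        Runs (.loop c f) v w (s + t + u + 1)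

/-! ### Encodings of finite objects as trees -/

/-- An injective encoding of a type by trees. -/
class TreeEnc (α : Type) where
  enc : α → Val
  inj : Function.Injective enc

/-- Natural numbers are written in unary. -/
def encNat : ℕ → Val
  | 0 => .nil
  | n + 1 => .cons .nil (encNat n)

theorem encNat_injective : Function.Injective encNat := by
  intro a
  induction a with
  | zero => intro b h; cases b <;> simp_all [encNat]
  | succ a ih =>
    intro b h
    cases b with
    | zero => simp [encNat] at h
    | succ b => simp only [encNat, Val.cons.injEq, true_and] at h; rw [ih h]

/-- Lists are written as right-nested pairs ending in `nil`. -/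
def encList {α : Type} (e : α → Val) : List α → Val
  | [] => .nil
  | a :: l => .cons (e a) (encList e l)

theorem encList_injective {α : Type} {e : α → Val} (he : Function.Injective e) :
    Function.Injective (encList e) := by
  intro a
  induction a with
  | nil => intro b h; cases b <;> simp_all [encList]
  | cons x a ih =>
    intro b h
    cases b with
    | nil => simp [encList] at h
    | cons y b =>
      simp only [encList, Val.cons.injEq] at h
      rw [he h.1, ih h.2]

instance : TreeEnc ℕ := ⟨encNat, encNat_injective⟩

instance (n : ℕ) : TreeEnc (Fin n) :=
  ⟨fun i => encNat i, fun _ _ h => Fin.ext (encNat_injective h)⟩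

instance : TreeEnc Bool :=
  ⟨fun b => if b then .cons .nil .nil else .nil, by intro a b; cases a <;> cases b <;> simp⟩

/-- Head movements `0`, `1`, `-1` are written as the numbers `0`, `1`, `2`. -/
instance : TreeEnc SignType :=
  ⟨fun d => match d with
    | .zero => encNat 0
    | .pos => encNat 1
    | .neg => encNat 2, by intro a b; cases a <;> cases b <;> simp [encNat]⟩

instance {α : Type} [TreeEnc α] : TreeEnc (Option α) :=
  ⟨fun o => match o with
    | none => .nil
    | some a => .cons .nil (TreeEnc.enc a), by
      intro a b h
      cases a <;> cases b <;> simp at h ⊢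
      exact TreeEnc.inj h⟩

instance {α β : Type} [TreeEnc α] [TreeEnc β] : TreeEnc (α × β) :=
  ⟨fun p => .cons (TreeEnc.enc p.1) (TreeEnc.enc p.2), by
    intro a b h
    simp only [Val.cons.injEq] at h
    exact Prod.ext (TreeEnc.inj h.1) (TreeEnc.inj h.2)⟩

instance {α : Type} [TreeEnc α] : TreeEnc (List α) :=
  ⟨encList TreeEnc.enc, encList_injective TreeEnc.inj⟩

/-- A tuple is written as the list of its entries. -/
instance {α : Type} [TreeEnc α] (n : ℕ) : TreeEnc (Fin n → α) :=
  ⟨fun f => TreeEnc.enc (List.ofFn f), fun _ _ h => List.ofFn_injective (TreeEnc.inj h)⟩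

/-! ### Parameterized problems and fpt-reductions -/

/-- A parameterized problem: a set of pairs (instance, parameter), where the instances are finite
objects given by an encoding. -/
structure ParamProblem where
  Inst : Type
  [code : TreeEnc Inst]
  Yes : Inst → ℕ → Prop

/-- The input tree of a program that is run on the instance `x` with parameter `k`. -/
def ParamProblem.input (A : ParamProblem) (x : A.Inst) (k : ℕ) : Val :=
  .cons (A.code.enc x) (encNat k)

/-- Parameterized many-one reducibility: a program maps `(x, k)` to an equivalent `(y, l)` with
`l ≤ g k`, in time `f k * |(x, k)| ^ c`, for computable `f` and `g` and a constant `c`. Trees may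
share subtrees in memory, so that a tree can be larger than the number of steps that built it;
therefore the size of the written output is counted as well. -/
def FPTReducible (A B : ParamProblem) : Prop :=
  ∃ (p : Prog) (f g : ℕ → ℕ) (c : ℕ), Computable f ∧ Computable g ∧
    ∀ (x : A.Inst) (k : ℕ), ∃ (y : B.Inst) (l t : ℕ),
      Runs p (A.input x k) (B.input y l) t ∧
      t + (B.input y l).size ≤ f k * (A.input x k).size ^ c ∧
      l ≤ g k ∧
      (A.Yes x k ↔ B.Yes y l)

/-! ### Boolean circuits, weft, and the W-hierarchy -/

/-- A gate, with the numbers of the wires that enter it. -/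
inductive Gate : Type
  | not : ℕ → Gate
  | and : List ℕ → Gate
  | or : List ℕ → Gate

/-- The wires that enter a gate. -/
def Gate.args : Gate → List ℕ
  | .not a => [a]
  | .and l => l
  | .or l => l

/-- The Boolean operation of a gate, where `v` gives the values of the wires. -/
def Gate.eval (v : ℕ → Bool) : Gate → Bool
  | .not a => !(v a)
  | .and l => l.all v
  | .or l => l.any v

/-- A gate is large if its fan-in exceeds two. -/
def Gate.isLarge (g : Gate) : Bool := decide (2 < g.args.length)

instance : TreeEnc Gate :=
  ⟨fun g => match g with
    | .not a => TreeEnc.enc ((0 : ℕ), [a])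
    | .and l => TreeEnc.enc ((1 : ℕ), l)
    | .or l => TreeEnc.enc ((2 : ℕ), l), by
      intro a b h
      cases a <;> cases b <;> have h' := TreeEnc.inj h <;> simp at h' ⊢ <;> exact h'⟩

/-- A Boolean circuit (an acyclic network of gates of arbitrary fan-out), with its gates in
topological order: the wires `0, …, inputs - 1` are the inputs, the wire `inputs + i` leaves
the gate number `i`, and a gate only uses earlier wires. -/
structure Circuit where
  inputs : ℕ
  gates : List Gate
  output : ℕ
  acyclic : ∀ (i : ℕ) (hi : i < gates.length), ∀ a ∈ gates[i].args, a < inputs + i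
  output_lt : output < inputs + gates.length

instance : TreeEnc Circuit :=
  ⟨fun C => TreeEnc.enc (C.inputs, C.gates, C.output), by
    rintro ⟨n, gs, o, _, _⟩ ⟨n', gs', o', _, _⟩ h
    have h' := TreeEnc.inj h
    simp only [Prod.mk.injEq] at h'
    obtain ⟨rfl, rfl, rfl⟩ := h'
    rfl⟩

/-- Values of all wires, computed gate by gate: `init` lists the values of the inputs, and a gate
`g` adds `op g v`, where `v` gives the values of the earlier wires. -/
def wireValues {α : Type} (dflt : α) (op : Gate → (ℕ → α) → α) (init : List α)
    (gates : List Gate) : List α :=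
  gates.foldl (fun vs g => vs ++ [op g (fun i => vs.getD i dflt)]) init

/-- The output of the circuit on the input vector `x`. -/
def Circuit.eval (C : Circuit) (x : Fin C.inputs → Bool) : Bool :=
  (wireValues false (fun g v => g.eval v) (List.ofFn x) C.gates).getD C.output false

/-- The maximum of `v` over a list (`0` for the empty list). -/
def maxOver (v : ℕ → ℕ) (l : List ℕ) : ℕ := l.foldr (fun a m => max (v a) m) 0

/-- The maximal number of gates on a path that ends in the output. -/
def Circuit.depth (C : Circuit) : ℕ :=
  (wireValues 0 (fun g v => maxOver v g.args + 1) (List.replicate C.inputs 0) C.gates).getD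
    C.output 0

/-- The maximal number of large gates on a path that ends in the output. -/
def Circuit.weft (C : Circuit) : ℕ :=
  (wireValues 0 (fun g v => maxOver v g.args + (if g.isLarge then 1 else 0))
    (List.replicate C.inputs 0) C.gates).getD C.output 0

instance (t h : ℕ) : TreeEnc {C : Circuit // C.weft ≤ t ∧ C.depth ≤ h} :=
  ⟨fun C => TreeEnc.enc C.1, fun _ _ e => Subtype.ext (TreeEnc.inj e)⟩

/-- Weighted satisfiability of circuits of weft at most `t` and depth at most `h`: does the
circuit accept an input vector with exactly `k` entries equal to true, where `k` is the
parameter? -/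
def WeightedCircuitSat (t h : ℕ) : ParamProblem where
  Inst := {C : Circuit // C.weft ≤ t ∧ C.depth ≤ h}
  Yes C k := ∃ x : Fin C.1.inputs → Bool,
    (Finset.univ.filter fun i => x i = true).card = k ∧ C.1.eval x = true

/-- The class `W[t]`: reducibility to weighted satisfiability of circuits of weft at most `t` and
depth at most some constant. -/
def InW (t : ℕ) (A : ParamProblem) : Prop :=
  ∃ h : ℕ, FPTReducible A (WeightedCircuitSat t h)

/-- Hardness for `W[t]`. -/
def WHard (t : ℕ) (B : ParamProblem) : Prop :=
  ∀ A : ParamProblem, InW t A → FPTReducible A B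

/-- Completeness for `W[t]`. -/
def WComplete (t : ℕ) (B : ParamProblem) : Prop := InW t B ∧ WHard t B

/-! ### Blind multi-tape non-deterministic Turing machines -/

/-- A transition of a blind machine with `m` tapes, `s` symbols and `q` states. The neutral symbol
is `none`: as an entry of `read` it matches every symbol, as an entry of `write` it keeps the
symbol. -/
structure Transition (m s q : ℕ) where
  read : Fin m → Option (Fin s)
  src : Fin q
  write : Fin m → Option (Fin s)
  tgt : Fin q
  move : Fin m → SignType

instance (m s q : ℕ) : TreeEnc (Transition m s q) :=
  ⟨fun δ => TreeEnc.enc (δ.read, δ.src, δ.write, δ.tgt, δ.move), by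
    rintro ⟨a, b, c, d, e⟩ ⟨a', b', c', d', e'⟩ h
    have h' := TreeEnc.inj h
    simp only [Prod.mk.injEq] at h'
    obtain ⟨rfl, rfl, rfl, rfl, rfl⟩ := h'
    rfl⟩

/-- A blind multi-tape non-deterministic Turing machine, whose transition relation is given as a
list. -/
structure BlindNTM where
  tapes : ℕ
  symbols : ℕ
  states : ℕ
  tapes_pos : 0 < tapes
  blank : Fin symbols
  start : Fin states
  accepting : Fin states → Bool
  delta : List (Transition tapes symbols states)

namespace BlindNTM

/-- A configuration: the state, the positions of the heads, and the contents of the two-way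
infinite tapes. -/
structure Config (M : BlindNTM) where
  state : Fin M.states
  head : Fin M.tapes → ℤ
  cell : Fin M.tapes → ℤ → Fin M.symbols

/-- The initial configuration: the word stands on the first tape, from cell `0` on, all other cells
are blank, and all heads are at cell `0`. -/
def init (M : BlindNTM) (w : List (Fin M.symbols)) : M.Config where
  state := M.start
  head _ := 0
  cell t l := if t.val = 0 ∧ 0 ≤ l then w.getD l.toNat M.blank else M.blank

/-- The state is right, and every tape on which the transition is not neutral shows the symbol to
be read. -/
def Applicable (M : BlindNTM) (δ : Transition M.tapes M.symbols M.states) (c : M.Config) : Prop :=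
  c.state = δ.src ∧ ∀ t, δ.read t = none ∨ δ.read t = some (c.cell t (c.head t))

/-- Write (or keep) the symbols under the heads, then move the heads and change the state. -/
def apply (M : BlindNTM) (δ : Transition M.tapes M.symbols M.states) (c : M.Config) :
    M.Config where
  state := δ.tgt
  head t := c.head t + (δ.move t : ℤ)
  cell t := Function.update (c.cell t) (c.head t) ((δ.write t).getD (c.cell t (c.head t)))

/-- One step of the machine. -/
def Step (M : BlindNTM) (c c' : M.Config) : Prop :=
  ∃ δ ∈ M.delta, M.Applicable δ c ∧ c' = M.apply δ c

/-- `M.Reach n c c'`: some computation of exactly `n` steps leads from `c` to `c'`. -/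
inductive Reach (M : BlindNTM) : ℕ → M.Config → M.Config → Prop
  | refl (c : M.Config) : Reach M 0 c c
  | step {n : ℕ} {c c' c'' : M.Config} : M.Step c c' → Reach M n c' c'' → Reach M (n + 1) c c''

/-- Some computation of `M` on `w` reaches an accepting state in at most `k` steps. -/
def AcceptsWithin (M : BlindNTM) (w : List (Fin M.symbols)) (k : ℕ) : Prop :=
  ∃ n ≤ k, ∃ c : M.Config, M.Reach n (M.init w) c ∧ M.accepting c.state = true

end BlindNTM

/-- A machine with an input word. -/
structure BlindInstance where
  machine : BlindNTM
  word : List (Fin machine.symbols)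

instance : TreeEnc BlindInstance :=
  ⟨fun I => .cons
      (TreeEnc.enc (I.machine.tapes, I.machine.symbols, I.machine.states))
      (TreeEnc.enc (I.machine.blank, I.machine.start, I.machine.accepting, I.machine.delta,
        I.word)), by
    rintro ⟨⟨m, s, q, _, b, i, a, d⟩, w⟩ ⟨⟨m', s', q', _, b', i', a', d'⟩, w'⟩ h
    simp only [Val.cons.injEq] at h
    obtain ⟨h1, h2⟩ := h
    have h1' := TreeEnc.inj h1
    simp only [Prod.mk.injEq] at h1'
    obtain ⟨rfl, rfl, rfl⟩ := h1'
    have h2' := TreeEnc.inj h2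
    simp only [Prod.mk.injEq] at h2'
    obtain ⟨rfl, rfl, rfl, rfl, rfl⟩ := h2'
    rfl⟩

/-- Short Blind Multi-Tape Non-Deterministic Turing Machine Computation, parameterized by the
number of steps. -/
def ShortBlindMultiTapeNTM : ParamProblem where
  Inst := BlindInstance
  Yes I k := I.machine.AcceptsWithin I.word k

end ParamW

namespace ParamW

open TreeEnc

/-! ### Polynomial bounds in the size of an encoding -/

/-! Both halves pass through one combinatorial problem, `ColoredHittingSet`: choose one option for
each of `k` slots so that every clause is hit by a chosen option. Such an instance is a big
conjunction of big disjunctions over a choice of parameter size, which is the shape of weft two.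
Four reductions carry the theorem.

Machine to hitting set (`shortBlind_reducible_coloredHittingSet`). The slots are the times `0, …, k`
and the options are transitions. Since every tape has one of only `3 ^ k` sequences of moves, a
clause may assume a sequence `μ` and is hit at once by any transition that deviates from it. Under a
fixed `μ` the head positions are known, and "the head sees `a`" says that the last write to this
cell wrote `a`. By `conf_cell_eq_iff` this is a conjunction of disjunctions in which every disjunct
concerns the transition of a single time, hence a set of clauses.

Hitting set to circuit (`coloredHittingSet_reducible_circuitSat`). One input per option, and
positive clauses saying that every slot has an option and every clause is hit. Weight exactly `k`
then forces one option per slot. With the first reduction this gives membership.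

Circuit to hitting set (`circuitSat_reducible_coloredHittingSet`). Negations are absorbed into the
value that is asked of a wire, and small gates are multiplied out, so a circuit of weft two and
depth `h` becomes a disjunction of conjunctions of disjunctions of conjunctions of at most `2 ^ h`
literals (`outputForm_eval`). A true set of `k` variables is given by its increasing enumeration, so
that negative literals too have positive witnesses: a variable is false iff it lies strictly between
two consecutive elements. A bottom conjunction is therefore witnessed by a tuple of at most `2 ^ h`
gaps. There is one slot for every tuple of gap indices, and consistency clauses tie these slots to
the enumeration; one further slot names the true disjunct at the top.

Hitting set to machine (`coloredHittingSet_reducible_shortBlind`). One tape per clause: `k` steps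
choose options and mark the tapes of the clauses that are hit, and one more step reads all tapes at
once. Neutral symbols make a single transition per option sufficient, whatever the tapes contain.
With the third reduction this gives hardness.

Running times are handled by the class `PT` of polynomial-time functions on encodings, which is
closed under the usual list operations, so that `fun_prop` can certify most of the reductions. Only
the list of all move sequences needs more than polynomial time; it depends on `k` alone
(`FPTReducible.of_aux`). -/

theorem Val.size_pos (v : Val) : 0 < v.size := by
  cases v <;> simp [Val.size]

instance : TreeEnc Unit := ⟨fun _ => .nil, fun _ _ _ => rfl⟩

/-- The tags are the encodings of `false` and `true`, so the first component of an encoded sum is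
the Boolean `isRight`. -/
instance {α β : Type} [TreeEnc α] [TreeEnc β] : TreeEnc (α ⊕ β) :=
  ⟨fun x => match x with
    | .inl a => .cons .nil (enc a)
    | .inr b => .cons (.cons .nil .nil) (enc b), by
      intro a b h
      cases a <;> cases b <;> simp at h ⊢ <;> exact TreeEnc.inj h⟩

section
variable {α β γ σ : Type} [TreeEnc α] [TreeEnc β] [TreeEnc γ] [TreeEnc σ]

/-- The size of the encoding of an object. -/
def esz (a : α) : ℕ := (enc a).size

theorem esz_pos (a : α) : 0 < esz a := Val.size_pos _

theorem esz_pair (a : α) (b : β) : esz (a, b) = esz a + esz b + 1 := rfl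

theorem esz_nil : esz ([] : List α) = 1 := rfl

theorem esz_cons (a : α) (l : List α) : esz (a :: l) = esz a + esz l + 1 := rfl

theorem esz_nat (n : ℕ) : esz n = 2 * n + 1 := by
  induction n with
  | zero => rfl
  | succ n ih =>
    have : esz (n + 1) = 1 + esz n + 1 := rfl
    omega

theorem esz_bool_le (b : Bool) : esz b ≤ 3 := by
  cases b <;> simp [esz, enc, Val.size]

theorem esz_append (l l' : List α) : esz (l ++ l') + 1 = esz l + esz l' := by
  induction l with
  | nil => simp [esz_nil]; omega
  | cons a l ih => simp only [List.cons_append, esz_cons]; omega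

theorem esz_reverse (l : List α) : esz l.reverse = esz l := by
  induction l with
  | nil => rfl
  | cons a l ih =>
    have := esz_append l.reverse [a]
    simp only [List.reverse_cons, esz_cons, esz_nil] at *
    omega

theorem esz_mem_lt {l : List α} {a : α} (h : a ∈ l) : esz a < esz l := by
  induction l with
  | nil => simp at h
  | cons b l ih =>
    rw [esz_cons]
    rcases List.mem_cons.1 h with rfl | h
    · have := esz_pos l; omega
    · have := ih h; omega

theorem length_lt_esz (l : List α) : l.length < esz l := by
  induction l with
  | nil => simp [esz_nil]
  | cons a l ih => rw [esz_cons, List.length_cons]; have := esz_pos a; omega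

theorem esz_prefix_le {l l' : List α} (h : l' <+: l) : esz l' ≤ esz l := by
  obtain ⟨m, rfl⟩ := h
  have := esz_append l' m
  have := esz_pos m
  omega

theorem esz_list_le (l : List α) (B : ℕ) (h : ∀ a ∈ l, esz a ≤ B) :
    esz l ≤ l.length * (B + 1) + 1 := by
  induction l with
  | nil => simp [esz_nil]
  | cons a l ih =>
    have h1 := ih fun b hb => h b (List.mem_cons_of_mem _ hb)
    have h2 := h a List.mem_cons_self
    rw [esz_cons, List.length_cons, Nat.succ_mul]
    omega

theorem esz_tail_le (l : List α) : esz l.tail ≤ esz l := by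
  cases l with
  | nil => exact le_rfl
  | cons a l => rw [esz_cons]; simp; omega

theorem esz_flatten_le (l : List (List α)) : esz l.flatten ≤ esz l := by
  induction l with
  | nil => exact le_rfl
  | cons a l ih =>
    have := esz_append a l.flatten
    rw [List.flatten_cons, esz_cons]
    omega

/-- `T` is bounded by a polynomial in the size of its argument. -/
def PB (T : α → ℕ) : Prop := ∃ c : ℕ, ∀ a, T a ≤ (esz a + 1) ^ c

theorem PB.mono {T U : α → ℕ} (hU : PB U) (h : ∀ a, T a ≤ U a) : PB T := by
  obtain ⟨c, hc⟩ := hU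
  exact ⟨c, fun a => (h a).trans (hc a)⟩

theorem PB.size : PB (fun a : α => esz a) := ⟨1, fun a => by simp⟩

/-- The base `esz a + 1` is at least two, so `n ≤ 2 ^ n` makes the exponent `n` sufficient. For the
same reason one extra factor absorbs a sum in `PB.add`. -/
theorem PB.const (n : ℕ) : PB (fun _ : α => n) :=
  ⟨n, fun a => (Nat.lt_two_pow_self).le.trans
    (Nat.pow_le_pow_left (by have := esz_pos a; omega) n)⟩

theorem PB.mul {T U : α → ℕ} (hT : PB T) (hU : PB U) : PB (fun a => T a * U a) := by
  obtain ⟨c, hc⟩ := hT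
  obtain ⟨d, hd⟩ := hU
  exact ⟨c + d, fun a => by rw [pow_add]; exact Nat.mul_le_mul (hc a) (hd a)⟩

theorem PB.add {T U : α → ℕ} (hT : PB T) (hU : PB U) : PB (fun a => T a + U a) := by
  obtain ⟨c, hc⟩ := hT
  obtain ⟨d, hd⟩ := hU
  refine ⟨max c d + 1, fun a => ?_⟩
  have h2 : 2 ≤ esz a + 1 := by have := esz_pos a; omega
  have h1 : (esz a + 1) ^ c ≤ (esz a + 1) ^ max c d := Nat.pow_le_pow_right (by omega) (by simp)
  have h3 : (esz a + 1) ^ d ≤ (esz a + 1) ^ max c d := Nat.pow_le_pow_right (by omega) (by simp)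
  have h4 := Nat.mul_le_mul_left ((esz a + 1) ^ max c d) h2
  have h5 := hc a
  have h6 := hd a
  beta_reduce
  rw [pow_succ]
  omega

theorem PB.pow {T : α → ℕ} (hT : PB T) (n : ℕ) : PB (fun a => T a ^ n) := by
  induction n with
  | zero => simpa using PB.const 1
  | succ n ih => simpa only [pow_succ] using ih.mul hT

theorem PB.comp {T : β → ℕ} (hT : PB T) {f : α → β} (hf : PB fun a => esz (f a)) :
    PB (fun a => T (f a)) := by
  obtain ⟨c, hc⟩ := hT
  exact ((hf.add (PB.const 1)).pow c).mono fun a => hc (f a)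

/-! ### Functions computable in polynomial time -/

/-- `f` is computed on encodings by a program in polynomial time, with output of polynomial
size. -/
@[fun_prop]
def PT (f : α → β) : Prop :=
  ∃ (p : Prog) (T : α → ℕ), (∀ a, Runs p (enc a) (enc (f a)) (T a)) ∧ PB T ∧
    PB (fun a => esz (f a))

theorem PT.pb {f : α → β} (hf : PT f) : PB (fun a => esz (f a)) := hf.choose_spec.choose_spec.2.2

theorem PT.of_enc_eq_self {f : α → β} (h : ∀ a, enc (f a) = enc a) : PT f :=
  ⟨.id, fun _ => 1, fun a => by rw [h]; exact .id _, PB.const 1,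
    PB.size.mono fun a => by rw [esz, h, esz]⟩

@[fun_prop]
theorem PT.id : PT (fun a : α => a) := PT.of_enc_eq_self fun _ => rfl

@[fun_prop]
theorem PT.comp {f : β → γ} {g : α → β} (hf : PT f) (hg : PT g) : PT (fun a => f (g a)) := by
  obtain ⟨p, T, hp, hT, hs⟩ := hf
  obtain ⟨q, U, hq, hU, hr⟩ := hg
  exact ⟨.seq q p, fun a => U a + T (g a) + 1, fun a => .seq (hq a) (hp _),
    (hU.add (hT.comp hr)).add (PB.const 1), hs.comp hr⟩

/-- Programs see only encodings. Objects of dependent types, such as circuits and machines, can thus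
be produced as plain lists of numbers with the same encoding, and their proof fields cost nothing.
-/
theorem PT.congr_enc {γ : Type} [TreeEnc γ] {f : α → β} {g : α → γ} (hf : PT f)
    (h : ∀ a, enc (g a) = enc (f a)) : PT g := by
  obtain ⟨p, T, hp, hT, hs⟩ := hf
  exact ⟨p, T, fun a => by rw [h]; exact hp a, hT, hs.mono fun a => by rw [esz, h, esz]⟩

theorem PT.of_eq {f g : α → β} (hf : PT f) (h : ∀ a, g a = f a) : PT g :=
  hf.congr_enc fun a => by rw [h]

theorem exists_runs_const (w : Val) : ∃ (p : Prog) (t : ℕ), ∀ v, Runs p v w t := by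
  induction w with
  | nil => exact ⟨.nil, 1, fun v => .nil v⟩
  | cons a b iha ihb =>
    obtain ⟨p, s, hp⟩ := iha
    obtain ⟨q, t, hq⟩ := ihb
    exact ⟨.cons p q, s + t + 1, fun v => .cons (hp v) (hq v)⟩

@[fun_prop]
theorem PT.const (b : β) : PT (fun _ : α => b) := by
  obtain ⟨p, t, hp⟩ := exists_runs_const (enc b)
  exact ⟨p, fun _ => t, fun a => hp _, PB.const t, PB.const _⟩

@[fun_prop]
theorem PT.pair {f : α → β} {g : α → γ} (hf : PT f) (hg : PT g) : PT (fun a => (f a, g a)) := by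
  obtain ⟨p, T, hp, hT, hs⟩ := hf
  obtain ⟨q, U, hq, hU, hr⟩ := hg
  exact ⟨.cons p q, fun a => T a + U a + 1, fun a => .cons (hp a) (hq a),
    (hT.add hU).add (PB.const 1), (hs.add hr).add (PB.const 1)⟩

@[fun_prop]
theorem PT.fst {f : α → β × γ} (hf : PT f) : PT (fun a => (f a).1) := by
  obtain ⟨p, T, hp, hT, hs⟩ := hf
  exact ⟨.seq p .hd, fun a => T a + 1 + 1, fun a => .seq (hp a) (.hd _),
    (hT.add (PB.const 1)).add (PB.const 1), hs.mono fun a => by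
      have : esz (f a) = esz (f a).1 + esz (f a).2 + 1 := rfl
      beta_reduce
      omega⟩

@[fun_prop]
theorem PT.snd {f : α → β × γ} (hf : PT f) : PT (fun a => (f a).2) := by
  obtain ⟨p, T, hp, hT, hs⟩ := hf
  exact ⟨.seq p .tl, fun a => T a + 1 + 1, fun a => .seq (hp a) (.tl _),
    (hT.add (PB.const 1)).add (PB.const 1), hs.mono fun a => by
      have : esz (f a) = esz (f a).1 + esz (f a).2 + 1 := rfl
      beta_reduce
      omega⟩

theorem PT.of_exists_runs {f : α → β} {p : Prog} {T : α → ℕ}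
    (hp : ∀ a, ∃ t ≤ T a, Runs p (enc a) (enc (f a)) t) (hT : PB T)
    (hs : PB fun a => esz (f a)) : PT f := by
  choose U hU hp using hp
  exact ⟨p, U, hp, hT.mono hU, hs⟩

/-- Branching on whether the encoding of `c a` is the atom. -/
theorem PT.ite_runs {c : α → σ} {h : α → β} {p q : Prog} {T U : α → ℕ} (hc : PT c)
    (hp : ∀ a, enc (c a) ≠ .nil → ∃ t ≤ T a, Runs p (enc a) (enc (h a)) t)
    (hq : ∀ a, enc (c a) = .nil → ∃ t ≤ U a, Runs q (enc a) (enc (h a)) t)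
    (hT : PB T) (hU : PB U) (hs : PB fun a => esz (h a)) : PT h := by
  obtain ⟨r, V, hr, hV, -⟩ := hc
  refine PT.of_exists_runs (p := .ite r p q) (T := fun a => V a + (T a + U a) + 1) (fun a => ?_)
    ((hV.add (hT.add hU)).add (PB.const 1)) hs
  by_cases hn : enc (c a) = .nil
  · obtain ⟨t, ht, h⟩ := hq a hn
    exact ⟨V a + t + 1, by omega, .ite_false (hn ▸ hr a) h⟩
  · obtain ⟨t, ht, h⟩ := hp a hn
    exact ⟨V a + t + 1, by omega, .ite_true (hr a) hn h⟩

theorem PT.ite_enc {c : α → σ} {f g h : α → β} (hc : PT c) (hf : PT f) (hg : PT g)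
    (h1 : ∀ a, enc (c a) ≠ .nil → h a = f a) (h2 : ∀ a, enc (c a) = .nil → h a = g a) :
    PT h := by
  obtain ⟨p, T, hp, hT, hs⟩ := hf
  obtain ⟨q, U, hq, hU, ht⟩ := hg
  refine PT.ite_runs (p := p) (q := q) hc (fun a hn => ⟨T a, le_rfl, by rw [h1 a hn]; exact hp a⟩)
    (fun a hn => ⟨U a, le_rfl, by rw [h2 a hn]; exact hq a⟩) hT hU ((hs.add ht).mono fun a => ?_)
  by_cases hn : enc (c a) = .nil
  · rw [h2 a hn]; omega
  · rw [h1 a hn]; omega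

@[fun_prop]
theorem PT.cond {c : α → Bool} {f g : α → β} (hc : PT c) (hf : PT f) (hg : PT g) :
    PT (fun a => bif c a then f a else g a) :=
  hc.ite_enc hf hg (fun a h => by cases hca : c a <;> simp_all [enc])
    (fun a h => by cases hca : c a <;> simp_all [enc])

@[fun_prop]
theorem PT.listCons {f : α → β} {g : α → List β} (hf : PT f) (hg : PT g) :
    PT (fun a => f a :: g a) :=
  (hf.pair hg).congr_enc fun _ => rfl

@[fun_prop]
theorem PT.tail {f : α → List β} (hf : PT f) : PT (fun a => (f a).tail) := by
  obtain ⟨p, T, hp, hT, hs⟩ := hf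
  refine ⟨.seq p .tl, fun a => T a + 1 + 1, fun a => .seq (hp a) ?_,
    (hT.add (PB.const 1)).add (PB.const 1), hs.mono fun a => esz_tail_le _⟩
  beta_reduce
  cases f a with
  | nil => exact .tl (enc ([] : List β))
  | cons b l => exact .tl (enc (b :: l))

@[fun_prop]
theorem PT.headD {f : α → List β} {d : α → β} (hf : PT f) (hd : PT d) :
    PT (fun a => (f a).headD (d a)) := by
  have hf' := hf
  obtain ⟨p, T, hp, hT, hs⟩ := hf
  obtain ⟨q, U, hq, hU, ht⟩ := hd
  refine PT.ite_runs (p := .seq p .hd) (q := q) (T := fun a => T a + 1 + 1) hf' (fun a hn => ?_)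
    (fun a hn => ⟨U a, le_rfl, ?_⟩) ((hT.add (PB.const 1)).add (PB.const 1)) hU
    ((hs.add ht).mono fun a => ?_)
  · refine ⟨_, le_rfl, .seq (hp a) ?_⟩
    cases hl : f a with
    | nil => rw [hl] at hn; exact absurd rfl hn
    | cons b l => exact .hd (enc (b :: l))
  · cases hl : f a with
    | nil => exact hq a
    | cons b l => rw [hl] at hn; cases hn
  · cases hl : f a with
    | nil => simp
    | cons b l => simp [esz_cons]; omega

theorem PT.isRight {f : α → β ⊕ γ} (hf : PT f) : PT (fun a => (f a).isRight) := by
  obtain ⟨p, T, hp, hT, hs⟩ := hf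
  refine ⟨.seq p .hd, fun a => T a + 1 + 1, fun a => .seq (hp a) ?_,
    (hT.add (PB.const 1)).add (PB.const 1), (PB.const 3).mono fun a => esz_bool_le _⟩
  beta_reduce
  cases f a with
  | inl b => exact .hd (enc (Sum.inl b : β ⊕ γ))
  | inr b => exact .hd (enc (Sum.inr b : β ⊕ γ))

theorem esz_inl (b : β) : esz (Sum.inl b : β ⊕ γ) = esz b + 2 := by
  have : esz (Sum.inl b : β ⊕ γ) = 1 + esz b + 1 := rfl
  omega

theorem esz_inr (b : γ) : esz (Sum.inr b : β ⊕ γ) = esz b + 4 := by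
  have : esz (Sum.inr b : β ⊕ γ) = (1 + 1 + 1) + esz b + 1 := rfl
  omega

@[fun_prop]
theorem PT.sumElim {f : α → β ⊕ γ} {F : α → β → σ} {G : α → γ → σ} (hf : PT f)
    (hF : PT (fun p : α × β => F p.1 p.2)) (hG : PT (fun p : α × γ => G p.1 p.2)) :
    PT (fun a => Sum.elim (F a) (G a) (f a)) := by
  have hf' := hf.isRight
  obtain ⟨r, V, hr, hV, hw⟩ := hf
  obtain ⟨p, T, hp, ⟨c, hT⟩, ⟨c', hs⟩⟩ := hF
  obtain ⟨q, U, hq, ⟨d, hU⟩, ⟨d', ht⟩⟩ := hG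
  have hB : PB (fun a => esz a + esz (f a) + 2) := (PB.size.add hw).add (PB.const 2)
  -- The tag of `inr` counts as true, hence `q` comes first. Both branches receive the input paired
  -- with the untagged content.
  refine PT.ite_runs (p := .seq (.cons .id (.seq r .tl)) q) (q := .seq (.cons .id (.seq r .tl)) p)
    (T := fun a => V a + (esz a + esz (f a) + 2) ^ d + 5)
    (U := fun a => V a + (esz a + esz (f a) + 2) ^ c + 5) hf'
    (fun a hn => ?_) (fun a hn => ?_) ((hV.add (hB.pow d)).add (PB.const 5))
    ((hV.add (hB.pow c)).add (PB.const 5)) (((hB.pow c').add (hB.pow d')).mono fun a => ?_)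
  · cases hx : f a with
    | inl b => rw [hx] at hn; exact absurd rfl hn
    | inr b =>
      have h1 := hr a
      rw [hx] at h1
      refine ⟨_, ?_, .seq (.cons (.id _) (.seq h1 (.tl _))) (hq (a, b))⟩
      have h2 := hU (a, b)
      have h3 : (esz (a, b) + 1) ^ d ≤ (esz a + esz (Sum.inr b : β ⊕ γ) + 2) ^ d :=
        Nat.pow_le_pow_left (by rw [esz_pair, esz_inr]; omega) _
      omega
  · cases hx : f a with
    | inr b => rw [hx] at hn; cases hn
    | inl b =>
      have h1 := hr a
      rw [hx] at h1
      refine ⟨_, ?_, .seq (.cons (.id _) (.seq h1 (.tl _))) (hp (a, b))⟩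
      have h2 := hT (a, b)
      have h3 : (esz (a, b) + 1) ^ c ≤ (esz a + esz (Sum.inl b : β ⊕ γ) + 2) ^ c :=
        Nat.pow_le_pow_left (by rw [esz_pair, esz_inl]; omega) _
      omega
  · cases hx : f a with
    | inr b =>
      have h2 := ht (a, b)
      have h3 : (esz (a, b) + 1) ^ d' ≤ (esz a + esz (Sum.inr b : β ⊕ γ) + 2) ^ d' :=
        Nat.pow_le_pow_left (by rw [esz_pair, esz_inr]; omega) _
      simp only [Sum.elim_inr] at *
      omega
    | inl b =>
      have h2 := hs (a, b)
      have h3 : (esz (a, b) + 1) ^ c' ≤ (esz a + esz (Sum.inl b : β ⊕ γ) + 2) ^ c' :=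
        Nat.pow_le_pow_left (by rw [esz_pair, esz_inl]; omega) _
      simp only [Sum.elim_inl] at *
      omega

@[fun_prop]
theorem PT.inl {f : α → β} (hf : PT f) : PT (fun a => (Sum.inl (f a) : β ⊕ γ)) :=
  ((PT.const ()).pair hf).congr_enc fun _ => rfl

@[fun_prop]
theorem PT.inr {f : α → γ} (hf : PT f) : PT (fun a => (Sum.inr (f a) : β ⊕ γ)) :=
  ((PT.const true).pair hf).congr_enc fun _ => rfl

/-! ### Folds -/

/-- The program that folds the program `p` over the list in the first component. -/
def foldProg (p : Prog) : Prog :=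
  .loop .hd (.cons (.seq .hd .tl) (.cons (.seq .tl .hd)
    (.seq (.cons (.seq .tl .hd) (.cons (.seq .tl .tl) (.seq .hd .hd))) p)))

/-- The loop carries the remaining list, the fixed environment `e` and the accumulator. The
remaining list is the first component, and it is the atom exactly when it is empty, so `hd` is the
loop test. The summand `25` covers the bookkeeping of one round. -/
theorem runs_foldProg {p : Prog} {e : Val} {B : ℕ} {step : σ → β → σ} (l : List β) (s : σ)
    (h : ∀ l₁ b l₂, l = l₁ ++ b :: l₂ → ∃ t ≤ B,
      Runs p (.cons e (.cons (enc (l₁.foldl step s)) (enc b)))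
        (enc (step (l₁.foldl step s) b)) t) :
    ∃ t ≤ l.length * (B + 25) + 2,
      Runs (foldProg p) (.cons (enc l) (.cons e (enc s)))
        (.cons .nil (.cons e (enc (l.foldl step s)))) t := by
  induction l generalizing s with
  | nil => exact ⟨1 + 1, by simp, .loop_done (.hd _)⟩
  | cons b l ih =>
    obtain ⟨t, ht, hr⟩ := h [] b l rfl
    obtain ⟨u, hu, hr'⟩ := ih (step s b) fun l₁ b' l₂ hl => by
      obtain ⟨t, ht⟩ := h (b :: l₁) b' l₂ (by rw [hl, List.cons_append])
      exact ⟨t, ht⟩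
    refine ⟨_, ?_, .loop_step (.hd _) (by simp [Val.hd, enc, encList])
      (.cons (.seq (.hd _) (.tl _)) (.cons (.seq (.tl _) (.hd _))
        (.seq (.cons (.seq (.tl _) (.hd _)) (.cons (.seq (.tl _) (.tl _))
          (.seq (.hd _) (.hd _)))) hr))) hr'⟩
    rw [List.length_cons, Nat.succ_mul]
    omega

/-- Iterating a polynomial-time step can produce exponentially large values, so a polynomial bound
`S` on all intermediate accumulators has to be supplied. These are the folds over prefixes of the
list. -/
theorem PT.foldl {l : α → List β} {init : α → σ} {step : α → σ → β → σ} (hl : PT l)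
    (hi : PT init) (hs : PT (fun p : α × σ × β => step p.1 p.2.1 p.2.2)) {S : α → ℕ} (hS : PB S)
    (hb : ∀ a l', l' <+: l a → esz (l'.foldl (step a) (init a)) ≤ S a) :
    PT (fun a => (l a).foldl (step a) (init a)) := by
  obtain ⟨pl, Tl, hpl, hTl, hsl⟩ := hl
  obtain ⟨pi, Ti, hpi, hTi, hsi⟩ := hi
  obtain ⟨p, T, hp, ⟨c, hT⟩, -⟩ := hs
  have hB : PB (fun a => (esz a + S a + esz (l a) + 3) ^ c) :=
    (((PB.size.add hS).add hsl).add (PB.const 3)).pow c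
  refine PT.of_exists_runs (p := .seq (.cons pl (.cons .id pi)) (.seq (foldProg p) (.seq .tl .tl)))
    (T := fun a => Tl a + Ti a + esz (l a) * ((esz a + S a + esz (l a) + 3) ^ c + 25) + 15)
    (fun a => ?_) (((hTl.add hTi).add (hsl.mul (hB.add (PB.const 25)))).add (PB.const 15))
    (hS.mono fun a => hb a _ List.prefix_rfl)
  obtain ⟨t, ht, hr⟩ := runs_foldProg (p := p) (e := enc a) (step := step a)
    (B := (esz a + S a + esz (l a) + 3) ^ c) (l a) (init a) fun l₁ b l₂ h => by
      refine ⟨_, (hT (a, l₁.foldl (step a) (init a), b)).trans (Nat.pow_le_pow_left ?_ _),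
        hp (a, l₁.foldl (step a) (init a), b)⟩
      have h1 := hb a l₁ ⟨b :: l₂, h.symm⟩
      have h2 : b ∈ l a := by rw [h]; simp
      have h3 := esz_mem_lt h2
      rw [esz_pair, esz_pair]
      omega
  refine ⟨_, ?_, .seq (.cons (hpl a) (.cons (.id _) (hpi a))) (.seq hr (.seq (.tl _) (.tl _)))⟩
  have h4 := Nat.mul_le_mul_right ((esz a + S a + esz (l a) + 3) ^ c + 25) (length_lt_esz (l a)).le
  omega

end

section
variable {α β γ σ : Type} [TreeEnc α] [TreeEnc β] [TreeEnc γ] [TreeEnc σ]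

/-! ### Arithmetic, Boolean operations and lists -/

@[fun_prop]
theorem PT.not {f : α → Bool} (hf : PT f) : PT (fun a => !(f a)) :=
  (hf.cond (PT.const false) (PT.const true)).of_eq fun a => by cases f a <;> rfl

@[fun_prop]
theorem PT.and {f g : α → Bool} (hf : PT f) (hg : PT g) : PT (fun a => f a && g a) :=
  (hf.cond hg (PT.const false)).of_eq fun a => by cases f a <;> rfl

@[fun_prop]
theorem PT.or {f g : α → Bool} (hf : PT f) (hg : PT g) : PT (fun a => f a || g a) :=
  (hf.cond (PT.const true) hg).of_eq fun a => by cases f a <;> rfl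

@[fun_prop]
theorem PT.beqBool {f g : α → Bool} (hf : PT f) (hg : PT g) : PT (fun a => f a == g a) :=
  (hf.cond hg hg.not).of_eq fun a => by cases f a <;> cases g a <;> rfl

theorem foldl_cons_eq {β : Type} (l s : List β) : l.foldl (fun acc b => b :: acc) s = l.reverse ++ s := by
  induction l generalizing s with
  | nil => rfl
  | cons b l ih => simp [ih]

theorem PT.reverseAppend {f g : α → List β} (hf : PT f) (hg : PT g) :
    PT (fun a => (f a).reverse ++ g a) := by
  refine (PT.foldl (l := f) (init := g) (step := fun _ acc b => b :: acc)
    (S := fun a => esz (f a) + esz (g a)) hf hg (by fun_prop) (hf.pb.add hg.pb) ?_).of_eq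
    fun a => (foldl_cons_eq _ _).symm
  intro a l' h
  rw [foldl_cons_eq]
  have h1 := esz_append l'.reverse (g a)
  rw [esz_reverse] at h1
  have h2 := esz_prefix_le h
  omega

@[fun_prop]
theorem PT.reverse {f : α → List β} (hf : PT f) : PT (fun a => (f a).reverse) :=
  (hf.reverseAppend (PT.const [])).of_eq fun a => by simp

@[fun_prop]
theorem PT.append {f g : α → List β} (hf : PT f) (hg : PT g) : PT (fun a => f a ++ g a) :=
  (hf.reverse.reverseAppend hg).of_eq fun a => by simp

@[fun_prop]
theorem PT.map {l : α → List β} {F : α → β → γ} (hl : PT l)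
    (hF : PT (fun p : α × β => F p.1 p.2)) : PT (fun a => (l a).map (F a)) := by
  obtain ⟨c, hc⟩ := hF.pb
  have key : ∀ (a : α) (m : List β) (s : List γ),
      m.foldl (fun acc b => F a b :: acc) s = (m.map (F a)).reverse ++ s := by
    intro a m
    induction m with
    | nil => intro s; rfl
    | cons b m ih => intro s; simp [ih]
  have hB : PB fun a => (esz a + esz (l a) + 2) ^ c :=
    ((PB.size.add hl.pb).add (PB.const 2)).pow c
  refine (PT.foldl (l := l) (init := fun _ => []) (step := fun a acc b => F a b :: acc)
    (S := fun a => esz (l a) * ((esz a + esz (l a) + 2) ^ c + 1) + 1) hl (PT.const [])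
    (PT.listCons (hF.comp (f := fun p : α × β => F p.1 p.2)
      (g := fun p : α × List γ × β => (p.1, p.2.2)) (by fun_prop)) (by fun_prop))
    ((hl.pb.mul (hB.add (PB.const 1))).add (PB.const 1)) ?_).reverse.of_eq fun a => by
      rw [key]; simp
  intro a l' h
  rw [key, List.append_nil, esz_reverse]
  refine (esz_list_le _ ((esz a + esz (l a) + 2) ^ c) ?_).trans ?_
  · intro x hx
    obtain ⟨b, hb, rfl⟩ := List.mem_map.1 hx
    refine (hc (a, b)).trans (Nat.pow_le_pow_left ?_ _)
    have := esz_mem_lt (h.subset hb)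
    rw [esz_pair]
    omega
  · have h1 := (length_lt_esz l').le.trans (esz_prefix_le h)
    have := Nat.mul_le_mul_right ((esz a + esz (l a) + 2) ^ c + 1) h1
    rw [List.length_map]
    omega

@[fun_prop]
theorem PT.flatten {f : α → List (List β)} (hf : PT f) : PT (fun a => (f a).flatten) := by
  have key : ∀ (m : List (List β)) (s : List β),
      m.foldl (fun acc b => acc ++ b) s = s ++ m.flatten := by
    intro m
    induction m with
    | nil => simp
    | cons b m ih => intro s; simp [ih]
  refine (PT.foldl (l := f) (init := fun _ => []) (step := fun _ acc b => acc ++ b)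
    (S := fun a => esz (f a)) hf (PT.const []) (by fun_prop) hf.pb ?_).of_eq fun a => by
      rw [key]; rfl
  intro a l' h
  rw [key, List.nil_append]
  exact (esz_flatten_le _).trans (esz_prefix_le h)

@[fun_prop]
theorem PT.flatMap {l : α → List β} {F : α → β → List γ} (hl : PT l)
    (hF : PT (fun p : α × β => F p.1 p.2)) : PT (fun a => (l a).flatMap (F a)) :=
  (hl.map hF).flatten.of_eq fun _ => List.flatMap_def

@[fun_prop]
theorem PT.all {l : α → List β} {F : α → β → Bool} (hl : PT l)
    (hF : PT (fun p : α × β => F p.1 p.2)) : PT (fun a => (l a).all (F a)) := by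
  have key : ∀ (a : α) (m : List β) (s : Bool),
      m.foldl (fun acc b => acc && F a b) s = (s && m.all (F a)) := by
    intro a m
    induction m with
    | nil => simp
    | cons b m ih => intro s; simp [ih, Bool.and_assoc]
  exact (PT.foldl (l := l) (init := fun _ => true) (step := fun a acc b => acc && F a b)
    (S := fun _ => 3) hl (PT.const true) (PT.and (by fun_prop)
      (hF.comp (f := fun p : α × β => F p.1 p.2)
        (g := fun p : α × Bool × β => (p.1, p.2.2)) (by fun_prop)))
    (PB.const 3) fun _ _ _ => esz_bool_le _).of_eq fun a => by rw [key]; simp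

@[fun_prop]
theorem PT.any {l : α → List β} {F : α → β → Bool} (hl : PT l)
    (hF : PT (fun p : α × β => F p.1 p.2)) : PT (fun a => (l a).any (F a)) :=
  (hl.all (F := fun a b => !F a b) hF.not).not.of_eq fun a => by simp [List.any_eq_not_all_not]

@[fun_prop]
theorem PT.filter {l : α → List β} {F : α → β → Bool} (hl : PT l)
    (hF : PT (fun p : α × β => F p.1 p.2)) : PT (fun a => (l a).filter (F a)) := by
  refine (hl.flatMap (F := fun a b => bif F a b then [b] else [])
    (hF.cond (by fun_prop) (by fun_prop))).of_eq fun a => ?_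
  induction l a with
  | nil => rfl
  | cons b m ih => cases h : F a b <;> simp [h, ih]

@[fun_prop]
theorem PT.succ {f : α → ℕ} (hf : PT f) : PT (fun a => f a + 1) :=
  ((PT.const ()).pair hf).congr_enc fun _ => rfl

/-- A unary number has the encoding of a list of units, so loops over numbers are folds over lists.
-/
theorem enc_nat_eq (n : ℕ) : enc n = enc (List.replicate n ()) := by
  induction n with
  | zero => rfl
  | succ n ih => exact congrArg (Val.cons .nil) ih

theorem PT.replicateUnit {f : α → ℕ} (hf : PT f) : PT (fun a => List.replicate (f a) ()) :=
  hf.congr_enc fun _ => (enc_nat_eq _).symm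

@[fun_prop]
theorem PT.length {f : α → List β} (hf : PT f) : PT (fun a => (f a).length) :=
  (hf.map (F := fun _ _ => ()) (PT.const ())).congr_enc fun a => by
    rw [enc_nat_eq, List.map_const']

theorem foldl_unit {σ : Type} (g : σ → σ) (n : ℕ) (s : σ) :
    (List.replicate n ()).foldl (fun acc _ => g acc) s = g^[n] s := by
  induction n generalizing s with
  | zero => rfl
  | succ n ih => simp [List.replicate_succ, ih]

theorem PT.iterate {n : α → ℕ} {init : α → σ} {step : σ → σ} (hn : PT n) (hi : PT init)
    (hs : PT step) {S : α → ℕ} (hS : PB S)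
    (hb : ∀ a, ∀ i ≤ n a, esz (step^[i] (init a)) ≤ S a) :
    PT (fun a => step^[n a] (init a)) := by
  refine (PT.foldl (l := fun a => List.replicate (n a) ()) (init := init)
    (step := fun _ acc _ => step acc) (S := S) hn.replicateUnit hi (by fun_prop) hS ?_).of_eq
    fun a => (foldl_unit _ _ _).symm
  intro a l' h
  obtain ⟨h1, h2⟩ := List.prefix_replicate_iff.1 h
  rw [h2, foldl_unit]
  exact hb a _ h1

@[fun_prop]
theorem PT.add {f g : α → ℕ} (hf : PT f) (hg : PT g) : PT (fun a => f a + g a) := by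
  have key : ∀ n m : ℕ, (fun x => x + 1)^[n] m = m + n := by
    intro n; induction n with
    | zero => simp
    | succ n ih => intro m; rw [Function.iterate_succ_apply, ih]; omega
  refine (PT.iterate (step := fun x : ℕ => x + 1) (S := fun a => esz (f a) + esz (g a)) hg hf
    (by fun_prop) (hf.pb.add hg.pb) ?_).of_eq fun a => (key _ _).symm
  intro a i hi
  rw [key]
  simp only [esz_nat]
  omega

theorem PT.pred {f : α → ℕ} (hf : PT f) : PT (fun a => f a - 1) :=
  hf.replicateUnit.tail.congr_enc fun a => by rw [enc_nat_eq]; simp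

@[fun_prop]
theorem PT.sub {f g : α → ℕ} (hf : PT f) (hg : PT g) : PT (fun a => f a - g a) := by
  have key : ∀ n m : ℕ, (fun x => x - 1)^[n] m = m - n := by
    intro n; induction n with
    | zero => simp
    | succ n ih => intro m; rw [Function.iterate_succ_apply, ih]; omega
  refine (PT.iterate (step := fun x : ℕ => x - 1) (S := fun a => esz (f a)) hg hf
    PT.id.pred hf.pb ?_).of_eq fun a => (key _ _).symm
  intro a i hi
  rw [key]
  simp only [esz_nat]
  omega

-- The truncated difference is encoded by the atom exactly when the comparison holds, so the
-- difference itself serves as the branch condition.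
@[fun_prop]
theorem PT.ble {f g : α → ℕ} (hf : PT f) (hg : PT g) : PT (fun a => Nat.ble (f a) (g a)) := by
  refine PT.ite_enc (hf.sub hg) (PT.const false) (PT.const true) (fun a h => ?_) (fun a h => ?_)
  · rw [Bool.eq_false_iff]
    intro h'
    rw [Nat.ble_eq] at h'
    exact h (by simp [Nat.sub_eq_zero_of_le h', enc, encNat])
  · rw [Nat.ble_eq]
    have h1 : enc (f a - g a) = enc 0 := h
    have := TreeEnc.inj h1
    omega

theorem blt_iff {m n : ℕ} : Nat.blt m n = true ↔ m < n := by
  rw [Nat.blt, Nat.ble_eq, Nat.succ_le_iff]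

@[fun_prop]
theorem PT.blt {f g : α → ℕ} (hf : PT f) (hg : PT g) : PT (fun a => Nat.blt (f a) (g a)) :=
  hf.succ.ble hg

@[fun_prop]
theorem PT.beqNat {f g : α → ℕ} (hf : PT f) (hg : PT g) : PT (fun a => f a == g a) :=
  ((hf.ble hg).and (hg.ble hf)).of_eq fun a => by
    rw [Bool.eq_iff_iff, beq_iff_eq, Bool.and_eq_true, Nat.ble_eq, Nat.ble_eq]; omega

theorem iterate_snoc_length (n : ℕ) :
    (fun l : List ℕ => l ++ [l.length])^[n] [] = List.range n := by
  induction n with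
  | zero => rfl
  | succ n ih => rw [Function.iterate_succ_apply', ih, List.range_succ, List.length_range]

@[fun_prop]
theorem PT.range {f : α → ℕ} (hf : PT f) : PT (fun a => List.range (f a)) := by
  refine (PT.iterate (step := fun l : List ℕ => l ++ [l.length]) (init := fun _ => [])
    (S := fun a => esz (f a) * (esz (f a) + 1) + 1) hf (by fun_prop) (by fun_prop)
    ((hf.pb.mul (hf.pb.add (PB.const 1))).add (PB.const 1)) ?_).of_eq
    fun a => (iterate_snoc_length _).symm
  intro a i hi
  rw [iterate_snoc_length]
  refine (esz_list_le _ (esz (f a)) ?_).trans ?_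
  · intro x hx
    have := List.mem_range.1 hx
    rw [esz_nat, esz_nat]
    omega
  · rw [List.length_range]
    refine Nat.add_le_add_right (Nat.mul_le_mul_right _ ?_) _
    rw [esz_nat]
    omega

@[fun_prop]
theorem PT.drop {f : α → ℕ} {l : α → List β} (hf : PT f) (hl : PT l) :
    PT (fun a => (l a).drop (f a)) := by
  have key : ∀ (n : ℕ) (m : List β), List.tail^[n] m = m.drop n := by
    intro n; induction n with
    | zero => simp
    | succ n ih => intro m; rw [Function.iterate_succ_apply, ih]; simp
  refine (PT.iterate (step := List.tail) hf hl (by fun_prop) hl.pb ?_).of_eq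
    fun a => (key _ _).symm
  intro a i hi
  induction i with
  | zero => rfl
  | succ i ih =>
    rw [Function.iterate_succ_apply']
    exact (esz_tail_le _).trans (ih (by omega))

@[fun_prop]
theorem PT.getD {f : α → ℕ} {l : α → List β} {d : α → β} (hl : PT l) (hf : PT f) (hd : PT d) :
    PT (fun a => (l a).getD (f a) (d a)) :=
  ((hf.drop hl).headD hd).of_eq fun a => by
    rw [List.headD_eq_head?_getD, List.head?_drop, List.getD_eq_getElem?_getD]

@[fun_prop]
theorem PT.beqListNat {f g : α → List ℕ} (hf : PT f) (hg : PT g) : PT (fun a => f a == g a) := by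
  refine ((hf.length.beqNat hg.length).and ((hf.length.range).all
    (F := fun a i => (f a).getD i 0 == (g a).getD i 0) (by fun_prop))).of_eq fun a => ?_
  rw [Bool.eq_iff_iff]
  simp only [beq_iff_eq, Bool.and_eq_true, List.all_eq_true, List.mem_range]
  constructor
  · intro h; simp [h]
  · rintro ⟨h1, h2⟩
    refine List.ext_getElem h1 fun i hi hi' => ?_
    have := h2 i hi
    simpa [List.getD_eq_getElem?_getD, hi, hi'] using this

end

/-- The list of all lists of length `r` with entries in `l`. -/
def tuples {β : Type} : ℕ → List β → List (List β)
  | 0, _ => [[]]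
  | r + 1, l => l.flatMap fun x => (tuples r l).map (x :: ·)

theorem mem_tuples {β : Type} {r : ℕ} {l m : List β} :
    m ∈ tuples r l ↔ m.length = r ∧ ∀ x ∈ m, x ∈ l := by
  induction r generalizing m with
  | zero => simp +contextual [tuples]
  | succ r ih =>
    simp only [tuples, List.mem_flatMap, List.mem_map, ih]
    cases m with
    | nil => simp
    | cons y m => simp; tauto

theorem length_tuples {β : Type} (r : ℕ) (l : List β) : (tuples r l).length = l.length ^ r := by
  induction r with
  | zero => rfl
  | succ r ih => simp [tuples, List.length_flatMap, ih, pow_succ, mul_comm]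

-- The exponent `r` is a constant of the program and not part of its input; this keeps the number
-- `l.length ^ r` of tuples polynomial.
@[fun_prop]
theorem PT.tuples {α β : Type} [TreeEnc α] [TreeEnc β] (r : ℕ) {l : α → List β} (hl : PT l) :
    PT (fun a => tuples r (l a)) := by
  induction r with
  | zero => exact PT.const _
  | succ r ih =>
    exact hl.flatMap (F := fun a x => (ParamW.tuples r (l a)).map (x :: ·))
      (PT.map (F := fun p y => p.2 :: y) (ih.comp PT.id.fst) (by fun_prop))

attribute [instance] ParamProblem.code

/-! ### Reductions -/

theorem computable_add {f g : ℕ → ℕ} (hf : Computable f) (hg : Computable g) :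
    Computable fun k => f k + g k :=
  (Primrec.nat_add.to_comp (α := ℕ) (β := ℕ)).comp hf hg

theorem computable_mul {f g : ℕ → ℕ} (hf : Computable f) (hg : Computable g) :
    Computable fun k => f k * g k :=
  (Primrec.nat_mul.to_comp (α := ℕ) (β := ℕ)).comp hf hg

theorem computable_pow {f g : ℕ → ℕ} (hf : Computable f) (hg : Computable g) :
    Computable fun k => f k ^ g k :=
  ((Primrec₂.unpaired'.1 Nat.Primrec.pow).to_comp (α := ℕ) (β := ℕ)).comp hf hg

/-- The sum of the values of `f` up to `n`. -/
def cumul (f : ℕ → ℕ) (n : ℕ) : ℕ := Nat.rec (f 0) (fun i s => s + f (i + 1)) n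

theorem le_cumul (f : ℕ → ℕ) {m n : ℕ} (h : m ≤ n) : f m ≤ cumul f n := by
  induction n with
  | zero => rw [Nat.le_zero.1 h]; exact le_rfl
  | succ n ih =>
    have e : cumul f (n + 1) = cumul f n + f (n + 1) := rfl
    rcases Nat.lt_or_ge n m with h' | h'
    · have : m = n + 1 := by omega
      subst this
      omega
    · have := ih h'
      omega

theorem computable_cumul {f g : ℕ → ℕ} (hf : Computable f) (hg : Computable g) :
    Computable fun k => cumul f (g k) := by
  refine Computable.nat_rec (h := fun (_ : ℕ) (p : ℕ × ℕ) => p.2 + f (p.1 + 1)) hg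
    (Computable.const (f 0)) ?_
  exact (Primrec.nat_add.to_comp (α := ℕ) (β := ℕ)).comp
    (Computable.snd.comp Computable.snd)
    (hf.comp (Computable.succ.comp (Computable.fst.comp Computable.snd)))

/-- The second reduction runs with a parameter `l` of which only `l ≤ g k` is known, and its bounds
need not be monotone. `cumul` replaces them by computable functions that dominate all values up to
`g k`. The input size of the second program is controlled because output sizes are counted in the
first bound. -/
theorem FPTReducible.trans {A B C : ParamProblem} (hAB : FPTReducible A B)
    (hBC : FPTReducible B C) : FPTReducible A C := by
  obtain ⟨p, f, g, c, hf, hg, h⟩ := hAB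
  obtain ⟨p', f', g', c', hf', hg', h'⟩ := hBC
  refine ⟨.seq p p', fun k => f k + 1 + cumul f' (g k) * f k ^ c', fun k => cumul g' (g k),
    c + c * c', ?_, computable_cumul hg' hg, fun x k => ?_⟩
  · exact computable_add (computable_add hf (Computable.const 1))
      (computable_mul (computable_cumul hf' hg) (computable_pow hf (Computable.const c')))
  obtain ⟨y, l, t, hr, ht, hl, hy⟩ := h x k
  obtain ⟨z, m, u, hr', hu, hm, hz⟩ := h' y l
  refine ⟨z, m, t + u + 1, .seq hr hr', ?_, hm.trans (le_cumul _ hl), hy.trans hz⟩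
  set n := (A.input x k).size with hn
  have hn1 : 1 ≤ n := Val.size_pos _
  have h1 : f' l ≤ cumul f' (g k) := le_cumul _ hl
  have h2 : (B.input y l).size ^ c' ≤ f k ^ c' * n ^ (c * c') := by
    rw [pow_mul, ← mul_pow]
    exact Nat.pow_le_pow_left (by omega) _
  have h3 : f' l * (B.input y l).size ^ c' ≤ cumul f' (g k) * f k ^ c' * n ^ (c * c') := by
    rw [mul_assoc]
    exact Nat.mul_le_mul h1 h2
  have h4 : n ^ (c * c') ≤ n ^ (c + c * c') := Nat.pow_le_pow_right hn1 (by omega)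
  have h5 : n ^ c ≤ n ^ (c + c * c') := Nat.pow_le_pow_right hn1 (by omega)
  have h6 : 1 ≤ n ^ (c + c * c') := Nat.one_le_pow _ _ hn1
  have h7 := Nat.mul_le_mul_left (f k) h5
  have h8 := Nat.mul_le_mul_left (cumul f' (g k) * f k ^ c') h4
  rw [add_mul, add_mul, one_mul]
  omega

/-- A reduction that first computes an object `E k` from the parameter, and then works in
polynomial time. -/
theorem FPTReducible.of_aux {A B : ParamProblem} {ε : Type} [TreeEnc ε] {E : ℕ → ε} {q : Prog}
    {b g : ℕ → ℕ} (hb : Computable b)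
    (hq : ∀ k, ∃ t, Runs q (enc k) (enc (E k)) t ∧ t + esz (E k) ≤ b k)
    {R : (A.Inst × ℕ) × ε → B.Inst × ℕ} (hR : PT R) (hg : Computable g)
    (hRg : ∀ x k, (R ((x, k), E k)).2 ≤ g k)
    (hyes : ∀ x k, A.Yes x k ↔ B.Yes (R ((x, k), E k)).1 (R ((x, k), E k)).2) :
    FPTReducible A B := by
  obtain ⟨p, T, hp, hT, hs⟩ := hR
  obtain ⟨c, hc⟩ := hT.add hs
  refine ⟨.seq (.cons .id (.seq .tl q)) p, fun k => b k + 5 + (b k + 3) ^ c, g, c, ?_, hg,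
    fun x k => ⟨(R ((x, k), E k)).1, (R ((x, k), E k)).2, ?_⟩⟩
  · exact computable_add (computable_add hb (Computable.const 5))
      (computable_pow (computable_add hb (Computable.const 3)) (Computable.const c))
  obtain ⟨t, hr, ht⟩ := hq k
  refine ⟨_, .seq (.cons (.id _) (.seq (.tl _) hr)) (hp ((x, k), E k)), ?_, hRg x k, hyes x k⟩
  have h1 : T ((x, k), E k) + esz (R ((x, k), E k)) ≤ _ := hc ((x, k), E k)
  set n := (A.input x k).size with hn
  have hn1 : 1 ≤ n := Val.size_pos _
  have h0 : esz ((x, k), E k) = n + esz (E k) + 1 := rfl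
  -- The size of the auxiliary object depends on the parameter alone. It goes into the factor `(b k
  -- + 3) ^ c`, and the exponent of the instance size stays constant.
  have h2 : esz ((x, k), E k) + 1 ≤ (b k + 3) * n := by
    have : b k + 3 ≤ (b k + 3) * n := Nat.le_mul_of_pos_right _ hn1
    have h3 := Nat.mul_le_mul_left (b k + 2) hn1
    rw [show b k + 3 = (b k + 2) + 1 from rfl, add_mul, one_mul]
    omega
  have h3 := h1.trans (Nat.pow_le_pow_left h2 c)
  rw [mul_pow] at h3
  have h4 : b k + 5 ≤ (b k + 5) * n ^ c := Nat.le_mul_of_pos_right _ (Nat.pow_pos hn1)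
  have h5 : (B.input (R ((x, k), E k)).1 (R ((x, k), E k)).2).size = esz (R ((x, k), E k)) := rfl
  rw [add_mul]
  omega

/-- A polynomial-time reduction. -/
theorem FPTReducible.of_PT {A B : ParamProblem} {g : ℕ → ℕ} {R : A.Inst × ℕ → B.Inst × ℕ}
    (hR : PT R) (hg : Computable g) (hRg : ∀ x k, (R (x, k)).2 ≤ g k)
    (hyes : ∀ x k, A.Yes x k ↔ B.Yes (R (x, k)).1 (R (x, k)).2) : FPTReducible A B :=
  FPTReducible.of_aux (E := fun _ => ()) (q := .nil) (b := fun _ => 2) (Computable.const 2)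
    (fun k => ⟨1, .nil _, by simp [esz, enc, Val.size]⟩) (hR.comp PT.id.fst) hg hRg hyes

/-! ### A colored hitting set problem -/

/-- The instance `(m, L)` lists for every slot its options, each given by the list of the
Booleans that tell which of the `m` clauses it hits. The question is whether one can choose an
option for each of the first `k` slots such that all clauses are hit. -/
def ColoredHittingSet : ParamProblem where
  Inst := ℕ × List (List (List Bool))
  Yes x k := ∃ f : ℕ → List Bool, (∀ i < k, f i ∈ x.2.getD i []) ∧
    ∀ c < x.1, ∃ i < k, (f i).getD c false = true

/-- The instance of the hitting set problem with the slots `idx`, the options `opts i` of the slot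
`i` and the clauses `Cl`, where `inc i v c` says that the option `v` of the slot `i` hits `c`. -/
def hitInstance {ι ν κ : Type} (idx : List ι) (opts : ι → List ν) (Cl : List κ)
    (inc : ι → ν → κ → Bool) : ℕ × List (List (List Bool)) :=
  (Cl.length, idx.map fun i => (opts i).map fun v => Cl.map fun c => inc i v c)

/-- Since `idx` has no repetitions, a choice by position and a choice by name of the slot are the
same thing. Different options with the same row of incidences are interchangeable, so remembering
only the row loses nothing. -/
theorem hitInstance_yes_iff {ι ν κ : Type} [Inhabited ν] {idx : List ι} (hidx : idx.Nodup)
    {opts : ι → List ν} {Cl : List κ} {inc : ι → ν → κ → Bool} :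
    ColoredHittingSet.Yes (hitInstance idx opts Cl inc) idx.length ↔
    ∃ f : ι → ν, (∀ i ∈ idx, f i ∈ opts i) ∧ ∀ c ∈ Cl, ∃ i ∈ idx, inc i (f i) c = true := by
  classical
  constructor
  · rintro ⟨F, hF, h⟩
    have h1 : ∀ i ∈ idx, ∃ v ∈ opts i, F (idx.idxOf i) = Cl.map fun c => inc i v c := by
      intro i hi
      have hlt := List.idxOf_lt_length_of_mem hi
      have := hF _ hlt
      simp only [hitInstance, List.getD_eq_getElem?_getD, List.getElem?_map, hlt,
        List.getElem?_eq_getElem, Option.map_some, Option.getD_some, List.mem_map,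
        List.getElem_idxOf] at this
      obtain ⟨v, hv, he⟩ := this
      exact ⟨v, hv, he.symm⟩
    choose f hf he using h1
    refine ⟨fun i => if hi : i ∈ idx then f i hi else default, fun i hi => ?_, fun c hc => ?_⟩
    · simp only [hi, dif_pos]
      exact hf i hi
    · obtain ⟨j, hj, rfl⟩ := List.getElem_of_mem hc
      obtain ⟨p, hp, hpj⟩ := h j hj
      refine ⟨idx[p], List.getElem_mem hp, ?_⟩
      have h2 := he _ (List.getElem_mem hp)
      rw [hidx.idxOf_getElem] at h2
      rw [h2] at hpj
      simpa [List.getD_eq_getElem?_getD, hj] using hpj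
  · rintro ⟨f, hf, h⟩
    refine ⟨fun p => (idx[p]?.map fun i => Cl.map fun c => inc i (f i) c).getD [], fun p hp => ?_,
      fun j hj => ?_⟩
    · simp only [hitInstance, List.getD_eq_getElem?_getD, List.getElem?_map, hp,
        List.getElem?_eq_getElem, Option.map_some, Option.getD_some, List.mem_map]
      exact ⟨_, hf _ (List.getElem_mem hp), rfl⟩
    · have hj' : j < Cl.length := hj
      obtain ⟨i, hi, hic⟩ := h Cl[j] (List.getElem_mem hj')
      obtain ⟨p, hp, rfl⟩ := List.getElem_of_mem hi
      refine ⟨p, hp, ?_⟩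
      simpa [List.getD_eq_getElem?_getD, hp, hj'] using hic

/-! ### Encodings that do not depend on the presentation -/

theorem enc_list_congr {α β : Type} [TreeEnc α] [TreeEnc β] {l : List α} {l' : List β}
    (h : l.map enc = l'.map enc) : enc l = enc l' := by
  have key : ∀ {γ : Type} [TreeEnc γ] (m : List γ), enc m = encList (fun v : Val => v) (m.map enc) := by
    intro γ _ m
    induction m with
    | nil => rfl
    | cons a m ih => exact congrArg (Val.cons (enc a)) ih
  rw [key, key, h]

theorem map_range_eq_ofFn {β : Type} (n : ℕ) (g : ℕ → β) :
    (List.range n).map g = List.ofFn fun i : Fin n => g i := by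
  apply List.ext_getElem <;> simp

theorem enc_fun_eq {α β : Type} [TreeEnc α] [TreeEnc β] {n : ℕ} (f : Fin n → α) (g : ℕ → β)
    (h : ∀ i : Fin n, enc (f i) = enc (g i)) : enc f = enc ((List.range n).map g) := by
  refine enc_list_congr ?_
  rw [map_range_eq_ofFn, List.map_ofFn, List.map_ofFn]
  exact congrArg List.ofFn (funext h)

theorem enc_pair_congr {α β α' β' : Type} [TreeEnc α] [TreeEnc β] [TreeEnc α'] [TreeEnc β']
    {a : α} {b : β} {a' : α'} {b' : β'} (h : enc a = enc a') (h' : enc b = enc b') :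
    enc (a, b) = enc (a', b') := congrArg₂ Val.cons h h'

namespace BlindNTM

variable {M : BlindNTM}

theorem Reach.snoc {n : ℕ} {c c' c'' : M.Config} (h : M.Reach n c c') (h' : M.Step c' c'') :
    M.Reach (n + 1) c c'' := by
  induction h with
  | refl c => exact .step h' (.refl _)
  | step hs _ ih => exact .step hs (ih h')

theorem Reach.exists_snoc {n : ℕ} {c c'' : M.Config} (h : M.Reach (n + 1) c c'') :
    ∃ c', M.Reach n c c' ∧ M.Step c' c'' := by
  induction n generalizing c with
  | zero =>
    cases h with
    | step hs h =>
      cases h with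
      | refl => exact ⟨c, .refl _, hs⟩
  | succ n ih =>
    cases h with
    | step hs h =>
      obtain ⟨c', h1, h2⟩ := ih h
      exact ⟨c', .step hs h1, h2⟩

end BlindNTM

/-! ### From hitting sets to blind machines -/

/-- The transition that chooses an option `row` for the slot `i`. -/
def hitTransition (m k : ℕ) (i : Fin k) (row : List Bool) : Transition (m + 1) 2 (k + 2) where
  read _ := none
  src := ⟨i, by omega⟩
  write t := bif row.getD t false then some 1 else none
  tgt := ⟨i + 1, by omega⟩
  move _ := 0

/-- The transition that checks that all clauses are hit. -/
def hitCheck (m k : ℕ) : Transition (m + 1) 2 (k + 2) where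
  read t := bif Nat.blt t m then some 1 else none
  src := ⟨k, by omega⟩
  write _ := none
  tgt := ⟨k + 1, by omega⟩
  move _ := 0

/-- The machine that chooses options and records the clauses that are hit, one on each tape. -/
abbrev hitMachine (m : ℕ) (L : List (List (List Bool))) (k : ℕ) : BlindNTM where
  -- The additional tape, which is never checked, provides the required tape when there are no
  -- clauses.
  tapes := m + 1
  symbols := 2
  states := k + 2
  tapes_pos := by omega
  blank := 0
  start := 0
  accepting q := q.val == k + 1
  delta := ((List.finRange k).flatMap fun i : Fin k => (L.getD i []).map fun row =>
    hitTransition m k i row) ++ [hitCheck m k]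

theorem mem_hitMachine_delta {m : ℕ} {L : List (List (List Bool))} {k : ℕ}
    {δ : Transition (m + 1) 2 (k + 2)} : δ ∈ (hitMachine m L k).delta ↔
      (∃ i : Fin k, ∃ row ∈ L.getD i [], hitTransition m k i row = δ) ∨ δ = hitCheck m k := by
  simp only [hitMachine, List.mem_append, List.mem_flatMap, List.mem_map, List.mem_finRange,
      true_and, List.mem_singleton]

theorem pt_hitMachine : PT (fun p : (ℕ × List (List (List Bool))) × ℕ =>
    ((⟨hitMachine p.1.1 p.1.2 p.2, []⟩ : BlindInstance), p.2 + 1)) := by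
  have key : PT (fun p : (ℕ × List (List (List Bool))) × ℕ =>
      (((p.1.1 + 1, 2, p.2 + 2),
        (0, 0, (List.range (p.2 + 2)).map (fun q => q == p.2 + 1),
          ((List.range p.2).flatMap fun i => (p.1.2.getD i []).map fun row =>
              ((List.range (p.1.1 + 1)).map fun _ => (none : Option ℕ), i,
                (List.range (p.1.1 + 1)).map fun t => bif row.getD t false then some 1 else none,
                i + 1, (List.range (p.1.1 + 1)).map fun _ => 0)) ++
            [((List.range (p.1.1 + 1)).map fun t => bif Nat.blt t p.1.1 then some 1 else none, p.2,
              (List.range (p.1.1 + 1)).map fun _ => (none : Option ℕ), p.2 + 1,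
              (List.range (p.1.1 + 1)).map fun _ => 0)],
          ([] : List ℕ))), p.2 + 1)) := by
    fun_prop
  refine key.congr_enc fun p => ?_
  obtain ⟨⟨m, L⟩, k⟩ := p
  refine enc_pair_congr ?_ rfl
  refine congrArg₂ Val.cons rfl ?_
  refine enc_pair_congr rfl (enc_pair_congr rfl (enc_pair_congr
    (enc_fun_eq _ _ fun _ => rfl) (enc_pair_congr (enc_list_congr ?_) rfl)))
  have h0 : enc (fun _ : Fin (m + 1) => (none : Option (Fin 2))) =
      enc ((List.range (m + 1)).map fun _ => (none : Option ℕ)) := enc_fun_eq _ _ fun _ => rfl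
  have h1 : enc (fun _ : Fin (m + 1) => (0 : SignType)) =
      enc ((List.range (m + 1)).map fun _ => 0) := enc_fun_eq _ _ fun _ => rfl
  simp only [hitMachine, List.map_append, List.map_flatMap, List.map_map, List.map_cons,
    List.map_nil]
  congr 1
  · rw [List.flatMap_def, List.flatMap_def, map_range_eq_ofFn, List.ofFn_eq_map]
    refine congrArg List.flatten (List.map_congr_left fun i _ => List.map_congr_left fun row _ => ?_)
    refine enc_pair_congr h0 (enc_pair_congr rfl (enc_pair_congr
      (enc_fun_eq _ _ fun t => ?_) (enc_pair_congr rfl h1)))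
    simp only [hitTransition]
    cases row.getD t false <;> rfl
  · refine congrArg₂ List.cons (enc_pair_congr (enc_fun_eq _ _ fun t => ?_) (enc_pair_congr rfl
      (enc_pair_congr h0 (enc_pair_congr rfl h1)))) rfl
    simp only [hitCheck]
    cases Nat.blt t m <;> rfl

/-- The configuration after the first `n` options of `f` have been chosen. -/
def hitConfig (m : ℕ) (L : List (List (List Bool))) (k : ℕ) (f : ℕ → List Bool) (n : ℕ)
    (hn : n < k + 2) : (hitMachine m L k).Config where
  state := ⟨n, hn⟩
  head _ := 0
  cell t l := if l = 0 ∧ ∃ i < n, (f i).getD t.val false = true then (1 : Fin 2) else (0 : Fin 2)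

theorem hitMachine_init (m : ℕ) (L : List (List (List Bool))) (k : ℕ) (f : ℕ → List Bool) :
    (hitMachine m L k).init [] = hitConfig m L k f 0 (by omega) := by
  simp [BlindNTM.init, hitConfig, hitMachine]

theorem hitConfig_congr (m : ℕ) (L : List (List (List Bool))) (k : ℕ) {f g : ℕ → List Bool} {n : ℕ}
    (hn : n < k + 2) (h : ∀ i < n, f i = g i) : hitConfig m L k f n hn = hitConfig m L k g n hn := by
  have : ∀ t, (∃ i < n, (f i).getD t false = true) ↔ ∃ i < n, (g i).getD t false = true :=
    fun t => exists_congr fun i => and_congr_right fun hi => by rw [h i hi]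
  simp only [hitConfig, this]

/-- A neutral write keeps an earlier mark, so cell `0` accumulates the disjunction over the options
chosen so far. -/
theorem hitMachine_apply (m : ℕ) (L : List (List (List Bool))) (k : ℕ) (f : ℕ → List Bool)
    (i : Fin k) : (hitMachine m L k).apply (hitTransition m k i (f i))
      (hitConfig m L k f i (by omega)) = hitConfig m L k f (i + 1) (by omega) := by
  simp only [BlindNTM.apply, hitConfig, hitTransition]
  congr 1
  funext t l
  by_cases hl : l = 0
  · subst hl
    simp only [Function.update_self, true_and]
    have e : (∃ j < i.val + 1, (f j).getD t.val false = true) ↔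
        (f i).getD t.val false = true ∨ ∃ j < i.val, (f j).getD t.val false = true := by
      constructor
      · rintro ⟨j, hj, h⟩
        rcases Nat.lt_succ_iff_lt_or_eq.1 hj with h' | rfl
        · exact .inr ⟨j, h', h⟩
        · exact .inl h
      · rintro (h | ⟨j, hj, h⟩)
        · exact ⟨i, by omega, h⟩
        · exact ⟨j, by omega, h⟩
    simp only [e]
    cases (f i).getD t.val false <;> simp
  · simp [hl]

/-- Every transition raises the number of the state by one, so this number counts the steps. The
check is the only way into the state `k + 1`, and nothing leads out of it. -/
theorem hitMachine_reach {m : ℕ} {L : List (List (List Bool))} {k n : ℕ}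
    {c : (hitMachine m L k).Config} (h : (hitMachine m L k).Reach n ((hitMachine m L k).init []) c) :
    (∃ (f : ℕ → List Bool) (hn : n < k + 1), (∀ i < n, f i ∈ L.getD i []) ∧
      c = hitConfig m L k f n (by omega)) ∨
    (c.state.val = k + 1 ∧ ColoredHittingSet.Yes (m, L) k) := by
  induction n generalizing c with
  | zero =>
    cases h with
    | refl => exact .inl ⟨fun _ => [], by omega, by simp, hitMachine_init _ _ _ _⟩
  | succ n ih =>
    obtain ⟨c', h1, δ, hδ, ⟨hs, hr⟩, rfl⟩ := h.exists_snoc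
    replace hδ := mem_hitMachine_delta.1 hδ
    rcases ih h1 with ⟨f, hn, hf, rfl⟩ | ⟨h2, -⟩
    · obtain ⟨i, row, hrow, rfl⟩ | rfl := hδ
      · have hi : n = i.val := congrArg Fin.val hs
        subst hi
        set g := Function.update f i row with hg
        have hgi : g i = row := by simp [hg]
        have hgj : ∀ j < i.val, f j = g j := fun j hj => by simp [hg, hj.ne]
        refine .inl ⟨g, by omega, fun j hj => ?_, ?_⟩
        · rcases Nat.lt_succ_iff_lt_or_eq.1 hj with h' | rfl
          · rw [← hgj j h']; exact hf j h'
          · rw [hgi]; exact hrow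
        · rw [hitConfig_congr m L k _ hgj, ← hgi]
          exact hitMachine_apply m L k g i
      · have hi : n = k := congrArg Fin.val hs
        subst hi
        refine .inr ⟨rfl, f, hf, fun t ht => ?_⟩
        have h3 := hr ⟨t, Nat.lt_succ_of_lt ht⟩
        have ht' : Nat.blt t m = true := by simpa [Nat.blt] using ht
        simp only [hitCheck, ht', cond_true, hitConfig, reduceCtorEq, false_or,
          Option.some.injEq] at h3
        simpa using h3
    · have h2' : c'.state.val = k + 1 := h2
      obtain ⟨i, row, hrow, rfl⟩ | rfl := hδ
      · have h3 : c'.state.val = i := congrArg Fin.val hs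
        omega
      · have h3 : c'.state.val = k := congrArg Fin.val hs
        omega

theorem coloredHittingSet_reducible_shortBlind :
    FPTReducible ColoredHittingSet ShortBlindMultiTapeNTM := by
  refine FPTReducible.of_PT pt_hitMachine (g := fun k => k + 1) Computable.succ
    (fun x k => le_rfl) ?_
  rintro ⟨m, L⟩ k
  constructor
  · rintro ⟨f, hf, h⟩
    have key : ∀ n (hn : n ≤ k), (hitMachine m L k).Reach n ((hitMachine m L k).init [])
        (hitConfig m L k f n (by omega)) := by
      intro n
      induction n with
      | zero => intro _; rw [hitMachine_init m L k f]; exact .refl _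
      | succ n ih =>
        intro hn
        refine (ih (by omega)).snoc ⟨hitTransition m k ⟨n, hn⟩ (f n), ?_, ⟨rfl, fun _ => .inl rfl⟩,
          (hitMachine_apply m L k f ⟨n, hn⟩).symm⟩
        exact mem_hitMachine_delta.2 (.inl ⟨⟨n, hn⟩, f n, hf n hn, rfl⟩)
    refine ⟨k + 1, le_rfl, _, (key k le_rfl).snoc ⟨hitCheck m k, ?_, ⟨rfl, fun t => ?_⟩, rfl⟩, ?_⟩
    · exact mem_hitMachine_delta.2 (.inr rfl)
    · by_cases ht : t.val < m
      · have ht' : Nat.blt t.val m = true := by simpa [Nat.blt] using ht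
        right
        have h1 : (hitConfig m L k f k (by omega)).cell t 0 = (1 : Fin 2) :=
          if_pos ⟨rfl, h t.val ht⟩
        change (hitCheck m k).read t = some ((hitConfig m L k f k (by omega)).cell t 0)
        rw [h1]
        simp only [hitCheck, ht', cond_true]
      · left
        have ht' : Nat.blt t.val m = false := by
          rw [Bool.eq_false_iff]; simpa [Nat.blt] using ht
        simp only [hitCheck, ht', cond_false]
    · simp [BlindNTM.apply, hitMachine, hitCheck]
  · rintro ⟨n, -, c, hr, ha⟩
    rcases hitMachine_reach hr with ⟨f, hn, -, rfl⟩ | ⟨-, h⟩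
    · simp [hitMachine, hitConfig] at ha
      omega
    · exact h

/-! ### Values of the wires of a circuit -/

section
variable {α : Type} {d : α} {op : Gate → (ℕ → α) → α} {init : List α}

theorem wireValues_snoc (gates : List Gate) (g : Gate) :
    wireValues d op init (gates ++ [g]) = wireValues d op init gates ++
      [op g fun i => (wireValues d op init gates).getD i d] := by
  simp [wireValues, List.foldl_append]

theorem length_wireValues (gates : List Gate) :
    (wireValues d op init gates).length = init.length + gates.length := by
  induction gates using List.reverseRecOn with
  | nil => rfl
  | append_singleton gates g ih => simp [wireValues_snoc, ih, add_assoc]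

theorem wireValues_input (gates : List Gate) {j : ℕ} (hj : j < init.length) :
    (wireValues d op init gates).getD j d = init.getD j d := by
  induction gates using List.reverseRecOn with
  | nil => rfl
  | append_singleton gates g ih =>
    rw [wireValues_snoc, List.getD_append _ _ _ _ (by rw [length_wireValues]; omega), ih]

/-- Later gates do not change earlier wires and a gate reads earlier wires only, so the recursion
turns into an equation for the final list of values. The operation `op` is general in order to serve
evaluation, depth and weft alike. -/
theorem wireValues_gate (hop : ∀ g v v', (∀ a ∈ g.args, v a = v' a) → op g v = op g v')
    (gates : List Gate)
    (hac : ∀ (i : ℕ) (hi : i < gates.length), ∀ a ∈ gates[i].args, a < init.length + i)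
    {i : ℕ} (hi : i < gates.length) :
    (wireValues d op init gates).getD (init.length + i) d =
      op gates[i] fun j => (wireValues d op init gates).getD j d := by
  induction gates using List.reverseRecOn with
  | nil => simp at hi
  | append_singleton gates g ih =>
    have hext : ∀ j < init.length + gates.length,
        (wireValues d op init (gates ++ [g])).getD j d = (wireValues d op init gates).getD j d :=
      fun j hj => by
        rw [wireValues_snoc, List.getD_append _ _ _ _ (by rw [length_wireValues]; omega)]
    have hle : i ≤ gates.length := by simp at hi; omega
    have harg : ∀ a ∈ (gates ++ [g])[i].args, a < init.length + gates.length := fun a ha =>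
      (hac i hi a ha).trans_le (by omega)
    rw [hop _ _ _ fun a ha => hext a (harg a ha)]
    rcases Nat.lt_or_ge i gates.length with h | h
    · rw [hext _ (by omega), ih (fun j hj a ha => hac j (by simp; omega) a
        (by rwa [List.getElem_append_left hj])) h, List.getElem_append_left h]
    · have : i = gates.length := by omega
      subst this
      rw [wireValues_snoc, List.getD_append_right _ _ _ _ (by rw [length_wireValues]),
        length_wireValues]
      simp

end

theorem maxOver_le_iff {v : ℕ → ℕ} {l : List ℕ} {B : ℕ} :
    maxOver v l ≤ B ↔ ∀ a ∈ l, v a ≤ B := by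
  induction l with
  | nil => simp [maxOver]
  | cons a l ih =>
    have : maxOver v (a :: l) = max (v a) (maxOver v l) := rfl
    simp [this, ih]

theorem maxOver_congr {v v' : ℕ → ℕ} {l : List ℕ} (h : ∀ a ∈ l, v a = v' a) :
    maxOver v l = maxOver v' l :=
  le_antisymm (maxOver_le_iff.2 fun a ha => h a ha ▸ maxOver_le_iff.1 le_rfl a ha)
    (maxOver_le_iff.2 fun a ha => h a ha ▸ maxOver_le_iff.1 le_rfl a ha)

theorem Gate.eval_congr {g : Gate} {v v' : ℕ → Bool} (h : ∀ a ∈ g.args, v a = v' a) :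
    g.eval v = g.eval v' := by
  cases g with
  | not a => simpa [Gate.eval, Gate.args] using h
  | and l =>
    rw [Bool.eq_iff_iff]
    simp only [Gate.eval, List.all_eq_true]
    exact forall₂_congr fun a ha => by rw [h a ha]
  | or l =>
    rw [Bool.eq_iff_iff]
    simp only [Gate.eval, List.any_eq_true]
    exact exists_congr fun a => and_congr_right fun ha => by rw [h a ha]

namespace Circuit

variable (C : Circuit)

/-- The value of a wire on the input vector `x`. -/
def val (x : Fin C.inputs → Bool) (w : ℕ) : Bool :=
  (wireValues false (fun g v => g.eval v) (List.ofFn x) C.gates).getD w false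

/-- The depth of a wire. -/
def wireDepth (w : ℕ) : ℕ :=
  (wireValues 0 (fun g v => maxOver v g.args + 1) (List.replicate C.inputs 0) C.gates).getD w 0

/-- The weft of a wire. -/
def wireWeft (w : ℕ) : ℕ :=
  (wireValues 0 (fun g v => maxOver v g.args + (if g.isLarge then 1 else 0))
    (List.replicate C.inputs 0) C.gates).getD w 0

theorem val_input (x : Fin C.inputs → Bool) {w : ℕ} (hw : w < C.inputs) :
    C.val x w = x ⟨w, hw⟩ := by
  rw [val, wireValues_input _ (by simpa using hw)]
  simp [List.getD_eq_getElem?_getD, hw]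

theorem wireDepth_input {w : ℕ} (hw : w < C.inputs) : C.wireDepth w = 0 := by
  rw [wireDepth, wireValues_input _ (by simpa using hw)]
  simp [List.getD_eq_getElem?_getD, hw]

theorem wireWeft_input {w : ℕ} (hw : w < C.inputs) : C.wireWeft w = 0 := by
  rw [wireWeft, wireValues_input _ (by simpa using hw)]
  simp [List.getD_eq_getElem?_getD, hw]

theorem val_gate (x : Fin C.inputs → Bool) {i : ℕ} (hi : i < C.gates.length) :
    C.val x (C.inputs + i) = C.gates[i].eval (C.val x) := by
  have h := wireValues_gate (d := false) (op := fun g v => g.eval v) (init := List.ofFn x)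
    (fun g v v' h => Gate.eval_congr h) C.gates (by simpa using C.acyclic) hi
  rwa [List.length_ofFn] at h

theorem wireDepth_gate {i : ℕ} (hi : i < C.gates.length) :
    C.wireDepth (C.inputs + i) = maxOver C.wireDepth C.gates[i].args + 1 := by
  have h := wireValues_gate (d := 0) (op := fun g v => maxOver v g.args + 1)
    (init := List.replicate C.inputs 0) (fun g v v' h => by rw [maxOver_congr h]) C.gates
    (by simpa using C.acyclic) hi
  rwa [List.length_replicate] at h

theorem wireWeft_gate {i : ℕ} (hi : i < C.gates.length) :
    C.wireWeft (C.inputs + i) =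
      maxOver C.wireWeft C.gates[i].args + (if C.gates[i].isLarge then 1 else 0) := by
  have h := wireValues_gate (d := 0)
    (op := fun g v => maxOver v g.args + (if g.isLarge then 1 else 0))
    (init := List.replicate C.inputs 0) (fun g v v' h => by rw [maxOver_congr h]) C.gates
    (by simpa using C.acyclic) hi
  rwa [List.length_replicate] at h

end Circuit

/-! ### Circuits for formulas in conjunctive normal form -/

/-- The circuit of the conjunction of the positive clauses in `ors`. -/
def cnfCircuit (n : ℕ) (ors : List (List ℕ)) (h : ∀ l ∈ ors, ∀ a ∈ l, a < n) : Circuit where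
  inputs := n
  gates := ors.map Gate.or ++ [Gate.and ((List.range ors.length).map fun i => n + i)]
  output := n + ors.length
  acyclic := by
    intro i hi a ha
    rcases Nat.lt_or_ge i ors.length with h' | h'
    · rw [List.getElem_append_left (by simpa using h'), List.getElem_map] at ha
      have := h _ (List.getElem_mem h') a ha
      omega
    · have hi' : i = ors.length := by simp at hi; omega
      subst hi'
      rw [List.getElem_append_right (by simp)] at ha
      simp [Gate.args] at ha
      omega
  output_lt := by simp

section
variable {n : ℕ} {ors : List (List ℕ)} (h : ∀ l ∈ ors, ∀ a ∈ l, a < n)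

theorem cnfCircuit_gate {i : ℕ} (hi : i < ors.length) :
    ∃ hi' : i < (cnfCircuit n ors h).gates.length,
      (cnfCircuit n ors h).gates[i] = Gate.or ors[i] :=
  ⟨by simp [cnfCircuit]; omega, by
    simp only [cnfCircuit]
    rw [List.getElem_append_left (by simpa using hi), List.getElem_map]⟩

theorem cnfCircuit_last :
    ∃ hi' : ors.length < (cnfCircuit n ors h).gates.length,
      (cnfCircuit n ors h).gates[ors.length] =
        Gate.and ((List.range ors.length).map fun i => n + i) :=
  ⟨by simp [cnfCircuit], by simp [cnfCircuit]⟩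

theorem cnfCircuit_eval (x : Fin n → Bool) :
    (cnfCircuit n ors h).eval x = true ↔ ∀ l ∈ ors, ∃ a : Fin n, a.val ∈ l ∧ x a = true := by
  obtain ⟨hl, hg⟩ := cnfCircuit_last h
  have h1 : (cnfCircuit n ors h).eval x = _ := (cnfCircuit n ors h).val_gate x hl
  rw [h1, hg]
  simp only [Gate.eval, List.all_eq_true, List.mem_map, List.mem_range, forall_exists_index,
    and_imp, forall_apply_eq_imp_iff₂]
  have h2 : ∀ i (hi : i < ors.length), (cnfCircuit n ors h).val x (n + i) = true ↔
      ∃ a : Fin n, a.val ∈ ors[i] ∧ x a = true := by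
    intro i hi
    obtain ⟨hi', hgi⟩ := cnfCircuit_gate h hi
    have h3 : (cnfCircuit n ors h).val x (n + i) = _ := (cnfCircuit n ors h).val_gate x hi'
    rw [h3, hgi]
    simp only [Gate.eval, List.any_eq_true]
    constructor
    · rintro ⟨a, ha, hv⟩
      have han : a < n := h _ (List.getElem_mem hi) a ha
      have hv' : (cnfCircuit n ors h).val x a = _ := (cnfCircuit n ors h).val_input x han
      exact ⟨⟨a, han⟩, ha, hv' ▸ hv⟩
    · rintro ⟨a, ha, hv⟩
      have hv' : (cnfCircuit n ors h).val x a = _ := (cnfCircuit n ors h).val_input x a.2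
      exact ⟨a, ha, hv'.trans hv⟩
  constructor
  · intro h3 l hl
    obtain ⟨i, hi, rfl⟩ := List.getElem_of_mem hl
    exact (h2 i hi).1 (h3 i hi)
  · intro h3 i hi
    exact (h2 i hi).2 (h3 _ (List.getElem_mem hi))

theorem cnfCircuit_depth_le : (cnfCircuit n ors h).depth ≤ 2 := by
  obtain ⟨hl, hg⟩ := cnfCircuit_last h
  have h1 : (cnfCircuit n ors h).depth = _ := (cnfCircuit n ors h).wireDepth_gate hl
  rw [h1, hg]
  refine Nat.succ_le_succ (maxOver_le_iff.2 fun a ha => ?_)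
  simp only [Gate.args, List.mem_map, List.mem_range] at ha
  obtain ⟨i, hi, rfl⟩ := ha
  obtain ⟨hi', hgi⟩ := cnfCircuit_gate h hi
  have h3 : (cnfCircuit n ors h).wireDepth (n + i) = _ := (cnfCircuit n ors h).wireDepth_gate hi'
  rw [h3, hgi]
  refine Nat.succ_le_succ (maxOver_le_iff.2 fun a ha => ?_)
  exact ((cnfCircuit n ors h).wireDepth_input (h _ (List.getElem_mem hi) a ha)).le

theorem cnfCircuit_weft_le : (cnfCircuit n ors h).weft ≤ 2 := by
  obtain ⟨hl, hg⟩ := cnfCircuit_last h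
  have h1 : (cnfCircuit n ors h).weft = _ := (cnfCircuit n ors h).wireWeft_gate hl
  rw [h1, hg]
  refine Nat.add_le_add (b := 1) (d := 1) (maxOver_le_iff.2 fun a ha => ?_) (by split_ifs <;> omega)
  simp only [Gate.args, List.mem_map, List.mem_range] at ha
  obtain ⟨i, hi, rfl⟩ := ha
  obtain ⟨hi', hgi⟩ := cnfCircuit_gate h hi
  have h3 : (cnfCircuit n ors h).wireWeft (n + i) = _ := (cnfCircuit n ors h).wireWeft_gate hi'
  rw [h3, hgi]
  refine Nat.add_le_add (b := 0) (d := 1) (maxOver_le_iff.2 fun a ha => ?_) (by split_ifs <;> omega)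
  exact ((cnfCircuit n ors h).wireWeft_input (h _ (List.getElem_mem hi) a ha)).le

end

/-! ### From hitting sets to circuits -/

/-- All options, with their slots. -/
def hitOptions (L : List (List (List Bool))) (k : ℕ) : List (ℕ × List Bool) :=
  (List.range k).flatMap fun i => (L.getD i []).map fun r => (i, r)

theorem mem_hitOptions {L : List (List (List Bool))} {k i : ℕ} {r : List Bool} :
    (i, r) ∈ hitOptions L k ↔ i < k ∧ r ∈ L.getD i [] := by
  simp only [hitOptions, List.mem_flatMap, List.mem_range, List.mem_map, Prod.mk.injEq]
  constructor
  · rintro ⟨j, hj, r', hr, rfl, rfl⟩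
    exact ⟨hj, hr⟩
  · rintro ⟨hj, hr⟩
    exact ⟨i, hj, r, hr, rfl, rfl⟩

/-- The clauses that say that every slot gets an option and every clause is hit. -/
def hitClauses (m : ℕ) (L : List (List (List Bool))) (k : ℕ) : List (List ℕ) :=
  ((List.range k).map fun i => (List.range (hitOptions L k).length).filter fun p =>
    ((hitOptions L k).getD p (0, [])).1 == i) ++
  ((List.range m).map fun c => (List.range (hitOptions L k).length).filter fun p =>
    ((hitOptions L k).getD p (0, [])).2.getD c false)

theorem hitClauses_lt (m : ℕ) (L : List (List (List Bool))) (k : ℕ) :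
    ∀ l ∈ hitClauses m L k, ∀ a ∈ l, a < (hitOptions L k).length := by
  intro l hl a ha
  simp only [hitClauses, List.mem_append, List.mem_map] at hl
  obtain ⟨i, -, rfl⟩ | ⟨i, -, rfl⟩ := hl <;>
  exact List.mem_range.1 (List.mem_filter.1 ha).1

/-- The circuit that checks a choice of options. -/
def hitCircuit (m : ℕ) (L : List (List (List Bool))) (k : ℕ) :
    {C : Circuit // C.weft ≤ 2 ∧ C.depth ≤ 2} :=
  ⟨cnfCircuit (hitOptions L k).length (hitClauses m L k) (hitClauses_lt m L k),
    cnfCircuit_weft_le _, cnfCircuit_depth_le _⟩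

@[fun_prop]
theorem pt_hitOptions {α : Type} [TreeEnc α] {L : α → List (List (List Bool))} {k : α → ℕ}
    (hL : PT L) (hk : PT k) : PT (fun a => hitOptions (L a) (k a)) := by
  unfold hitOptions
  fun_prop

@[fun_prop]
theorem pt_hitClauses {α : Type} [TreeEnc α] {m : α → ℕ} {L : α → List (List (List Bool))}
    {k : α → ℕ} (hm : PT m) (hL : PT L) (hk : PT k) :
    PT (fun a => hitClauses (m a) (L a) (k a)) := by
  unfold hitClauses
  fun_prop

theorem pt_hitCircuit : PT (fun p : (ℕ × List (List (List Bool))) × ℕ =>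
    (hitCircuit p.1.1 p.1.2 p.2, p.2)) := by
  have h2 : PT (fun p : (ℕ × List (List (List Bool))) × ℕ =>
      (((hitOptions p.1.2 p.2).length,
        ((hitClauses p.1.1 p.1.2 p.2).map fun l => (2, l)) ++
          [(1, (List.range (hitClauses p.1.1 p.1.2 p.2).length).map
            fun i => (hitOptions p.1.2 p.2).length + i)],
        (hitOptions p.1.2 p.2).length + (hitClauses p.1.1 p.1.2 p.2).length), p.2)) := by
    fun_prop
  refine h2.congr_enc fun p => enc_pair_congr ?_ rfl
  refine enc_pair_congr rfl (enc_pair_congr (enc_list_congr ?_) rfl)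
  simp only [hitCircuit, cnfCircuit, List.map_append, List.map_map, List.map_cons, List.map_nil]
  rfl

/-- Every slot needs a true input, and inputs of different slots are different, so a vector of
weight `k` has exactly one true input per slot. The exact weight replaces the negative clauses that
would forbid two options for a slot. -/
theorem hitCircuit_yes_iff (m : ℕ) (L : List (List (List Bool))) (k : ℕ) :
    ColoredHittingSet.Yes (m, L) k ↔ (WeightedCircuitSat 2 2).Yes (hitCircuit m L k) k := by
  set O := hitOptions L k with hO
  have key : (WeightedCircuitSat 2 2).Yes (hitCircuit m L k) k ↔
      ∃ x : Fin O.length → Bool, (Finset.univ.filter fun i => x i = true).card = k ∧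
        (∀ i < k, ∃ a, x a = true ∧ O[a].1 = i) ∧
        ∀ c < m, ∃ a, x a = true ∧ O[a].2.getD c false = true := by
    change (∃ x : Fin O.length → Bool, (Finset.univ.filter fun i => x i = true).card = k ∧
      (cnfCircuit O.length (hitClauses m L k) (hitClauses_lt m L k)).eval x = true) ↔ _
    refine exists_congr fun x => and_congr_right fun _ => ?_
    rw [cnfCircuit_eval (hitClauses_lt m L k) x]
    simp only [hitClauses, List.mem_append, List.mem_map, List.mem_range, or_imp, forall_and,
      forall_exists_index, and_imp, forall_apply_eq_imp_iff₂, List.mem_filter, ← hO]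
    have e : ∀ a : Fin O.length, O.getD a (0, []) = O[a] := fun a => by
      simp [List.getD_eq_getElem?_getD]
    simp only [e, beq_iff_eq]
    exact and_congr (forall₂_congr fun _ _ => exists_congr fun a =>
        ⟨fun h => ⟨h.2, h.1.2⟩, fun h => ⟨⟨a.2, h.2⟩, h.1⟩⟩)
      (forall₂_congr fun _ _ => exists_congr fun a =>
        ⟨fun h => ⟨h.2, h.1.2⟩, fun h => ⟨⟨a.2, h.2⟩, h.1⟩⟩)
  rw [key]
  constructor
  · rintro ⟨f, hf, h⟩
    have h1 : ∀ i : Fin k, ∃ a : Fin O.length, O[a] = (i.val, f i) := fun i => by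
      obtain ⟨a, ha, e⟩ := List.getElem_of_mem (mem_hitOptions.2 ⟨i.2, hf i i.2⟩)
      exact ⟨⟨a, ha⟩, e⟩
    choose p hp using h1
    have hinj : Function.Injective p := fun i j hij => by
      have := congrArg Prod.fst (hp i)
      rw [hij, hp j] at this
      exact Fin.ext this.symm
    refine ⟨fun a => decide (a ∈ Finset.univ.image p), ?_, fun i hi => ⟨p ⟨i, hi⟩, ?_, ?_⟩,
      fun c hc => ?_⟩
    · simp only [decide_eq_true_eq, Finset.filter_mem_eq_inter, Finset.univ_inter]
      rw [Finset.card_image_of_injective _ hinj, Finset.card_univ, Fintype.card_fin]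
    · simp
    · rw [hp]
    · obtain ⟨i, hi, hic⟩ := h c hc
      exact ⟨p ⟨i, hi⟩, by simp, by rw [hp]; exact hic⟩
  · rintro ⟨x, hcard, h1, h2⟩
    have h1' : ∀ i : Fin k, ∃ a, x a = true ∧ O[a].1 = i.val := fun i => h1 i i.2
    choose p hp hpi using h1'
    have hinj : Function.Injective p := fun i j hij => by
      have := hpi i
      rw [hij, hpi j] at this
      exact Fin.ext this.symm
    -- The `k` selected inputs are distinct and true, and only `k` inputs are true; hence any true
    -- input that hits a clause is a selected one.
    have himg : Finset.univ.image p = Finset.univ.filter fun a => x a = true := by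
      refine Finset.eq_of_subset_of_card_le ?_ ?_
      · intro a ha
        obtain ⟨i, -, rfl⟩ := Finset.mem_image.1 ha
        simp [hp i]
      · rw [hcard, Finset.card_image_of_injective _ hinj, Finset.card_univ, Fintype.card_fin]
    refine ⟨fun i => if hi : i < k then O[p ⟨i, hi⟩].2 else [], fun i hi => ?_, fun c hc => ?_⟩
    · have : (i, O[p ⟨i, hi⟩].2) ∈ hitOptions L k := by
        have e : O[p ⟨i, hi⟩] = (i, O[p ⟨i, hi⟩].2) := Prod.ext (hpi ⟨i, hi⟩) rfl
        rw [← e]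
        exact List.getElem_mem _
      simpa [hi] using (mem_hitOptions.1 this).2
    · obtain ⟨a, hxa, hac⟩ := h2 c hc
      have : a ∈ Finset.univ.image p := by rw [himg]; simp [hxa]
      obtain ⟨i, -, rfl⟩ := Finset.mem_image.1 this
      exact ⟨i, i.2, by simpa using hac⟩

theorem coloredHittingSet_reducible_circuitSat :
    FPTReducible ColoredHittingSet (WeightedCircuitSat 2 2) :=
  FPTReducible.of_PT pt_hitCircuit (g := fun k => k) Computable.id (fun _ _ => le_rfl)
    fun x k => hitCircuit_yes_iff x.1 x.2 k

/-! ### Normal forms of circuits of bounded depth -/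

/-- Conjunction or disjunction of the values of `f` on a list. -/
def aggr {β : Type} (b : Bool) (f : β → Bool) (l : List β) : Bool :=
  bif b then l.all f else l.any f

section
variable {β γ : Type}

theorem aggr_flatMap (b : Bool) (f : γ → Bool) (F : β → List γ) (l : List β) :
    aggr b f (l.flatMap F) = aggr b (fun x => aggr b f (F x)) l := by
  cases b <;> simp [aggr, List.any_flatMap, List.all_flatMap]

theorem aggr_congr {b : Bool} {f g : β → Bool} {l : List β} (h : ∀ a ∈ l, f a = g a) :
    aggr b f l = aggr b g l := by
  rw [Bool.eq_iff_iff]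
  cases b
  · simp only [aggr, cond_false, List.any_eq_true]
    exact exists_congr fun a => and_congr_right fun ha => by rw [h a ha]
  · simp only [aggr, cond_true, List.all_eq_true]
    exact forall₂_congr fun a ha => by rw [h a ha]

/-- De Morgan's laws: asking for the value `false` exchanges the two operations. The requested value
`s` therefore replaces explicit negations in normal forms. -/
theorem aggr_beq (b s : Bool) (f : β → Bool) (l : List β) :
    (aggr b f l == s) = aggr (b == s) (fun a => f a == s) l := by
  cases b <;> cases s <;> simp [aggr, List.any_eq_not_all_not]

/-- The value of a normal form: outer conjunctions for `pol = true`, disjunctions otherwise. -/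
def nfEval (pol : Bool) (ev : β → Bool) (D : List (List β)) : Bool :=
  aggr pol (aggr (!pol) ev) D

theorem nfEval_flatMap (pol : Bool) (ev : γ → Bool) (F : β → List (List γ)) (l : List β) :
    nfEval pol ev (l.flatMap F) = aggr pol (fun x => nfEval pol ev (F x)) l :=
  aggr_flatMap _ _ _ _

/-- Distributivity. The case `pol = true` is the dual of the other one and is proved on the negated
statements. -/
theorem nfEval_prod (pol : Bool) (ev : β → Bool) (A B : List (List β)) :
    nfEval pol ev (A.flatMap fun x => B.map fun y => x ++ y) =
      aggr (!pol) (nfEval pol ev) [A, B] := by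
  cases pol
  · rw [Bool.eq_iff_iff]
    simp only [nfEval, aggr, Bool.not_false, cond_false, cond_true, List.any_eq_true,
      List.mem_flatMap, List.mem_map, List.all_cons, List.all_nil, Bool.and_true,
      Bool.and_eq_true]
    constructor
    · rintro ⟨_, ⟨x, hx, y, hy, rfl⟩, h⟩
      rw [List.all_append, Bool.and_eq_true] at h
      exact ⟨⟨x, hx, h.1⟩, ⟨y, hy, h.2⟩⟩
    · rintro ⟨⟨x, hx, h⟩, ⟨y, hy, h'⟩⟩
      exact ⟨_, ⟨x, hx, y, hy, rfl⟩, by rw [List.all_append, h, h']; rfl⟩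
  · rw [Bool.eq_iff_iff, ← not_iff_not]
    simp only [nfEval, aggr, Bool.not_true, cond_false, cond_true, List.all_eq_true,
      List.mem_flatMap, List.mem_map, List.any_cons, List.any_nil, Bool.or_false,
      Bool.or_eq_true, not_or, not_forall]
    constructor
    · rintro ⟨_, ⟨x, hx, y, hy, rfl⟩, h⟩
      rw [List.any_append, Bool.or_eq_true, not_or] at h
      exact ⟨⟨x, hx, h.1⟩, ⟨y, hy, h.2⟩⟩
    · rintro ⟨⟨x, hx, h⟩, ⟨y, hy, h'⟩⟩
      exact ⟨_, ⟨x, hx, y, hy, rfl⟩, by rw [List.any_append, Bool.or_eq_true, not_or]; exact ⟨h, h'⟩⟩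

end

/-- The data of a circuit that its normal forms depend on: the number of inputs and the gates,
given by a number for the operation and the list of arguments. -/
abbrev Net : Type := ℕ × List (ℕ × List ℕ)

/-- The gate of the wire `w`. -/
def Net.gate (c : Net) (w : ℕ) : ℕ × List ℕ := c.2.getD (w - c.1) (0, [])

@[fun_prop]
theorem pt_net_gate {α : Type} [TreeEnc α] {c : α → Net} {w : α → ℕ} (hc : PT c) (hw : PT w) :
    PT (fun a => (c a).gate (w a)) := by
  unfold Net.gate
  fun_prop

/-- A normal form for the statement that the wire `p.2.1` of the circuit `p.1` has the value
`p.2.2`: a conjunction of disjunctions for `pol = true`, a disjunction of conjunctions otherwise.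
Gates of the inner operation are multiplied out if they are small, and treated by `lower` if they
are large. -/
def norm {X : Type} (pol : Bool) (lower : Net × ℕ × Bool → X) :
    ℕ → Net × ℕ × Bool → List (List X)
  | 0, p => [[lower p]]
  | h + 1, p =>
    bif Nat.blt p.2.1 p.1.1 then [[lower p]] else
    bif (p.1.gate p.2.1).1 == 0 then norm pol lower h (p.1, (p.1.gate p.2.1).2.headD 0, !p.2.2) else
    bif (((p.1.gate p.2.1).1 == 1) == p.2.2) == pol then
      (p.1.gate p.2.1).2.flatMap fun a => norm pol lower h (p.1, a, p.2.2) else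
    bif Nat.blt 2 (p.1.gate p.2.1).2.length then [[lower p]] else
    bif (p.1.gate p.2.1).2.length == 0 then [[]] else
    bif (p.1.gate p.2.1).2.length == 1 then
      norm pol lower h (p.1, (p.1.gate p.2.1).2.getD 0 0, p.2.2) else
    (norm pol lower h (p.1, (p.1.gate p.2.1).2.getD 0 0, p.2.2)).flatMap fun x =>
      (norm pol lower h (p.1, (p.1.gate p.2.1).2.getD 1 0, p.2.2)).map fun y => x ++ y

/-- The depth `h` is a constant, so the recursion unfolds to finitely many polynomial-time
operations, with a polynomial that depends on `h`. -/
theorem pt_norm {X : Type} [TreeEnc X] {pol : Bool} {lower : Net × ℕ × Bool → X}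
    (hl : PT lower) (h : ℕ) : PT (norm pol lower h) := by
  induction h with
  | zero => exact (hl.listCons (PT.const [])).listCons (PT.const [])
  | succ h ih =>
    change PT (fun p => norm pol lower (h + 1) p)
    simp only [norm]
    generalize norm pol lower h = N at ih
    fun_prop

/-- Inner lists grow only where a gate of fan-in two is multiplied out, which at most doubles their
length at each level. Gates of larger fan-in are either of the outer kind or left to `lower`. -/
theorem length_le_of_mem_norm {X : Type} {pol : Bool} {lower : Net × ℕ × Bool → X} {h : ℕ}
    {p : Net × ℕ × Bool} {l : List X} (hl : l ∈ norm pol lower h p) : l.length ≤ 2 ^ h := by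
  induction h generalizing p l with
  | zero => simp only [norm, List.mem_singleton] at hl; simp [hl]
  | succ h ih =>
    have h1 : 1 ≤ 2 ^ h := Nat.one_le_two_pow
    simp only [norm, Bool.cond_eq_ite] at hl
    rw [pow_succ]
    split_ifs at hl
    · simp only [List.mem_singleton] at hl; simp [hl]; omega
    · have := ih hl; omega
    · obtain ⟨a, -, ha⟩ := List.mem_flatMap.1 hl
      have := ih ha; omega
    · simp only [List.mem_singleton] at hl; simp [hl]; omega
    · simp only [List.mem_singleton] at hl; simp [hl]
    · have := ih hl; omega
    · obtain ⟨x, hx, hl⟩ := List.mem_flatMap.1 hl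
      obtain ⟨y, hy, rfl⟩ := List.mem_map.1 hl
      have := ih hx
      have := ih hy
      rw [List.length_append]
      omega

theorem exists_eq_lower_of_mem_norm {X : Type} {pol : Bool} {lower : Net × ℕ × Bool → X} {h : ℕ}
    {p : Net × ℕ × Bool} {l : List X} (hl : l ∈ norm pol lower h p) {y : X} (hy : y ∈ l) :
    ∃ q, y = lower q := by
  induction h generalizing p l with
  | zero => simp only [norm, List.mem_singleton] at hl; exact ⟨p, by simpa [hl] using hy⟩
  | succ h ih =>
    simp only [norm, Bool.cond_eq_ite] at hl
    split_ifs at hl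
    · exact ⟨p, by simpa [List.mem_singleton.1 hl] using hy⟩
    · exact ih hl hy
    · obtain ⟨a, -, ha⟩ := List.mem_flatMap.1 hl
      exact ih ha hy
    · exact ⟨p, by simpa [List.mem_singleton.1 hl] using hy⟩
    · simp [List.mem_singleton.1 hl] at hy
    · exact ih hl hy
    · obtain ⟨x, hx, hl⟩ := List.mem_flatMap.1 hl
      obtain ⟨y, hy', rfl⟩ := List.mem_map.1 hl
      rcases List.mem_append.1 hy with h | h
      · exact ih hx h
      · exact ih hy' h

/-- A gate as a pair of numbers and arguments. -/
def Gate.raw : Gate → ℕ × List ℕ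
  | .not a => (0, [a])
  | .and l => (1, l)
  | .or l => (2, l)

/-- The data of a circuit for normal forms. -/
def Circuit.net (C : Circuit) : Net := (C.inputs, C.gates.map Gate.raw)

theorem Circuit.net_gate (C : Circuit) {i : ℕ} (hi : i < C.gates.length) :
    C.net.gate (C.inputs + i) = C.gates[i].raw := by
  simp [Circuit.net, Net.gate, List.getD_eq_getElem?_getD, hi]

theorem enc_raw (g : Gate) : enc g.raw = enc g := by
  cases g <;> rfl

/-- `w` is a gate, not a negation, and the statement that it has the value `s` is a conjunction
(for `b = true`) or a disjunction of the same statement for its arguments. -/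
def Circuit.IsAggr (C : Circuit) (b : Bool) (w : ℕ) (s : Bool) : Prop :=
  ∃ (i : ℕ) (hi : i < C.gates.length), w = C.inputs + i ∧ C.gates[i].raw.1 ≠ 0 ∧
    ((C.gates[i].raw.1 == 1) == s) = b

/-- The arguments of the wire `w` have weft at most `t`. -/
def Circuit.ArgsWeft (C : Circuit) (t w : ℕ) : Prop :=
  ∀ a ∈ (C.net.gate w).2, C.wireWeft a ≤ t

theorem gate_raw_args (g : Gate) : g.raw.2 = g.args := by cases g <;> rfl

theorem nfEval_singleton {X : Type} (pol : Bool) (ev : X → Bool) (y : X) :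
    nfEval pol ev [[y]] = ev y := by
  cases pol <;> simp [nfEval, aggr]

theorem nfEval_nil {X : Type} (pol : Bool) (ev : X → Bool) :
    nfEval pol ev [[]] = !pol := by
  cases pol <;> simp [nfEval, aggr]

theorem Gate.eval_eq_aggr {g : Gate} (hg : g.raw.1 ≠ 0) (v : ℕ → Bool) :
    g.eval v = aggr (g.raw.1 == 1) v g.raw.2 := by
  cases g with
  | not a => exact absurd rfl hg
  | and l => rfl
  | or l => rfl

/-- The only gates that reach `lower` are large gates of the inner kind. If such a gate has weft at
most `t`, its arguments have weft at most `t - 1`. For the next form down, whose polarity is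
opposite, the gate is of the outer kind and is expanded for free, although its own weft may exceed
`t - 1`. The second alternative of `hwt` admits exactly this starting wire. -/
theorem norm_eval {X : Type} {pol : Bool} {lower : Net × ℕ × Bool → X} {ev : X → Bool}
    (C : Circuit) (x : Fin C.inputs → Bool) {t H : ℕ}
    (hin : ∀ w < C.inputs, ∀ s, ev (lower (C.net, w, s)) = (C.val x w == s))
    (hlarge : ∀ w s, C.IsAggr (!pol) w s → C.ArgsWeft (t - 1) w → 0 < t →
      C.wireDepth w ≤ H → ev (lower (C.net, w, s)) = (C.val x w == s))
    {h : ℕ} (hH : h ≤ H) {w : ℕ} {s : Bool} (hw : w < C.inputs + C.gates.length)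
    (hd : C.wireDepth w ≤ h) (hwt : C.wireWeft w ≤ t ∨ C.IsAggr pol w s ∧ C.ArgsWeft t w) :
    nfEval pol ev (norm pol lower h (C.net, w, s)) = (C.val x w == s) := by
  induction h generalizing w s with
  | zero =>
    have hwi : w < C.inputs := by
      by_contra hwi
      obtain ⟨i, rfl⟩ := Nat.exists_eq_add_of_le (not_lt.1 hwi)
      rw [C.wireDepth_gate (by omega)] at hd
      omega
    rw [norm, nfEval_singleton, hin w hwi]
  | succ h ih =>
    by_cases hwi : w < C.inputs
    · have hb : Nat.blt w C.net.1 = true := by simpa [Nat.blt, Circuit.net] using hwi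
      simp only [norm, hb, cond_true]
      rw [nfEval_singleton, hin w hwi]
    have hb : Nat.blt w C.net.1 = false := by
      rw [Bool.eq_false_iff]; simpa [Nat.blt, Circuit.net] using hwi
    obtain ⟨i, rfl⟩ := Nat.exists_eq_add_of_le (not_lt.1 hwi)
    have hi : i < C.gates.length := by omega
    have hargs : ∀ a ∈ C.gates[i].raw.2, a < C.inputs + i := by
      rw [gate_raw_args]; exact C.acyclic i hi
    have hdep : ∀ a ∈ C.gates[i].raw.2, C.wireDepth a ≤ h := by
      rw [C.wireDepth_gate hi, Nat.succ_le_succ_iff, maxOver_le_iff] at hd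
      rwa [gate_raw_args]
    have hweft : ∀ a ∈ C.gates[i].raw.2, C.wireWeft a ≤ t := by
      rcases hwt with h1 | ⟨-, h1⟩
      · rw [C.wireWeft_gate hi] at h1
        rw [gate_raw_args]
        exact maxOver_le_iff.1 (by omega)
      · rwa [Circuit.ArgsWeft, C.net_gate hi] at h1
    have ih' : ∀ a ∈ C.gates[i].raw.2, ∀ s,
        nfEval pol ev (norm pol lower h (C.net, a, s)) = (C.val x a == s) := fun a ha s =>
      ih (by omega) (by have := hargs a ha; omega) (hdep a ha) (.inl (hweft a ha))
    simp only [norm, hb, cond_false, C.net_gate hi]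
    rw [C.val_gate x hi]
    by_cases h0 : C.gates[i].raw.1 = 0
    · simp only [h0, beq_self_eq_true, cond_true]
      cases hg : C.gates[i] with
      | not a =>
        rw [hg] at ih'
        rw [show (Gate.not a).raw.2.headD 0 = a from rfl, ih' a (by simp [Gate.raw])]
        simp only [Gate.eval]
        cases C.val x a <;> cases s <;> rfl
      | and l => rw [hg] at h0; cases h0
      | or l => rw [hg] at h0; cases h0
    rw [Gate.eval_eq_aggr h0, aggr_beq]
    simp only [beq_eq_false_iff_ne.2 h0, cond_false]
    by_cases hp : ((C.gates[i].raw.1 == 1) == s) = pol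
    · simp only [hp, beq_self_eq_true, cond_true]
      rw [nfEval_flatMap]
      exact aggr_congr fun a ha => ih' a ha s
    simp only [beq_eq_false_iff_ne.2 hp, cond_false]
    have hp' : ((C.gates[i].raw.1 == 1) == s) = !pol := by
      revert hp
      generalize ((C.gates[i].raw.1 == 1) == s) = u
      cases u <;> cases pol <;> simp
    rw [hp']
    by_cases hlen : 2 < C.gates[i].raw.2.length
    · have hb' : Nat.blt 2 C.gates[i].raw.2.length = true := blt_iff.2 hlen
      simp only [hb', cond_true]
      rw [nfEval_singleton, ← hp', ← aggr_beq, ← Gate.eval_eq_aggr h0, ← C.val_gate x hi]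
      -- A gate of the inner kind excludes the second alternative of `hwt`. Being large, the gate
      -- then uses up one unit of weft.
      have h1 : C.wireWeft (C.inputs + i) ≤ t := by
        rcases hwt with h1 | ⟨⟨j, hj, hij, -, h2⟩, -⟩
        · exact h1
        · have : j = i := by omega
          subst this
          exact absurd h2 hp
      have hL : C.gates[i].isLarge = true := by
        rw [Gate.isLarge, ← gate_raw_args]; simpa using hlen
      rw [C.wireWeft_gate hi, hL, if_pos rfl] at h1
      refine hlarge _ s ⟨i, hi, rfl, h0, hp'⟩ ?_ (by omega) (hd.trans hH)
      rw [Circuit.ArgsWeft, C.net_gate hi, gate_raw_args]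
      exact maxOver_le_iff.1 (by omega)
    have hb' : Nat.blt 2 C.gates[i].raw.2.length = false := by
      rw [Bool.eq_false_iff]; exact fun h => hlen (blt_iff.1 h)
    simp only [hb', cond_false]
    generalize C.gates[i].raw.2 = l at ih' hlen
    match l, hlen with
    | [], _ =>
      simp only [List.length_nil, beq_self_eq_true, cond_true]
      rw [nfEval_nil]
      cases pol <;> rfl
    | [a], _ =>
      simp only [List.length_singleton, List.getD_cons_zero]
      rw [show ((1 : ℕ) == 0) = false from rfl, cond_false, beq_self_eq_true, cond_true,
        ih' a (by simp) s]
      cases pol <;> simp [aggr]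
    | [a, b], _ =>
      simp only [List.length_cons, List.length_nil, List.getD_cons_zero, List.getD_cons_succ]
      rw [show ((0 + 1 + 1 : ℕ) == 0) = false from rfl,
        show ((0 + 1 + 1 : ℕ) == 1) = false from rfl, cond_false, cond_false, nfEval_prod]
      cases pol <;> simp [aggr, ih']
    | _ :: _ :: _ :: _, hlen => simp at hlen

/-! ### The four-level normal form of a circuit of weft two -/

/-- A literal: a variable and its value. -/
abbrev Literal : Type := ℕ × Bool

/-- Disjunctions of conjunctions of literals. -/
def norm₀ (h : ℕ) : Net × ℕ × Bool → List (List Literal) :=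
  norm false (fun p => (p.2.1, p.2.2)) h

/-- Conjunctions of disjunctions over `norm₀`. -/
def norm₁ (h : ℕ) : Net × ℕ × Bool → List (List (List (List Literal))) :=
  norm true (norm₀ h) h

/-- Disjunctions of conjunctions over `norm₁`. -/
def norm₂ (h : ℕ) : Net × ℕ × Bool → List (List (List (List (List (List Literal))))) :=
  norm false (norm₁ h) h

/-- The normal form of the output of a circuit: a disjunction of conjunctions of disjunctions of
conjunctions of literals. -/
def outputForm (h : ℕ) (c : Net) (w : ℕ) : List (List (List (List Literal))) :=
  (norm₂ h (c, w, true)).map fun l => l.flatten.map List.flatten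

@[fun_prop]
theorem pt_outputForm {α : Type} [TreeEnc α] (h : ℕ) {c : α → Net} {w : α → ℕ} (hc : PT c)
    (hw : PT w) : PT (fun a => outputForm h (c a) (w a)) := by
  have h0 : PT (norm₀ h) := pt_norm (by fun_prop) h
  have h1 : PT (norm₁ h) := pt_norm h0 h
  have h2 : PT (norm₂ h) := pt_norm h1 h
  unfold outputForm
  fun_prop

theorem length_le_of_mem_outputForm {h : ℕ} {c : Net} {w : ℕ} {F : List (List (List Literal))}
    (hF : F ∈ outputForm h c w) {cl : List (List Literal)} (hcl : cl ∈ F) {t : List Literal}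
    (ht : t ∈ cl) : t.length ≤ 2 ^ h := by
  obtain ⟨l, hl, rfl⟩ := List.mem_map.1 hF
  obtain ⟨m, hm, rfl⟩ := List.mem_map.1 hcl
  obtain ⟨u, hu, hmu⟩ := List.mem_flatten.1 hm
  obtain ⟨y, hy, hty⟩ := List.mem_flatten.1 ht
  obtain ⟨q, rfl⟩ := exists_eq_lower_of_mem_norm hl hu
  obtain ⟨q', rfl⟩ := exists_eq_lower_of_mem_norm hmu hy
  exact length_le_of_mem_norm hty

/-- `norm_eval` is applied for weft `0`, `1` and `2` with alternating polarity; at weft `0` no large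
gate is left, so the leaves are literals. The inner operation of each form is the outer operation of
the next one, so flattening merges six levels into four. -/
theorem outputForm_eval {h : ℕ} (C : Circuit) (hw : C.weft ≤ 2) (hd : C.depth ≤ h)
    (x : Fin C.inputs → Bool) (ev : Literal → Bool)
    (hev : ∀ w < C.inputs, ∀ s, ev (w, s) = (C.val x w == s)) :
    C.eval x = (outputForm h C.net C.output).any fun F => F.all fun cl => cl.any fun t =>
      t.all ev := by
  have h0 : ∀ w s, w < C.inputs + C.gates.length → C.wireDepth w ≤ h →
      (C.wireWeft w ≤ 0 ∨ C.IsAggr false w s ∧ C.ArgsWeft 0 w) →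
      nfEval false ev (norm₀ h (C.net, w, s)) =
        (C.val x w == s) := fun w s h1 h2 h3 =>
    norm_eval C x hev (fun _ _ _ _ h => absurd h (lt_irrefl _)) le_rfl h1 h2 h3
  have lift : ∀ {w s b}, C.IsAggr b w s → w < C.inputs + C.gates.length := by
    rintro w s b ⟨i, hi, rfl, -⟩
    omega
  have hin : ∀ w < C.inputs, C.wireDepth w ≤ h := fun w hw => by rw [C.wireDepth_input hw]; omega
  have h1 : ∀ w s, w < C.inputs + C.gates.length → C.wireDepth w ≤ h →
      (C.wireWeft w ≤ 1 ∨ C.IsAggr true w s ∧ C.ArgsWeft 1 w) →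
      nfEval true (nfEval false ev) (norm₁ h (C.net, w, s)) =
        (C.val x w == s) := fun w s h1 h2 h3 =>
    norm_eval (pol := true) C x (fun w hw s => h0 w s (by omega) (hin w hw) (.inl (C.wireWeft_input hw).le))
      (fun w s h4 h5 _ h6 => h0 w s (lift h4) h6 (.inr ⟨h4, h5⟩)) le_rfl h1 h2 h3
  have h2 : nfEval false (nfEval true (nfEval false ev))
      (norm₂ h (C.net, C.output, true)) = (C.val x C.output == true) :=
    norm_eval (pol := false) C x (t := 2)
      (fun w hw s => h1 w s (by omega) (hin w hw) (.inl ((C.wireWeft_input hw).le.trans (by omega))))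
      (fun w s h4 h5 _ h6 => h1 w s (lift h4) h6 (.inr ⟨h4, h5⟩)) le_rfl C.output_lt hd (.inl hw)
  have h3 : C.eval x = C.val x C.output := rfl
  rw [beq_true] at h2
  rw [h3, ← h2]
  simp only [outputForm, nfEval, aggr, Bool.not_false, cond_false,
    List.any_map, List.all_map, List.all_flatten, List.any_flatten, Function.comp_def]
  rfl

/-! ### Sets of variables as chains of positions

A set of `k` variables below `n` is given by the increasing sequence of positions
`0 = a 0 < a 1 < ⋯ < a (k + 1) = n + 1`, where the variable `w` has the position `w + 1`. Both a
positive and a negative literal are then witnessed by one pair of consecutive positions. -/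

/-- `a` is an increasing sequence of positions from `0` to `n + 1`, with `k` steps in between. -/
structure IsChain (n k : ℕ) (a : ℕ → ℕ) : Prop where
  zero : a 0 = 0
  last : a (k + 1) = n + 1
  lt : ∀ s < k + 1, a s < a (s + 1)

/-- The consecutive positions `g` witness that the literal `l` is true. -/
def gapHolds (g : ℕ × ℕ) (l : Literal) : Bool :=
  bif l.2 then g.1 == l.1 + 1 else Nat.blt g.1 (l.1 + 1) && Nat.blt (l.1 + 1) g.2

/-- The literal `l` is witnessed by the chain `a`. -/
def chainHolds (k : ℕ) (a : ℕ → ℕ) (l : Literal) : Bool :=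
  (List.range (k + 1)).any fun s => gapHolds (a s, a (s + 1)) l

theorem IsChain.mono {n k : ℕ} {a : ℕ → ℕ} (ha : IsChain n k a) {s t : ℕ} (h : s < t)
    (ht : t ≤ k + 1) : a s < a t := by
  induction t with
  | zero => omega
  | succ t ih =>
    have h1 := ha.lt t (by omega)
    rcases Nat.lt_succ_iff_lt_or_eq.1 h with h' | rfl
    · exact (ih h' (by omega)).trans h1
    · exact h1

theorem IsChain.mono_le {n k : ℕ} {a : ℕ → ℕ} (ha : IsChain n k a) {s t : ℕ} (h : s ≤ t)
    (ht : t ≤ k + 1) : a s ≤ a t := by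
  rcases h.lt_or_eq with h | rfl
  · exact (ha.mono h ht).le
  · exact le_rfl

/-- The variable `w` belongs to the set given by the chain `a`. -/
def InChain (k : ℕ) (a : ℕ → ℕ) (w : ℕ) : Prop := ∃ s, s < k ∧ a (s + 1) = w + 1

theorem IsChain.chainHolds_true {n k : ℕ} {a : ℕ → ℕ} (ha : IsChain n k a) {w : ℕ} :
    chainHolds k a (w, true) = true ↔ InChain k a w := by
  simp only [chainHolds, gapHolds, cond_true, List.any_eq_true, List.mem_range, beq_iff_eq, InChain]
  constructor
  · rintro ⟨s, hs, h⟩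
    -- The position `0` belongs to no variable; this is the purpose of the shift by one.
    cases s with
    | zero => rw [ha.zero] at h; omega
    | succ s => exact ⟨s, by omega, h⟩
  · rintro ⟨s, hs, h⟩
    exact ⟨s + 1, by omega, h⟩

/-- A position that the chain misses lies strictly between the last chain element below it and the
following one. The end points `0` and `n + 1` ensure that both exist for every variable. -/
theorem IsChain.chainHolds_false {n k : ℕ} {a : ℕ → ℕ} (ha : IsChain n k a) {w : ℕ} (hw : w < n) :
    chainHolds k a (w, false) = true ↔ ¬ InChain k a w := by
  simp only [chainHolds, gapHolds, cond_false, List.any_eq_true, List.mem_range, Bool.and_eq_true,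
    blt_iff, InChain]
  constructor
  · rintro ⟨s, hs, h1, h2⟩ ⟨r, hr, h⟩
    rcases Nat.lt_or_ge s (r + 1) with h' | h'
    · have := ha.mono_le (s := s + 1) (t := r + 1) h' (by omega)
      omega
    · have := ha.mono_le h' (by omega)
      omega
  · intro hne
    set s := Nat.findGreatest (fun s => a s < w + 1) k with hs
    have h0 : a 0 < w + 1 := by rw [ha.zero]; omega
    have h1 : a s < w + 1 := Nat.findGreatest_spec (P := fun s => a s < w + 1) (Nat.zero_le k) h0
    have hsk : s ≤ k := Nat.findGreatest_le k
    refine ⟨s, by omega, h1, ?_⟩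
    rcases hsk.lt_or_eq with h | h
    · have h2 : ¬ a (s + 1) < w + 1 :=
        Nat.findGreatest_is_greatest (P := fun s => a s < w + 1) (Nat.lt_succ_self s) h
      have h3 : a (s + 1) ≠ w + 1 := fun e => hne ⟨s, h, e⟩
      omega
    · rw [h, ha.last]
      omega

theorem IsChain.chainHolds_eq {n k : ℕ} {a : ℕ → ℕ} (ha : IsChain n k a) {w : ℕ} (hw : w < n)
    {b : Bool} (hb : b = true ↔ InChain k a w) (s : Bool) : chainHolds k a (w, s) = (b == s) := by
  rw [Bool.eq_iff_iff, beq_iff_eq]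
  cases s
  · rw [ha.chainHolds_false hw, ← hb, Bool.not_eq_true]
  · rw [ha.chainHolds_true, ← hb]

theorem IsChain.card {n k : ℕ} {a : ℕ → ℕ} (ha : IsChain n k a) (x : Fin n → Bool)
    (hx : ∀ w, x w = true ↔ InChain k a w) :
    (Finset.univ.filter fun w => x w = true).card = k := by
  have hpos : ∀ s : Fin k, 0 < a (s + 1) ∧ a (s + 1) < n + 1 := fun s => by
    have h1 := ha.mono (s := 0) (t := s + 1) (by omega) (by omega)
    have h2 := ha.mono (s := s + 1) (t := k + 1) (by omega) le_rfl
    rw [ha.last] at h2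
    omega
  have himg : (Finset.univ.filter fun w => x w = true) =
      Finset.univ.image fun s : Fin k => (⟨a (s + 1) - 1, by have := hpos s; omega⟩ : Fin n) := by
    ext w
    simp only [Finset.mem_filter, Finset.mem_univ, true_and, Finset.mem_image, hx, InChain]
    constructor
    · rintro ⟨s, hs, h⟩
      exact ⟨⟨s, hs⟩, Fin.ext (by simp [h])⟩
    · rintro ⟨s, rfl⟩
      exact ⟨s, s.2, by have := hpos s; simp; omega⟩
  rw [himg, Finset.card_image_of_injective, Finset.card_univ, Fintype.card_fin]
  intro s t hst
  have h1 : a (s + 1) - 1 = a (t + 1) - 1 := congrArg Fin.val hst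
  have := hpos s
  have := hpos t
  rcases lt_trichotomy s t with h | h | h
  · have := ha.mono (s := s + 1) (t := t + 1) (by omega) (by omega); omega
  · exact h
  · have := ha.mono (s := t + 1) (t := s + 1) (by omega) (by omega); omega

/-- The chain is the increasing enumeration of the set, shifted by one, between the end points `0`
and `n + 1`. -/
theorem exists_isChain {n k : ℕ} (x : Fin n → Bool)
    (hx : (Finset.univ.filter fun w => x w = true).card = k) :
    ∃ a, IsChain n k a ∧ ∀ w, x w = true ↔ InChain k a w := by
  set S := Finset.univ.filter fun w => x w = true
  let e := S.orderEmbOfFin hx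
  let a : ℕ → ℕ := fun s => if s = 0 then 0 else if h : s - 1 < k then (e ⟨s - 1, h⟩).val + 1
    else n + 1
  have hin : ∀ s (h : s < k), a (s + 1) = (e ⟨s, h⟩).val + 1 := fun s h => by simp [a, h]
  have hlast : a (k + 1) = n + 1 := by simp [a]
  refine ⟨a, ⟨by simp [a], hlast, fun s hs => ?_⟩, fun w => ?_⟩
  · cases s with
    | zero =>
      have : a (0 + 1) ≠ 0 := by
        simp only [a]
        split_ifs <;> simp_all
      have : a 0 = 0 := by simp [a]
      omega
    | succ s =>
      have h1 := hin s (by omega)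
      rcases Nat.lt_or_ge (s + 1) k with h | h
      · have h2 := hin (s + 1) h
        have h3 : e ⟨s, by omega⟩ < e ⟨s + 1, h⟩ := e.strictMono (by simp)
        have h4 : (e ⟨s, by omega⟩).val < (e ⟨s + 1, h⟩).val := h3
        omega
      · have : s + 1 = k := by omega
        have h2 : a (s + 1 + 1) = n + 1 := by rw [this, hlast]
        have := (e ⟨s, by omega⟩).2
        omega
  · have h1 : x w = true ↔ w ∈ Set.range e := by
      rw [Finset.range_orderEmbOfFin]
      simp [S]
    rw [h1]
    constructor
    · rintro ⟨s, rfl⟩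
      exact ⟨s, s.2, hin s s.2⟩
    · rintro ⟨s, hs, h⟩
      rw [hin s hs] at h
      exact ⟨⟨s, hs⟩, Fin.ext (by omega)⟩

/-! ### From normal forms to hitting sets -/

/-- Disjunctions of conjunctions of disjunctions of conjunctions of literals. -/
abbrev Form : Type := List (List (List (List Literal)))

/-- The pairs `(a, b)` with `a < b ≤ n + 1`. -/
def gaps (n : ℕ) : List (ℕ × ℕ) :=
  (List.range (n + 2)).flatMap fun a =>
    ((List.range (n + 2)).filter fun b => Nat.blt a b).map fun b => (a, b)

theorem mem_gaps {n : ℕ} {g : ℕ × ℕ} : g ∈ gaps n ↔ g.1 < g.2 ∧ g.2 < n + 2 := by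
  obtain ⟨a, b⟩ := g
  simp only [gaps, List.mem_flatMap, List.mem_map, List.mem_filter, List.mem_range, blt_iff,
    Prod.mk.injEq]
  constructor
  · rintro ⟨_, h1, _, ⟨h2, h3⟩, rfl, rfl⟩
    exact ⟨h3, h2⟩
  · rintro ⟨h1, h2⟩
    exact ⟨a, by omega, b, ⟨h2, h1⟩, rfl, rfl⟩

/-- The slots: positions `0, …, k + 1`, the choice `k + 2` of a disjunct, and one slot for every
tuple of `r` pairs of consecutive positions. -/
def formSlots (r k : ℕ) : List (ℕ ⊕ List ℕ) :=
  ((List.range (k + 3)).map fun s => .inl s) ++ ((tuples r (List.range (k + 1))).map fun σ => .inr σ)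

/-- The options of the slots. -/
def formOptions (r n d k : ℕ) (i : ℕ ⊕ List ℕ) : List (ℕ × List (ℕ × ℕ)) :=
  Sum.elim
    (fun s => (bif s == 0 then [0] else bif s == k + 1 then [n + 1] else
      bif s == k + 2 then List.range d else List.range (n + 2)).map fun v => (v, []))
    (fun _ => (tuples r (gaps n)).map fun τ => (0, τ)) i

/-- The clauses: `(σ, j, e, v)` for the consistency of the entry `j` of the tuple slot `σ` with the
positions, and `(i, c)` for the conjunct `c` of the disjunct `i`. -/
def formClauses (r n : ℕ) (D : Form) (k : ℕ) :
    List ((List ℕ × ℕ × ℕ × ℕ) ⊕ (ℕ × List (List Literal))) :=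
  ((tuples r (List.range (k + 1))).flatMap fun σ => (List.range r).flatMap fun j =>
    (List.range 2).flatMap fun e => (List.range (n + 2)).map fun v => .inl (σ, j, e, v)) ++
  ((List.range D.length).flatMap fun i => (D.getD i []).map fun c => .inr (i, c))

/-- The option `v` of the slot `i` hits the clause `c`. -/
def formInc (k : ℕ) (i : ℕ ⊕ List ℕ) (v : ℕ × List (ℕ × ℕ))
    (c : (List ℕ × ℕ × ℕ × ℕ) ⊕ (ℕ × List (List Literal))) : Bool :=
  Sum.elim
    (fun s => Sum.elim (fun q => (s == q.1.getD q.2.1 0 + q.2.2.1) && (v.1 == q.2.2.2))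
      (fun q => (s == k + 2) && !(v.1 == q.1)) c)
    (fun σ => Sum.elim
      (fun q => (σ == q.1) && !((bif q.2.2.1 == 0 then (v.2.getD q.2.1 (0, 0)).1
        else (v.2.getD q.2.1 (0, 0)).2) == q.2.2.2))
      (fun q => q.2.any fun t => t.all fun l => v.2.any fun g => gapHolds g l) c) i

/-- The hitting set instance of a normal form. -/
def formInstance (r n : ℕ) (D : Form) (k : ℕ) : ℕ × List (List (List Bool)) :=
  hitInstance (formSlots r k) (formOptions r n D.length k) (formClauses r n D k) (formInc k)

theorem length_formSlots (r k : ℕ) : (formSlots r k).length = k + 3 + (k + 1) ^ r := by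
  simp [formSlots, length_tuples]

section
variable {α : Type} [TreeEnc α]

@[fun_prop]
theorem pt_gapHolds {g : α → ℕ × ℕ} {l : α → Literal} (hg : PT g) (hl : PT l) :
    PT (fun a => gapHolds (g a) (l a)) := by
  unfold gapHolds
  fun_prop

@[fun_prop]
theorem pt_gaps {n : α → ℕ} (hn : PT n) : PT (fun a => gaps (n a)) := by
  unfold gaps
  fun_prop

@[fun_prop]
theorem pt_formSlots (r : ℕ) {k : α → ℕ} (hk : PT k) : PT (fun a => formSlots r (k a)) := by
  unfold formSlots
  fun_prop

@[fun_prop]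
theorem pt_formOptions (r : ℕ) {n d k : α → ℕ} {i : α → ℕ ⊕ List ℕ} (hn : PT n) (hd : PT d)
    (hk : PT k) (hi : PT i) : PT (fun a => formOptions r (n a) (d a) (k a) (i a)) := by
  unfold formOptions
  fun_prop

@[fun_prop]
theorem pt_formClauses (r : ℕ) {n k : α → ℕ} {D : α → Form} (hn : PT n) (hD : PT D) (hk : PT k) :
    PT (fun a => formClauses r (n a) (D a) (k a)) := by
  unfold formClauses
  fun_prop

@[fun_prop]
theorem pt_formInc {k : α → ℕ} {i : α → ℕ ⊕ List ℕ} {v : α → ℕ × List (ℕ × ℕ)}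
    {c : α → (List ℕ × ℕ × ℕ × ℕ) ⊕ (ℕ × List (List Literal))} (hk : PT k) (hi : PT i) (hv : PT v)
    (hc : PT c) : PT (fun a => formInc (k a) (i a) (v a) (c a)) := by
  unfold formInc
  fun_prop

@[fun_prop]
theorem pt_formInstance (r : ℕ) {n k : α → ℕ} {D : α → Form} (hn : PT n) (hD : PT D) (hk : PT k) :
    PT (fun a => formInstance r (n a) (D a) (k a)) := by
  unfold formInstance hitInstance
  fun_prop

end

/-! ### Correctness of the hitting set instance of a normal form -/

theorem nodup_tuples {β : Type} (r : ℕ) {l : List β} (hl : l.Nodup) : (tuples r l).Nodup := by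
  induction r with
  | zero => simp [tuples]
  | succ r ih =>
    rw [tuples, List.nodup_flatMap]
    refine ⟨fun x _ => ih.map fun y z h => (List.cons.inj h).2, ?_⟩
    refine hl.imp fun {x y} hxy => ?_
    intro z hz hz'
    obtain ⟨u, -, rfl⟩ := List.mem_map.1 hz
    obtain ⟨v, -, h⟩ := List.mem_map.1 hz'
    exact hxy (List.cons.inj h).1.symm

theorem nodup_formSlots (r k : ℕ) : (formSlots r k).Nodup := by
  refine List.Nodup.append (List.nodup_range.map Sum.inl_injective)
    ((nodup_tuples r List.nodup_range).map Sum.inr_injective) ?_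
  intro x hx hx'
  obtain ⟨u, -, rfl⟩ := List.mem_map.1 hx
  obtain ⟨v, -, h⟩ := List.mem_map.1 hx'
  cases h

theorem inl_mem_formSlots {r k s : ℕ} : Sum.inl s ∈ formSlots r k ↔ s < k + 3 := by
  simp [formSlots]

theorem inr_mem_formSlots {r k : ℕ} {σ : List ℕ} :
    Sum.inr σ ∈ formSlots r k ↔ σ ∈ tuples r (List.range (k + 1)) := by
  simp [formSlots]

theorem inl_mem_formClauses {r n k j e v : ℕ} {D : Form} {σ : List ℕ} :
    Sum.inl (σ, j, e, v) ∈ formClauses r n D k ↔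
      σ ∈ tuples r (List.range (k + 1)) ∧ j < r ∧ e < 2 ∧ v < n + 2 := by
  simp only [formClauses, List.mem_append, List.mem_flatMap, List.mem_map, List.mem_range,
    Sum.inl.injEq, Prod.mk.injEq, reduceCtorEq, and_false, exists_false, or_false]
  constructor
  · rintro ⟨_, h1, _, h2, _, h3, _, h4, rfl, rfl, rfl, rfl⟩
    exact ⟨h1, h2, h3, h4⟩
  · rintro ⟨h1, h2, h3, h4⟩
    exact ⟨_, h1, _, h2, _, h3, _, h4, rfl, rfl, rfl, rfl⟩

theorem inr_mem_formClauses {r n k i : ℕ} {D : Form} {c : List (List Literal)} :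
    Sum.inr (i, c) ∈ formClauses r n D k ↔ ∃ hi : i < D.length, c ∈ D[i] := by
  simp only [formClauses, List.mem_append, List.mem_flatMap, List.mem_map, List.mem_range,
    Sum.inr.injEq, Prod.mk.injEq, reduceCtorEq, and_false, exists_false, false_or]
  constructor
  · rintro ⟨_, h1, _, h2, rfl, rfl⟩
    exact ⟨h1, by simpa [List.getD_eq_getElem?_getD, h1] using h2⟩
  · rintro ⟨h1, h2⟩
    exact ⟨i, h1, c, by simpa [List.getD_eq_getElem?_getD, h1] using h2, rfl, rfl⟩

/-- A chain that satisfies a normal form gives a solution of the hitting set instance. -/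
theorem formInstance_yes_of_chain {r n k : ℕ} {D : Form} {a : ℕ → ℕ}
    (hD : ∀ F ∈ D, ∀ c ∈ F, ∀ t ∈ c, t.length ≤ r) (ha : IsChain n k a)
    (h : (D.any fun F => F.all fun c => c.any fun t => t.all (chainHolds k a)) = true) :
    ColoredHittingSet.Yes (formInstance r n D k) (formSlots r k).length := by
  rw [formInstance, hitInstance_yes_iff (nodup_formSlots r k)]
  simp only [List.any_eq_true, List.all_eq_true] at h
  obtain ⟨F, hF, hc⟩ := h
  obtain ⟨i, hi, rfl⟩ := List.getElem_of_mem hF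
  have hle : ∀ s ≤ k + 1, a s < n + 2 := fun s hs => by
    have := ha.mono_le hs le_rfl
    rw [ha.last] at this
    omega
  -- Position slots follow the chain, the slot `k + 2` names a true disjunct, and every tuple slot
  -- shows the actual gaps.
  refine ⟨Sum.elim (fun s => (if s = k + 2 then i else a s, []))
    (fun σ => (0, σ.map fun s => (a s, a (s + 1)))), ?_, ?_⟩
  · rintro (s | σ) hs
    · rw [inl_mem_formSlots] at hs
      simp only [formOptions, Sum.elim_inl, List.mem_map, Prod.mk.injEq, and_true, exists_eq_right]
      by_cases h0 : s = 0
      · subst h0; simp [ha.zero]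
      by_cases h1 : s = k + 1
      · subst h1; simp [ha.last]
      by_cases h2 : s = k + 2
      · subst h2
        have hk : (k + 2 == k + 1) = false := by simp
        simpa [hk] using hi
      · simp only [beq_eq_false_iff_ne.2 h0, beq_eq_false_iff_ne.2 h1, beq_eq_false_iff_ne.2 h2,
          cond_false, if_neg h2, List.mem_range]
        exact hle s (by omega)
    · rw [inr_mem_formSlots, mem_tuples] at hs
      simp only [formOptions, Sum.elim_inr, List.mem_map, Prod.mk.injEq, true_and, exists_eq_right,
        mem_tuples, List.length_map, mem_gaps]
      refine ⟨hs.1, ?_⟩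
      rintro g ⟨s, h1, rfl⟩
      have h2 := List.mem_range.1 (hs.2 s h1)
      exact ⟨ha.lt s h2, hle _ (by omega)⟩
  · rintro (⟨σ, j, e, v⟩ | ⟨i', c⟩) hcl
    · rw [inl_mem_formClauses] at hcl
      obtain ⟨h1, h2, h3, h4⟩ := hcl
      obtain ⟨hlen, hσ⟩ := mem_tuples.1 h1
      have hj : j < σ.length := by omega
      have hs := List.mem_range.1 (hσ _ (List.getElem_mem hj))
      -- If the position differs from `v`, then so does the entry of the tuple slot, which repeats
      -- that position.
      by_cases hv : a (σ[j] + e) = v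
      · refine ⟨.inl (σ[j] + e), inl_mem_formSlots.2 (by omega), ?_⟩
        have h5 : σ[j] + e ≠ k + 2 := by omega
        simp [formInc, List.getD_eq_getElem?_getD, hj, hv, h5]
      · refine ⟨.inr σ, inr_mem_formSlots.2 h1, ?_⟩
        have h5 : e = 0 ∨ e = 1 := by omega
        rcases h5 with rfl | rfl
        · rw [add_zero] at hv
          simp [formInc, List.getD_eq_getElem?_getD, hj, hv]
        · simp [formInc, List.getD_eq_getElem?_getD, hj, hv]
    · obtain ⟨hi', hc'⟩ := inr_mem_formClauses.1 hcl
      by_cases he : i' = i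
      · subst he
        obtain ⟨t, ht, hl⟩ := hc c hc'
        have h1 : ∀ l ∈ t, ∃ s < k + 1, gapHolds (a s, a (s + 1)) l = true := fun l hlt => by
          simpa [chainHolds] using hl l hlt
        choose! f hf hg using h1
        have hlen := hD _ hF c hc' t ht
        -- One witnessing gap per literal, padded with the gap `0` to the fixed length `r`.
        have hσ : t.map f ++ List.replicate (r - t.length) 0 ∈ tuples r (List.range (k + 1)) := by
          rw [mem_tuples]
          refine ⟨by simp; omega, fun s hs => ?_⟩
          rw [List.mem_range]
          rcases List.mem_append.1 hs with h | h
          · obtain ⟨l, hl, rfl⟩ := List.mem_map.1 h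
            exact hf l hl
          · have := (List.mem_replicate.1 h).2
            omega
        refine ⟨.inr _, inr_mem_formSlots.2 hσ, ?_⟩
        simp only [formInc, Sum.elim_inr, List.any_eq_true, List.all_eq_true]
        exact ⟨t, ht, fun l hlt => ⟨_, List.mem_map.2 ⟨f l, List.mem_append_left _
          (List.mem_map.2 ⟨l, hlt, rfl⟩), rfl⟩, hg l hlt⟩⟩
      · refine ⟨.inl (k + 2), inl_mem_formSlots.2 (by omega), ?_⟩
        simp [formInc, Ne.symm he]

/-- A solution of the hitting set instance gives a chain that satisfies the normal form. -/
theorem exists_chain_of_formInstance_yes {r n k : ℕ} {D : Form} (hr : 0 < r)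
    (h : ColoredHittingSet.Yes (formInstance r n D k) (formSlots r k).length) :
    ∃ a, IsChain n k a ∧
      (D.any fun F => F.all fun c => c.any fun t => t.all (chainHolds k a)) = true := by
  rw [formInstance, hitInstance_yes_iff (nodup_formSlots r k)] at h
  obtain ⟨f, hf, hc⟩ := h
  set a : ℕ → ℕ := fun s => (f (.inl s)).1 with ha
  set τ : List ℕ → List (ℕ × ℕ) := fun σ => (f (.inr σ)).2 with hτ
  have ha0 : a 0 = 0 := by
    have := hf (.inl 0) (inl_mem_formSlots.2 (by omega))
    simp [formOptions] at this
    simp [ha, this]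
  have ha1 : a (k + 1) = n + 1 := by
    have := hf (.inl (k + 1)) (inl_mem_formSlots.2 (by omega))
    simp [formOptions] at this
    simp [ha, this]
  have ha2 : a (k + 2) < D.length := by
    have := hf (.inl (k + 2)) (inl_mem_formSlots.2 (by omega))
    have hk : (k + 2 == k + 1) = false := by simp
    simp only [formOptions, Sum.elim_inl, hk, cond_false, beq_self_eq_true, cond_true,
      List.mem_map] at this
    obtain ⟨v, hv, h⟩ := this
    simpa [ha, ← h] using hv
  have hτ1 : ∀ σ ∈ tuples r (List.range (k + 1)), (τ σ).length = r ∧ ∀ g ∈ τ σ, g ∈ gaps n := by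
    intro σ hσ
    have := hf (.inr σ) (inr_mem_formSlots.2 hσ)
    simp only [formOptions, Sum.elim_inr, List.mem_map] at this
    obtain ⟨u, hu, h⟩ := this
    rw [hτ]
    simp only [← h]
    exact mem_tuples.1 hu
  have hcons : ∀ σ ∈ tuples r (List.range (k + 1)), ∀ j (hj : j < σ.length)
      (hj' : j < (τ σ).length), (τ σ)[j] = (a σ[j], a (σ[j] + 1)) := by
    intro σ hσ j hj hj'
    have hjr : j < r := by rw [← (mem_tuples.1 hσ).1]; exact hj
    have hg := mem_gaps.1 ((hτ1 σ hσ).2 _ (List.getElem_mem hj'))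
    -- The consistency clause for the very value `v` that the tuple slot shows cannot be hit by this
    -- slot, so the position slot must hold `v`.
    have key : ∀ e < 2, (bif e == 0 then (τ σ)[j].1 else (τ σ)[j].2) = a (σ[j] + e) := by
      intro e he
      set v := (bif e == 0 then (τ σ)[j].1 else (τ σ)[j].2) with hv
      have hv2 : v < n + 2 := by
        rw [hv]
        cases e == 0
        · exact hg.2
        · exact hg.1.trans hg.2
      obtain ⟨s | σ', hs, hi⟩ := hc _ (inl_mem_formClauses.2 ⟨hσ, hjr, he, hv2⟩)
      · simp only [formInc, Sum.elim_inl, Bool.and_eq_true, beq_iff_eq,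
          List.getD_eq_getElem?_getD, hj, List.getElem?_eq_getElem, Option.getD_some] at hi
        rw [← hi.1]
        exact hi.2.symm
      · simp only [formInc, Sum.elim_inl, Sum.elim_inr, Bool.and_eq_true, beq_iff_eq,
          Bool.not_eq_true', beq_eq_false_iff_ne] at hi
        obtain ⟨rfl, hne⟩ := hi
        refine absurd ?_ hne
        have h6 : (f (.inr σ')).2.getD j (0, 0) = (τ σ')[j] := by
          rw [List.getD_eq_getElem?_getD, List.getElem?_eq_getElem hj', Option.getD_some]
        rw [hv, h6]
    exact Prod.ext (key 0 (by omega)) (key 1 (by omega))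
  have hchain : IsChain n k a := by
    refine ⟨ha0, ha1, fun s hs => ?_⟩
    -- The constant tuple displays the gap `s`, and options contain increasing pairs only. Here `0 <
    -- r` is needed to have a first entry.
    have hσ : List.replicate r s ∈ tuples r (List.range (k + 1)) := by
      rw [mem_tuples]
      refine ⟨by simp, fun x hx => ?_⟩
      rw [(List.mem_replicate.1 hx).2, List.mem_range]
      exact hs
    have hj' : 0 < (τ (List.replicate r s)).length := by rw [(hτ1 _ hσ).1]; exact hr
    have h1 := hcons _ hσ 0 (by simpa using hr) hj'
    have h2 := (mem_gaps.1 ((hτ1 _ hσ).2 _ (List.getElem_mem hj'))).1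
    rw [h1] at h2
    simpa using h2
  refine ⟨a, hchain, ?_⟩
  simp only [List.any_eq_true, List.all_eq_true]
  refine ⟨D[a (k + 2)], List.getElem_mem _, fun c hcD => ?_⟩
  -- The choice slot hits only the clauses of disjuncts that it does not name, so this clause is hit
  -- by a tuple slot.
  obtain ⟨s | σ, hs, hi⟩ := hc _ (inr_mem_formClauses.2 ⟨ha2, hcD⟩)
  · simp only [formInc, Sum.elim_inl, Sum.elim_inr, Bool.and_eq_true, beq_iff_eq,
      Bool.not_eq_true', beq_eq_false_iff_ne] at hi
    obtain ⟨rfl, hne⟩ := hi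
    exact absurd rfl hne
  · simp only [formInc, Sum.elim_inr, List.any_eq_true, List.all_eq_true] at hi
    obtain ⟨t, ht, hl⟩ := hi
    refine ⟨t, ht, fun l hlt => ?_⟩
    obtain ⟨g, hg, hgl⟩ := hl l hlt
    rw [inr_mem_formSlots] at hs
    obtain ⟨j, hj, rfl⟩ := List.getElem_of_mem hg
    have hlen := mem_tuples.1 hs
    have hj' : j < σ.length := by
      have h3 : j < (τ σ).length := hj
      rw [(hτ1 σ hs).1] at h3
      omega
    have h4 := hcons σ hs j hj' hj
    have h5 : gapHolds (a σ[j], a (σ[j] + 1)) l = true := by rw [← h4]; exact hgl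
    simp only [chainHolds, List.any_eq_true]
    exact ⟨σ[j], hlen.2 _ (List.getElem_mem hj'), h5⟩

/-- Bottom conjunctions have at most `2 ^ h` literals, so tuples of that length suffice. Their
number `(k + 1) ^ 2 ^ h` depends only on `k`, as the new parameter must. -/
theorem circuitSat_reducible_coloredHittingSet (h : ℕ) :
    FPTReducible (WeightedCircuitSat 2 h) ColoredHittingSet := by
  have hnet : PT (fun C : {C : Circuit // C.weft ≤ 2 ∧ C.depth ≤ h} => (C.1.net, C.1.output)) := by
    have h1 : PT (fun C : {C : Circuit // C.weft ≤ 2 ∧ C.depth ≤ h} =>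
        (C.1.inputs, C.1.gates.map Gate.raw, C.1.output)) :=
      PT.of_enc_eq_self fun C => enc_pair_congr rfl (enc_pair_congr (enc_list_congr (by
        rw [List.map_map]
        exact List.map_congr_left fun g _ => enc_raw g)) rfl)
    unfold Circuit.net
    exact (h1.fst.pair h1.snd.fst).pair h1.snd.snd
  have hR : PT (fun p : {C : Circuit // C.weft ≤ 2 ∧ C.depth ≤ h} × ℕ =>
      (formInstance (2 ^ h) p.1.1.net.1 (outputForm h p.1.1.net p.1.1.output) p.2,
        (formSlots (2 ^ h) p.2).length)) := by
    have h1 : PT (fun p : {C : Circuit // C.weft ≤ 2 ∧ C.depth ≤ h} × ℕ => p.1.1.net) :=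
      (hnet.comp PT.id.fst).fst
    have h2 : PT (fun p : {C : Circuit // C.weft ≤ 2 ∧ C.depth ≤ h} × ℕ => p.1.1.output) :=
      (hnet.comp PT.id.fst).snd
    exact (pt_formInstance _ h1.fst (pt_outputForm h h1 h2) PT.id.snd).pair
      (pt_formSlots _ PT.id.snd).length
  refine FPTReducible.of_PT (A := WeightedCircuitSat 2 h) (B := ColoredHittingSet) hR
    (g := fun k => k + 3 + (k + 1) ^ 2 ^ h) ?_ ?_ ?_
  · exact computable_add (computable_add Computable.id (Computable.const 3))
      (computable_pow Computable.succ (Computable.const _))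
  · exact fun C k => (length_formSlots _ _).le
  · rintro ⟨C, hw, hd⟩ k
    have hev : ∀ (a : ℕ → ℕ) (x : Fin C.inputs → Bool), IsChain C.inputs k a →
        (∀ w, x w = true ↔ InChain k a w) → C.eval x =
        (outputForm h C.net C.output).any fun F => F.all fun c => c.any fun t =>
          t.all (chainHolds k a) := by
      intro a x ha hx
      refine outputForm_eval C hw hd x (chainHolds k a) fun w hwi s => ?_
      rw [C.val_input x hwi]
      exact ha.chainHolds_eq hwi (hx ⟨w, hwi⟩) s
    constructor
    · rintro ⟨x, hcard, hx⟩
      obtain ⟨a, ha, hax⟩ := exists_isChain x hcard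
      exact formInstance_yes_of_chain
        (fun F hF c hc t ht => length_le_of_mem_outputForm hF hc ht) ha ((hev a x ha hax).symm.trans hx)
    · intro hy
      obtain ⟨a, ha, hD⟩ := exists_chain_of_formInstance_yes (Nat.two_pow_pos h) hy
      classical
      have hax : ∀ w : Fin C.inputs, decide (InChain k a w) = true ↔ InChain k a w :=
        fun w => decide_eq_true_iff
      exact ⟨fun w => decide (InChain k a w), ha.card _ hax, (hev a _ ha hax).trans hD⟩

/-! ### Objects computed from the parameter by iteration -/

/-- The unary parameter is itself the list that drives the fold. Time that depends on the parameter
alone needs only a computable bound, so `S` need not be polynomial. -/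
theorem exists_prog_iterate {σ : Type} [TreeEnc σ] {step : σ → σ} (hs : PT step) (s₀ : σ)
    {S : ℕ → ℕ} (hS : Computable S) (hb : ∀ k, ∀ i ≤ k, esz (step^[i] s₀) ≤ S k) :
    ∃ (q : Prog) (b : ℕ → ℕ), Computable b ∧
      ∀ k, ∃ t, Runs q (enc k) (enc (step^[k] s₀)) t ∧ t + esz (step^[k] s₀) ≤ b k := by
  have hs' : PT (fun p : Unit × σ × Unit => step p.2.1) := hs.comp PT.id.snd.fst
  obtain ⟨p, T, hp, ⟨c, hT⟩, -⟩ := hs'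
  obtain ⟨q₀, t₀, hq₀⟩ := exists_runs_const (enc s₀)
  refine ⟨.seq (.cons .id (.cons .nil q₀)) (.seq (foldProg p) (.seq .tl .tl)),
    fun k => k * ((S k + 5) ^ c + 25) + S k + (t₀ + 12), ?_, fun k => ?_⟩
  · exact computable_add (computable_add (computable_mul Computable.id (computable_add
      (computable_pow (computable_add hS (Computable.const 5)) (Computable.const c))
      (Computable.const 25))) hS) (Computable.const _)
  obtain ⟨t, ht, hr⟩ := runs_foldProg (p := p) (e := .nil) (B := (S k + 5) ^ c)
    (step := fun s (_ : Unit) => step s) (List.replicate k ()) s₀ fun l₁ b l₂ h => by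
      have hlen : l₁.length ≤ k := by
        have := congrArg List.length h
        simp at this
        omega
      have h1 : l₁.foldl (fun s (_ : Unit) => step s) s₀ = step^[l₁.length] s₀ := by
        rw [← foldl_unit, List.eq_replicate_of_mem (a := ()) (l := l₁) fun _ _ => rfl,
          List.length_replicate]
      refine ⟨_, ?_, hp ((), l₁.foldl (fun s (_ : Unit) => step s) s₀, b)⟩
      refine (hT _).trans (Nat.pow_le_pow_left ?_ _)
      have h2 := hb k _ hlen
      have h3 : esz () = 1 := rfl
      rw [esz_pair, esz_pair, h1, h3]
      omega
  rw [foldl_unit, List.length_replicate, ← enc_nat_eq] at *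
  refine ⟨_, .seq (.cons (.id _) (.cons (.nil _) (hq₀ _))) (.seq hr (.seq (.tl _) (.tl _))), ?_⟩
  have := hb k k le_rfl
  beta_reduce
  omega

/-- The step from the lists of length `k` to those of length `k + 1`, with entries below three. -/
def moveStep (T : List (List ℕ)) : List (List ℕ) :=
  [0, 1, 2].flatMap fun x => T.map (x :: ·)

theorem iterate_moveStep (k : ℕ) : moveStep^[k] [[]] = tuples k [0, 1, 2] := by
  induction k with
  | zero => rfl
  | succ k ih => rw [Function.iterate_succ_apply', ih]; rfl

theorem esz_moveTuples_le (k : ℕ) : esz (tuples k [0, 1, 2]) ≤ 3 ^ k * (k * 6 + 2) + 1 := by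
  have h := esz_list_le (tuples k [0, 1, 2]) (k * 6 + 1) fun l hl => by
    obtain ⟨h1, h2⟩ := mem_tuples.1 hl
    have := esz_list_le l 5 fun a ha => by
      rw [esz_nat]
      have := h2 a ha
      simp at this
      omega
    rwa [h1] at this
  rwa [length_tuples] at h

theorem exists_prog_moveTuples : ∃ (q : Prog) (b : ℕ → ℕ), Computable b ∧
    ∀ k, ∃ t, Runs q (enc k) (enc (tuples k [0, 1, 2])) t ∧
      t + esz (tuples k [0, 1, 2]) ≤ b k := by
  have h := exists_prog_iterate (step := moveStep) (by unfold moveStep; fun_prop) [[]]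
    (S := fun k => 3 ^ k * (k * 6 + 2) + 1)
    (computable_add (computable_mul (computable_pow (Computable.const 3) Computable.id)
      (computable_add (computable_mul Computable.id (Computable.const 6)) (Computable.const 2)))
      (Computable.const 1))
    (fun k i hi => by
      rw [iterate_moveStep]
      refine (esz_moveTuples_le i).trans ?_
      have h1 : 3 ^ i ≤ 3 ^ k := Nat.pow_le_pow_right (by omega) hi
      have := Nat.mul_le_mul h1 (show i * 6 + 2 ≤ k * 6 + 2 by omega)
      omega)
  simpa only [iterate_moveStep] using h

/-! ### Computations of blind machines -/

namespace BlindNTM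

variable (M : BlindNTM)

/-- The transition that does nothing in the state `q`. -/
def idle (q : Fin M.states) : Transition M.tapes M.symbols M.states where
  read _ := none
  src := q
  write _ := none
  tgt := q
  move _ := 0

/-- The transitions of the machine, and idle transitions in the accepting states. -/
def deltaIdle : List (Transition M.tapes M.symbols M.states) :=
  M.delta ++ ((List.finRange M.states).filter M.accepting).map M.idle

/-- The configuration reached from `c` by the transitions `d 0, …, d (n - 1)`. -/
def conf (c : M.Config) (d : ℕ → Transition M.tapes M.symbols M.states) : ℕ → M.Config
  | 0 => c
  | n + 1 => M.apply (d n) (conf c d n)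

theorem conf_congr {c : M.Config} {d d' : ℕ → Transition M.tapes M.symbols M.states} {n : ℕ}
    (h : ∀ i < n, d i = d' i) : M.conf c d n = M.conf c d' n := by
  induction n with
  | zero => rfl
  | succ n ih =>
    rw [conf, conf, ih fun i hi => h i (by omega), h n (by omega)]

theorem apply_idle (c : M.Config) (q : Fin M.states) (h : c.state = q) :
    M.apply (M.idle q) c = c := by
  subst h
  obtain ⟨s, hd, cl⟩ := c
  simp [apply, idle]

theorem Reach.exists_conf {M : BlindNTM} {c c' : M.Config} {n : ℕ} (h : M.Reach n c c') :
    ∃ d : ℕ → Transition M.tapes M.symbols M.states,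
      (∀ i < n, d i ∈ M.delta ∧ M.Applicable (d i) (M.conf c d i)) ∧ M.conf c d n = c' := by
  induction n generalizing c' with
  | zero =>
    cases h with
    | refl => exact ⟨fun _ => M.idle c.state, by simp, rfl⟩
  | succ n ih =>
    obtain ⟨c₁, h1, δ, hδ, hap, rfl⟩ := h.exists_snoc
    obtain ⟨d, hd, rfl⟩ := ih h1
    have hlt : ∀ i < n, d i = Function.update d n δ i := fun i hi => by simp [hi.ne]
    have hc : ∀ i ≤ n, M.conf c (Function.update d n δ) i = M.conf c d i := fun i hi =>
      (M.conf_congr fun j hj => hlt j (by omega)).symm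
    refine ⟨Function.update d n δ, fun i hi => ?_, ?_⟩
    · rw [hc i (by omega)]
      rcases Nat.lt_succ_iff_lt_or_eq.1 hi with h' | rfl
      · rw [← hlt i h']; exact hd i h'
      · rw [Function.update_self]; exact ⟨hδ, hap⟩
    · rw [conf, hc n le_rfl, Function.update_self]

/-- Idling in an accepting state stretches an accepting computation to exactly `k` steps. The state
reached is read off as the source of a further transition, number `k`, so acceptance becomes a
condition on one option of one slot. -/
theorem acceptsWithin_iff (w : List (Fin M.symbols)) (k : ℕ) :
    M.AcceptsWithin w k ↔ ∃ d : ℕ → Transition M.tapes M.symbols M.states,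
      (∀ i ≤ k, d i ∈ M.deltaIdle ∧ M.Applicable (d i) (M.conf (M.init w) d i)) ∧
      M.accepting (d k).src = true := by
  constructor
  · rintro ⟨n, hn, c, hr, hacc⟩
    obtain ⟨d, hd, hc⟩ := hr.exists_conf
    set e : ℕ → Transition M.tapes M.symbols M.states :=
      fun i => if i < n then d i else M.idle c.state with he
    have hlt : ∀ i < n, d i = e i := fun i hi => by simp [he, hi]
    have hge : ∀ i, n ≤ i → e i = M.idle c.state := fun i hi => by simp [he, not_lt.2 hi]
    have hcn : ∀ i, n ≤ i → M.conf (M.init w) e i = c := by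
      intro i hi
      induction i, hi using Nat.le_induction with
      | base => rw [← M.conf_congr hlt, hc]
      | succ i hi ih => rw [conf, ih, hge i hi, M.apply_idle _ _ rfl]
    refine ⟨e, fun i hi => ?_, ?_⟩
    · rcases Nat.lt_or_ge i n with h | h
      · rw [← hlt i h, ← M.conf_congr fun j hj => hlt j (hj.trans h)]
        exact ⟨List.mem_append_left _ (hd i h).1, (hd i h).2⟩
      · rw [hge i h, hcn i h]
        refine ⟨List.mem_append_right _ (List.mem_map.2 ⟨_, ?_, rfl⟩), rfl, fun t => .inl rfl⟩
        simpa using hacc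
    · rw [hge k hn]
      exact hacc
  · rintro ⟨d, hd, hacc⟩
    -- Idle transitions change nothing and are dropped, so `i` only bounds the number of genuine
    -- steps.
    have key : ∀ i ≤ k, ∃ n ≤ i, M.Reach n (M.init w) (M.conf (M.init w) d i) := by
      intro i
      induction i with
      | zero => exact fun _ => ⟨0, le_rfl, .refl _⟩
      | succ i ih =>
        intro hi
        obtain ⟨n, hn, hr⟩ := ih (by omega)
        obtain ⟨h1, h2⟩ := hd i (by omega)
        rcases List.mem_append.1 h1 with h | h
        · exact ⟨n + 1, by omega, hr.snoc ⟨d i, h, h2, rfl⟩⟩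
        · obtain ⟨q, -, hq⟩ := List.mem_map.1 h
          refine ⟨n, by omega, ?_⟩
          have h3 := h2.1
          rw [← hq] at h3
          rw [conf, ← hq, M.apply_idle _ q h3]
          exact hr
    obtain ⟨n, hn, hr⟩ := key k le_rfl
    exact ⟨n, hn, _, hr, by rw [(hd k le_rfl).2.1]; exact hacc⟩

/-- The symbol in a cell is determined by the last write to it. -/
theorem conf_cell_eq_iff (c : M.Config) (d : ℕ → Transition M.tapes M.symbols M.states)
    (t : Fin M.tapes) (x : ℤ) (a : Fin M.symbols) (i : ℕ) :
    (M.conf c d i).cell t x = a ↔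
      (c.cell t x = a ∨ ∃ i' < i, (M.conf c d i').head t = x ∧ (d i').write t ≠ none) ∧
      ∀ j < i, ((M.conf c d j).head t ≠ x ∨ (d j).write t = none ∨ (d j).write t = some a) ∨
        ∃ i' < i, j < i' ∧ (M.conf c d i').head t = x ∧ (d i').write t ≠ none := by
  -- The right-hand side is a conjunction of `i + 1` disjunctions: one for the initial symbol and
  -- one for each earlier time, each excused by a later write. Once the head positions are known,
  -- every disjunct concerns a single transition, and this makes it usable for clauses.
  induction i with
  | zero => simp [conf]
  | succ i ih =>
    by_cases hx : (M.conf c d i).head t = x ∧ (d i).write t ≠ none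
    · obtain ⟨b, hb⟩ := Option.ne_none_iff_exists'.1 hx.2
      have h1 : (M.conf c d (i + 1)).cell t x = b := by
        rw [conf, apply]
        simp [hx.1, hb]
      rw [h1]
      constructor
      · rintro rfl
        refine ⟨.inr ⟨i, by omega, hx⟩, fun j hj => ?_⟩
        rcases Nat.lt_succ_iff_lt_or_eq.1 hj with h | rfl
        · exact .inr ⟨i, by omega, h, hx⟩
        · exact .inl (.inr (.inr hb))
      · rintro ⟨-, h⟩
        rcases h i (by omega) with (h | h | h) | ⟨i', h1, h2, -⟩
        · exact absurd hx.1 h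
        · exact absurd h hx.2
        · rw [hb] at h; exact Option.some.inj h
        · omega
    · have h1 : (M.conf c d (i + 1)).cell t x = (M.conf c d i).cell t x := by
        rw [conf, apply]
        by_cases hh : (M.conf c d i).head t = x
        · have hn : (d i).write t = none := by
            by_contra hn
            exact hx ⟨hh, hn⟩
          simp [hn]
        · exact Function.update_of_ne (Ne.symm hh) _ _
      rw [h1, ih]
      have h2 : ∀ P : ℕ → Prop, (∃ i' < i + 1, P i' ∧ (M.conf c d i').head t = x ∧
          (d i').write t ≠ none) ↔ ∃ i' < i, P i' ∧ (M.conf c d i').head t = x ∧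
          (d i').write t ≠ none := by
        intro P
        constructor
        · rintro ⟨i', h3, h4, h5⟩
          rcases Nat.lt_succ_iff_lt_or_eq.1 h3 with h | rfl
          · exact ⟨i', h, h4, h5⟩
          · exact absurd h5 hx
        · rintro ⟨i', h3, h4⟩
          exact ⟨i', by omega, h4⟩
      have h3 := h2 fun _ => True
      simp only [true_and] at h3
      rw [h3]
      refine and_congr_right fun _ => ?_
      constructor
      · intro h j hj
        rw [h2]
        rcases Nat.lt_succ_iff_lt_or_eq.1 hj with h' | rfl
        · exact h j h'
        · left
          by_contra hne
          push Not at hne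
          exact hx ⟨hne.1, hne.2.1⟩
      · intro h j hj
        have := h j (by omega)
        rwa [h2] at this

end BlindNTM

/-! ### Machines as plain data -/

/-- A transition: symbols to be read, source, symbols to be written, target, moves. The neutral
symbol is `0` and the symbol `a` is `a + 1`. -/
abbrev RawTransition : Type := List ℕ × ℕ × List ℕ × ℕ × List ℕ

/-- A machine with its input word: numbers of tapes, symbols and states, blank, initial state,
accepting states, transitions and word. -/
abbrev RawMachine : Type :=
  (ℕ × ℕ × ℕ) × ℕ × ℕ × List Bool × List RawTransition × List ℕ

/-- The number of a symbol or of the neutral symbol. -/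
def symCode {s : ℕ} : Option (Fin s) → ℕ
  | none => 0
  | some a => a + 1

/-- The number of a move. -/
def moveCode : SignType → ℕ
  | .zero => 0
  | .pos => 1
  | .neg => 2

theorem enc_symCode {s : ℕ} (o : Option (Fin s)) : enc (symCode o) = enc o := by
  cases o <;> rfl

theorem enc_moveCode (d : SignType) : enc (moveCode d) = enc d := by
  cases d <;> rfl

theorem enc_fun_eq_ofFn {α β : Type} [TreeEnc α] [TreeEnc β] {n : ℕ} (f : Fin n → α)
    (g : Fin n → β) (h : ∀ i, enc (g i) = enc (f i)) : enc (List.ofFn g) = enc f := by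
  refine enc_list_congr ?_
  rw [List.map_ofFn, List.map_ofFn]
  exact congrArg List.ofFn (funext h)

/-- A transition as plain data. -/
def Transition.raw {m s q : ℕ} (δ : Transition m s q) : RawTransition :=
  (List.ofFn fun t => symCode (δ.read t), δ.src, List.ofFn fun t => symCode (δ.write t), δ.tgt,
    List.ofFn fun t => moveCode (δ.move t))

theorem Transition.enc_raw {m s q : ℕ} (δ : Transition m s q) : enc δ.raw = enc δ :=
  enc_pair_congr (enc_fun_eq_ofFn _ _ fun _ => enc_symCode _) (enc_pair_congr rfl
    (enc_pair_congr (enc_fun_eq_ofFn _ _ fun _ => enc_symCode _) (enc_pair_congr rfl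
      (enc_fun_eq_ofFn _ _ fun _ => enc_moveCode _))))

/-- A machine with its input word as plain data. -/
def BlindInstance.raw (I : BlindInstance) : RawMachine :=
  ((I.machine.tapes, I.machine.symbols, I.machine.states), I.machine.blank, I.machine.start,
    List.ofFn I.machine.accepting, I.machine.delta.map Transition.raw, I.word.map fun a => a.val)

@[fun_prop]
theorem pt_blindInstance_raw : PT BlindInstance.raw :=
  PT.of_enc_eq_self fun I => congrArg₂ Val.cons rfl (enc_pair_congr rfl (enc_pair_congr rfl
    (enc_pair_congr rfl (enc_pair_congr
      (enc_list_congr (by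
        rw [List.map_map]; exact List.map_congr_left fun δ _ => δ.enc_raw))
      (enc_list_congr (by rw [List.map_map]; rfl))))))

theorem getD_ofFn {β : Type} {m : ℕ} (f : Fin m → β) (t : Fin m) (d : β) :
    (List.ofFn f).getD t d = f t := by
  simp [List.getD_eq_getElem?_getD]

/-! ### From blind machines to hitting sets -/

/-- The list of `m` zeros. -/
def zeros (m : ℕ) : List ℕ := (List.range m).map fun _ => 0

/-- The transitions, and idle transitions in the accepting states. -/
def rawDelta (r : RawMachine) : List RawTransition :=
  r.2.2.2.2.1 ++ ((List.range r.1.2.2).filter fun q => r.2.2.2.1.getD q false).map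
    fun q => (zeros r.1.1, q, zeros r.1.1, q, zeros r.1.1)

/-- The options for the transition number `i`. -/
def runOptions (r : RawMachine) (k i : ℕ) : List RawTransition :=
  (rawDelta r).filter fun δ => (!(i == 0) || (δ.2.1 == r.2.2.1)) &&
    (!(i == k) || r.2.2.2.1.getD δ.2.1 false)

/-- The number of entries `d` of `μ` at the times from `i` on before `j`. -/
def countMoves (μ : List ℕ) (i j d : ℕ) : ℕ :=
  ((List.range j).filter fun p => Nat.ble i p && (μ.getD p 0 == d)).length

/-- After the moves in `μ`, the head is at the same cell at the times `i` and `j`. -/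
def samePos (μ : List ℕ) (i j : ℕ) : Bool := countMoves μ i j 1 == countMoves μ i j 2

/-- The initial symbol of the cell of tape `t` that is reached at time `i` by the moves in `μ`. -/
def initSym (r : RawMachine) (t : ℕ) (μ : List ℕ) (i : ℕ) : ℕ :=
  bif (t == 0) && Nat.ble (countMoves μ 0 i 2) (countMoves μ 0 i 1) then
    r.2.2.2.2.2.getD (countMoves μ 0 i 1 - countMoves μ 0 i 2) r.2.1 else r.2.1

/-- The clauses: `(i, q)` for the link between the transitions `i` and `i + 1`, and
`(t, i, μ, j, a)` for reading `a` from tape `t` at time `i` after the moves in `μ`, with a view to the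
initial symbol for `j = 0` and to what is written at time `j - 1` otherwise. -/
def runClauses (r : RawMachine) (k : ℕ) (E : List (List ℕ)) :
    List ((ℕ × ℕ) ⊕ (ℕ × ℕ × List ℕ × ℕ × ℕ)) :=
  ((List.range k).flatMap fun i => (List.range r.1.2.2).map fun q => .inl (i, q)) ++
  ((List.range r.1.1).flatMap fun t => (List.range (k + 1)).flatMap fun i => E.flatMap fun μ =>
    (List.range (i + 1)).flatMap fun j => (List.range r.1.2.1).map fun a => .inr (t, i, μ, j, a))

/-- The transition `δ` at time `i` hits the link clause `(j, q)`. -/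
def linkInc (i : ℕ) (δ : RawTransition) (c : ℕ × ℕ) : Bool :=
  ((i == c.1) && !(δ.2.2.2.1 == c.2)) || ((i == c.1 + 1) && (δ.2.1 == c.2))

/-- The transition `δ` at time `p` hits the read clause `(t, i, μ, j, a)`. -/
def readInc (r : RawMachine) (p : ℕ) (δ : RawTransition) (t i : ℕ) (μ : List ℕ) (j a : ℕ) : Bool :=
  (Nat.blt p i && !(δ.2.2.2.2.getD t 0 == μ.getD p 0)) ||
  (((p == i) && !(δ.1.getD t 0 == a + 1)) ||
  ((Nat.blt p i && (Nat.ble j p && (samePos μ p i && !(δ.2.2.1.getD t 0 == 0)))) ||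
  (bif j == 0 then initSym r t μ i == a else
    !(samePos μ (j - 1) i) ||
      ((p == j - 1) && ((δ.2.2.1.getD t 0 == 0) || (δ.2.2.1.getD t 0 == a + 1))))))

/-- The transition `δ` at time `i` hits the clause `c`. -/
def runInc (r : RawMachine) (i : ℕ) (δ : RawTransition)
    (c : (ℕ × ℕ) ⊕ (ℕ × ℕ × List ℕ × ℕ × ℕ)) : Bool :=
  Sum.elim (fun q => linkInc i δ q)
    (fun q => readInc r i δ q.1 q.2.1 q.2.2.1 q.2.2.2.1 q.2.2.2.2) c

/-- The hitting set instance of a machine. -/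
def runInstance (r : RawMachine) (k : ℕ) (E : List (List ℕ)) : ℕ × List (List (List Bool)) :=
  hitInstance (List.range (k + 1)) (runOptions r k) (runClauses r k E) (runInc r)

section
variable {α : Type} [TreeEnc α]

@[fun_prop]
theorem pt_rawDelta {r : α → RawMachine} (hr : PT r) : PT (fun a => rawDelta (r a)) := by
  unfold rawDelta zeros
  fun_prop

@[fun_prop]
theorem pt_runOptions {r : α → RawMachine} {k i : α → ℕ} (hr : PT r) (hk : PT k) (hi : PT i) :
    PT (fun a => runOptions (r a) (k a) (i a)) := by
  unfold runOptions
  fun_prop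

@[fun_prop]
theorem pt_countMoves {μ : α → List ℕ} {i j d : α → ℕ} (hμ : PT μ) (hi : PT i) (hj : PT j)
    (hd : PT d) : PT (fun a => countMoves (μ a) (i a) (j a) (d a)) := by
  unfold countMoves
  fun_prop

@[fun_prop]
theorem pt_samePos {μ : α → List ℕ} {i j : α → ℕ} (hμ : PT μ) (hi : PT i) (hj : PT j) :
    PT (fun a => samePos (μ a) (i a) (j a)) := by
  unfold samePos
  fun_prop

@[fun_prop]
theorem pt_initSym {r : α → RawMachine} {t i : α → ℕ} {μ : α → List ℕ} (hr : PT r) (ht : PT t)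
    (hμ : PT μ) (hi : PT i) : PT (fun a => initSym (r a) (t a) (μ a) (i a)) := by
  unfold initSym
  fun_prop

@[fun_prop]
theorem pt_runClauses {r : α → RawMachine} {k : α → ℕ} {E : α → List (List ℕ)} (hr : PT r)
    (hk : PT k) (hE : PT E) : PT (fun a => runClauses (r a) (k a) (E a)) := by
  unfold runClauses
  fun_prop

@[fun_prop]
theorem pt_linkInc {i : α → ℕ} {δ : α → RawTransition} {c : α → ℕ × ℕ} (hi : PT i) (hδ : PT δ)
    (hc : PT c) : PT (fun a => linkInc (i a) (δ a) (c a)) := by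
  unfold linkInc
  fun_prop

@[fun_prop]
theorem pt_readInc {r : α → RawMachine} {p t i j b : α → ℕ} {δ : α → RawTransition}
    {μ : α → List ℕ} (hr : PT r) (hp : PT p) (hδ : PT δ) (ht : PT t) (hi : PT i) (hμ : PT μ)
    (hj : PT j) (hb : PT b) :
    PT (fun a => readInc (r a) (p a) (δ a) (t a) (i a) (μ a) (j a) (b a)) := by
  unfold readInc
  fun_prop

@[fun_prop]
theorem pt_runInc {r : α → RawMachine} {i : α → ℕ} {δ : α → RawTransition}
    {c : α → (ℕ × ℕ) ⊕ (ℕ × ℕ × List ℕ × ℕ × ℕ)} (hr : PT r) (hi : PT i) (hδ : PT δ) (hc : PT c) :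
    PT (fun a => runInc (r a) (i a) (δ a) (c a)) := by
  unfold runInc
  fun_prop

@[fun_prop]
theorem pt_runInstance {r : α → RawMachine} {k : α → ℕ} {E : α → List (List ℕ)} (hr : PT r)
    (hk : PT k) (hE : PT E) : PT (fun a => runInstance (r a) (k a) (E a)) := by
  unfold runInstance hitInstance
  fun_prop

end

/-! ### Correctness of the hitting set instance of a machine -/

theorem rawDelta_eq (I : BlindInstance) :
    rawDelta I.raw = I.machine.deltaIdle.map Transition.raw := by
  have h : ∀ q : Fin I.machine.states, (I.machine.idle q).raw =
      (zeros I.machine.tapes, q.val, zeros I.machine.tapes, q.val, zeros I.machine.tapes) := by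
    intro q
    simp only [zeros, map_range_eq_ofFn]
    rfl
  rw [BlindNTM.deltaIdle, List.map_append, List.map_map]
  refine congrArg₂ _ rfl ?_
  have h1 : List.range I.machine.states = (List.finRange I.machine.states).map Fin.val := by
    apply List.ext_getElem <;> simp
  simp only [BlindInstance.raw, h1, List.filter_map, List.map_map]
  have h2 : ((fun q => (List.ofFn I.machine.accepting).getD q false) ∘ Fin.val) =
      I.machine.accepting := funext fun q => getD_ofFn _ _ _
  rw [h2]
  exact List.map_congr_left fun q _ => (h q).symm

theorem mem_runOptions {I : BlindInstance} {k i : ℕ} {δ : RawTransition} :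
    δ ∈ runOptions I.raw k i ↔ ∃ δ' ∈ I.machine.deltaIdle, δ'.raw = δ ∧
      (i = 0 → δ'.src = I.machine.start) ∧ (i = k → I.machine.accepting δ'.src = true) := by
  rw [runOptions, List.mem_filter, rawDelta_eq, List.mem_map]
  have key : ∀ δ' : Transition I.machine.tapes I.machine.symbols I.machine.states,
      ((!(i == 0) || (δ'.raw.2.1 == I.raw.2.2.1)) &&
        (!(i == k) || I.raw.2.2.2.1.getD δ'.raw.2.1 false)) = true ↔
      (i = 0 → δ'.src = I.machine.start) ∧ (i = k → I.machine.accepting δ'.src = true) := by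
    intro δ'
    have h1 : I.raw.2.2.2.1.getD δ'.raw.2.1 false = I.machine.accepting δ'.src := getD_ofFn _ _ _
    have h2 : (δ'.raw.2.1 == I.raw.2.2.1) = true ↔ δ'.src = I.machine.start := by
      rw [beq_iff_eq, Fin.ext_iff]
      rfl
    rw [h1, Bool.and_eq_true, Bool.or_eq_true, Bool.or_eq_true, h2, Bool.not_eq_true',
      Bool.not_eq_true', beq_eq_false_iff_ne, beq_eq_false_iff_ne, imp_iff_not_or, imp_iff_not_or]
  constructor
  · rintro ⟨⟨δ', hm, rfl⟩, h⟩
    exact ⟨δ', hm, rfl, (key δ').1 h⟩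
  · rintro ⟨δ', hm, rfl, h⟩
    exact ⟨⟨δ', hm, rfl⟩, (key δ').2 h⟩

theorem symCode_eq_zero {s : ℕ} {o : Option (Fin s)} : symCode o = 0 ↔ o = none := by
  cases o <;> simp [symCode]

theorem symCode_eq_succ {s : ℕ} {o : Option (Fin s)} {a : Fin s} :
    symCode o = a + 1 ↔ o = some a := by
  cases o <;> simp [symCode, Fin.ext_iff]

theorem countMoves_self (μ : List ℕ) (i e : ℕ) : countMoves μ i i e = 0 := by
  rw [countMoves, List.length_eq_zero_iff, List.filter_eq_nil_iff]
  intro p hp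
  rw [List.mem_range] at hp
  simp
  omega

theorem countMoves_succ (μ : List ℕ) {i j : ℕ} (h : i ≤ j) (e : ℕ) :
    countMoves μ i (j + 1) e = countMoves μ i j e + if μ.getD j 0 = e then 1 else 0 := by
  have h' : Nat.ble i j = true := by simpa using h
  rw [countMoves, countMoves, List.range_succ, List.filter_append, List.length_append]
  by_cases he : μ.getD j 0 = e
  · rw [if_pos he, List.filter_cons_of_pos (by rw [h', he]; simp)]
    simp
  · rw [if_neg he, List.filter_cons_of_neg (by rw [h', beq_eq_false_iff_ne.2 he]; simp)]
    simp

section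
variable {M : BlindNTM} {c : M.Config} {d : ℕ → Transition M.tapes M.symbols M.states}
  {t : Fin M.tapes} {μ : List ℕ}

/-- Right and left moves (codes `1` and `2`) are counted separately, so that programs compare head
positions without negative numbers. -/
theorem head_eq_countMoves {i j : ℕ} (h : i ≤ j)
    (hμ : ∀ p < j, moveCode ((d p).move t) = μ.getD p 0) :
    (M.conf c d j).head t =
      (M.conf c d i).head t + countMoves μ i j 1 - countMoves μ i j 2 := by
  induction j, h using Nat.le_induction with
  | base => simp [countMoves_self]
  | succ j h ih =>
    have h1 : (M.conf c d (j + 1)).head t = (M.conf c d j).head t + ((d j).move t : ℤ) := rfl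
    rw [h1, ih fun p hp => hμ p (by omega), countMoves_succ μ h, countMoves_succ μ h,
      ← hμ j (by omega)]
    cases (d j).move t <;> simp [moveCode] <;> ring

theorem samePos_iff {i j : ℕ} (h : i ≤ j)
    (hμ : ∀ p < j, moveCode ((d p).move t) = μ.getD p 0) :
    samePos μ i j = true ↔ (M.conf c d i).head t = (M.conf c d j).head t := by
  rw [head_eq_countMoves (c := c) h hμ, samePos, beq_iff_eq]
  omega

end

section
variable {I : BlindInstance}
  {d : ℕ → Transition I.machine.tapes I.machine.symbols I.machine.states}
  {t : Fin I.machine.tapes} {μ : List ℕ}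

theorem initSym_eq {i : ℕ} (hμ : ∀ p < i, moveCode ((d p).move t) = μ.getD p 0) :
    initSym I.raw t μ i = ((I.machine.init I.word).cell t
      ((I.machine.conf (I.machine.init I.word) d i).head t)).val := by
  have h1 := head_eq_countMoves (c := I.machine.init I.word) (Nat.zero_le i) hμ
  have h2 : (I.machine.conf (I.machine.init I.word) d 0).head t = 0 := rfl
  rw [h1, h2]
  simp only [initSym, BlindNTM.init]
  by_cases h : t.val = 0 ∧ (0 : ℤ) ≤ 0 + countMoves μ 0 i 1 - countMoves μ 0 i 2
  · have h3 : (((t.val == 0) && Nat.ble (countMoves μ 0 i 2) (countMoves μ 0 i 1)) = true) := by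
      simp [h.1]; omega
    have h4 : ((0 : ℤ) + countMoves μ 0 i 1 - countMoves μ 0 i 2).toNat =
        countMoves μ 0 i 1 - countMoves μ 0 i 2 := by omega
    rw [if_pos h, h3, cond_true, h4]
    simp only [BlindInstance.raw, List.getD_eq_getElem?_getD, List.getElem?_map]
    cases I.word[countMoves μ 0 i 1 - countMoves μ 0 i 2]? <;> rfl
  · have h3 : (((t.val == 0) && Nat.ble (countMoves μ 0 i 2) (countMoves μ 0 i 1)) = false) := by
      rw [Bool.eq_false_iff]
      intro h5
      simp at h5
      exact h ⟨by simpa using h5.1, by omega⟩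
    rw [if_neg h, h3, cond_false]
    rfl

theorem readInc_iff {p i j : ℕ} {a : Fin I.machine.symbols} :
    readInc I.raw p (d p).raw t i μ j a = true ↔
      (p < i ∧ moveCode ((d p).move t) ≠ μ.getD p 0) ∨
      (p = i ∧ (d p).read t ≠ some a) ∨
      (p < i ∧ j ≤ p ∧ samePos μ p i = true ∧ (d p).write t ≠ none) ∨
      (if j = 0 then initSym I.raw t μ i = a else ¬ samePos μ (j - 1) i = true ∨
        (p = j - 1 ∧ ((d p).write t = none ∨ (d p).write t = some a))) := by
  have h1 : (d p).raw.1.getD t 0 = symCode ((d p).read t) := getD_ofFn _ _ _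
  have h2 : (d p).raw.2.2.1.getD t 0 = symCode ((d p).write t) := getD_ofFn _ _ _
  have h3 : (d p).raw.2.2.2.2.getD t 0 = moveCode ((d p).move t) := getD_ofFn _ _ _
  rw [readInc, h1, h2, h3]
  simp only [Bool.or_eq_true, Bool.and_eq_true, blt_iff, Bool.not_eq_true', beq_eq_false_iff_ne,
    beq_iff_eq, Nat.ble_eq, ne_eq, symCode_eq_zero, symCode_eq_succ, Bool.cond_eq_ite]
  refine or_congr Iff.rfl (or_congr Iff.rfl (or_congr Iff.rfl ?_))
  split_ifs <;> simp [symCode_eq_zero, symCode_eq_succ]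

/-- The read clauses of tape `t` at time `i` for the moves that are made. -/
theorem read_clauses_iff {k i : ℕ} (hi : i ≤ k)
    (hμ : ∀ p < i, moveCode ((d p).move t) = μ.getD p 0) {a : Fin I.machine.symbols}
    (ha : (d i).read t = some a) :
    (∀ j ≤ i, ∃ p ≤ k, readInc I.raw p (d p).raw t i μ j a = true) ↔
      (I.machine.conf (I.machine.init I.word) d i).cell t
        ((I.machine.conf (I.machine.init I.word) d i).head t) = a := by
  -- Clause `0` is the conjunct for the initial symbol and clause `j + 1` the one for the write at
  -- time `j`. As `μ` is correct and `a` is the symbol to be read, the two disjuncts that excuse a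
  -- clause with other data are void.
  rw [BlindNTM.conf_cell_eq_iff]
  have hc : (I.machine.conf (I.machine.init I.word) d 0) = I.machine.init I.word := rfl
  have hsame : ∀ p ≤ i, samePos μ p i = true ↔
      (I.machine.conf (I.machine.init I.word) d p).head t =
        (I.machine.conf (I.machine.init I.word) d i).head t := fun p hp => samePos_iff hp hμ
  have hinit := initSym_eq hμ
  constructor
  · intro h
    constructor
    · obtain ⟨p, hp, hr⟩ := h 0 (by omega)
      rw [readInc_iff, if_pos rfl] at hr
      rcases hr with ⟨h1, h2⟩ | ⟨rfl, h2⟩ | ⟨h1, -, h2, h3⟩ | h1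
      · exact absurd (hμ p h1) h2
      · exact absurd ha h2
      · exact .inr ⟨p, h1, (hsame p h1.le).1 h2, h3⟩
      · exact .inl (Fin.ext (hinit.symm.trans h1))
    · intro j hj
      obtain ⟨p, hp, hr⟩ := h (j + 1) hj
      rw [readInc_iff, if_neg (by omega), Nat.add_sub_cancel] at hr
      rcases hr with ⟨h1, h2⟩ | ⟨rfl, h2⟩ | ⟨h1, h4, h2, h3⟩ | h1 | ⟨rfl, h1⟩
      · exact absurd (hμ p h1) h2
      · exact absurd ha h2
      · exact .inr ⟨p, h1, h4, (hsame p h1.le).1 h2, h3⟩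
      · exact .inl (.inl fun e => h1 ((hsame j hj.le).2 e))
      · exact .inl (.inr h1)
  · rintro ⟨h0, h⟩ j hj
    cases j with
    | zero =>
      rcases h0 with h0 | ⟨p, h1, h2, h3⟩
      · exact ⟨i, hi, readInc_iff.2 (.inr (.inr (.inr (by
          rw [if_pos rfl, hinit]; exact congrArg Fin.val h0))))⟩
      · exact ⟨p, by omega, readInc_iff.2
          (.inr (.inr (.inl ⟨h1, by omega, (hsame p h1.le).2 h2, h3⟩)))⟩
    | succ j =>
      rcases h j hj with (h1 | h1) | ⟨p, h1, h4, h2, h3⟩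
      · refine ⟨i, hi, readInc_iff.2 (.inr (.inr (.inr ?_)))⟩
        rw [if_neg (by omega), Nat.add_sub_cancel]
        exact .inl fun e => h1 ((hsame j (by omega)).1 e)
      · refine ⟨j, by omega, readInc_iff.2 (.inr (.inr (.inr ?_)))⟩
        rw [if_neg (by omega), Nat.add_sub_cancel]
        exact .inr ⟨rfl, h1⟩
      · exact ⟨p, by omega, readInc_iff.2
          (.inr (.inr (.inl ⟨h1, by omega, (hsame p h1.le).2 h2, h3⟩)))⟩

/-- Equality of two states is expressed as "if the target is `q`, then the next source is `q`" for
each `q`; such an implication is a disjunction of two conditions on single transitions. -/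
theorem link_clauses_iff {k : ℕ} :
    (∀ i < k, ∀ q < I.machine.states, ∃ p ≤ k, linkInc p (d p).raw (i, q) = true) ↔
      ∀ i < k, (d i).tgt = (d (i + 1)).src := by
  have key : ∀ p i q, linkInc p (d p).raw (i, q) = true ↔
      (p = i ∧ (d p).tgt.val ≠ q) ∨ (p = i + 1 ∧ (d p).src.val = q) := by
    intro p i q
    simp only [linkInc, Bool.or_eq_true, Bool.and_eq_true, Bool.not_eq_true', beq_eq_false_iff_ne,
      beq_iff_eq]
    rfl
  simp only [key]
  constructor
  · intro h i hi
    obtain ⟨p, -, ⟨rfl, h1⟩ | ⟨rfl, h1⟩⟩ := h i hi (d i).tgt (d i).tgt.2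
    · exact absurd rfl h1
    · exact Fin.ext h1.symm
  · intro h i hi q _
    by_cases hq : (d i).tgt.val = q
    · exact ⟨i + 1, hi, .inr ⟨rfl, by rw [← h i hi]; exact hq⟩⟩
    · exact ⟨i, hi.le, .inl ⟨rfl, hq⟩⟩

end

theorem forall_mem_runClauses {r : RawMachine} {k : ℕ} {E : List (List ℕ)}
    {P : (ℕ × ℕ) ⊕ (ℕ × ℕ × List ℕ × ℕ × ℕ) → Prop} :
    (∀ c ∈ runClauses r k E, P c) ↔
      (∀ i < k, ∀ q < r.1.2.2, P (.inl (i, q))) ∧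
      ∀ t < r.1.1, ∀ i ≤ k, ∀ μ ∈ E, ∀ j ≤ i, ∀ a < r.1.2.1, P (.inr (t, i, μ, j, a)) := by
  simp only [runClauses, List.mem_append, List.mem_flatMap, List.mem_map, List.mem_range]
  constructor
  · intro h
    exact ⟨fun i hi q hq => h _ (.inl ⟨i, hi, q, hq, rfl⟩),
      fun t ht i hi μ hμ j hj a ha => h _ (.inr ⟨t, ht, i, by omega, μ, hμ, j, by omega, a, ha, rfl⟩)⟩
  · rintro ⟨h1, h2⟩ c (⟨i, hi, q, hq, rfl⟩ | ⟨t, ht, i, hi, μ, hμ, j, hj, a, ha, rfl⟩)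
    · exact h1 i hi q hq
    · exact h2 t ht i (by omega) μ hμ j (by omega) a ha

/-- Applicability uses only the clauses with the actual moves of the tape and the symbol actually
required. All others hold trivially: a wrong `μ` is refuted by the transition at some time before
`i`, and a wrong symbol by the transition at time `i`. -/
theorem runInstance_clauses_iff {I : BlindInstance} {k : ℕ}
    {d : ℕ → Transition I.machine.tapes I.machine.symbols I.machine.states}
    (hs : (d 0).src = I.machine.start) :
    (∀ c ∈ runClauses I.raw k (tuples k [0, 1, 2]), ∃ p ≤ k, runInc I.raw p (d p).raw c = true) ↔
      ∀ i ≤ k, I.machine.Applicable (d i) (I.machine.conf (I.machine.init I.word) d i) := by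
  rw [forall_mem_runClauses]
  change ((∀ i < k, ∀ q < I.machine.states, ∃ p ≤ k, linkInc p (d p).raw (i, q) = true) ∧
    ∀ t < I.machine.tapes, ∀ i ≤ k, ∀ μ ∈ tuples k [0, 1, 2], ∀ j ≤ i, ∀ a < I.machine.symbols,
      ∃ p ≤ k, readInc I.raw p (d p).raw t i μ j a = true) ↔ _
  rw [link_clauses_iff]
  constructor
  · rintro ⟨hlink, hread⟩ i hi
    refine ⟨?_, fun t => ?_⟩
    · cases i with
      | zero => exact hs.symm
      | succ i => exact hlink i hi
    · rcases hr : (d i).read t with _ | a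
      · exact .inl rfl
      right
      let μ := (List.range k).map fun p => moveCode ((d p).move t)
      have hμE : μ ∈ tuples k [0, 1, 2] := by
        rw [mem_tuples]
        refine ⟨by simp [μ], fun x hx => ?_⟩
        obtain ⟨p, -, rfl⟩ := List.mem_map.1 hx
        cases (d p).move t <;> simp [moveCode]
      have hμ : ∀ p < i, moveCode ((d p).move t) = μ.getD p 0 := fun p hp => by
        have : p < k := by omega
        simp [μ, List.getD_eq_getElem?_getD, this]
      rw [(read_clauses_iff hi hμ hr).1 fun j hj => hread t t.2 i hi μ hμE j hj a a.2]
  · intro h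
    refine ⟨fun i hi => (h (i + 1) hi).1, fun t ht i hi μ _ j hj a ha => ?_⟩
    by_cases hμ : ∀ p < i, moveCode ((d p).move ⟨t, ht⟩) = μ.getD p 0
    · by_cases hr : (d i).read ⟨t, ht⟩ = some ⟨a, ha⟩
      · refine (read_clauses_iff hi hμ hr).2 ?_ j hj
        rcases (h i hi).2 ⟨t, ht⟩ with h1 | h1
        · rw [hr] at h1; cases h1
        · rw [hr] at h1; exact (Option.some.inj h1).symm
      · exact ⟨i, hi, (readInc_iff (t := ⟨t, ht⟩) (a := ⟨a, ha⟩)).2 (.inr (.inl ⟨rfl, hr⟩))⟩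
    · push Not at hμ
      obtain ⟨p, hp, hne⟩ := hμ
      exact ⟨p, by omega, (readInc_iff (t := ⟨t, ht⟩) (a := ⟨a, ha⟩)).2 (.inl ⟨hp, hne⟩)⟩

theorem runInstance_yes_iff (I : BlindInstance) (k : ℕ) :
    I.machine.AcceptsWithin I.word k ↔
      ColoredHittingSet.Yes (runInstance I.raw k (tuples k [0, 1, 2])) (k + 1) := by
  have h1 := hitInstance_yes_iff (List.nodup_range (n := k + 1)) (opts := runOptions I.raw k)
    (Cl := runClauses I.raw k (tuples k [0, 1, 2])) (inc := runInc I.raw)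
  rw [List.length_range] at h1
  rw [runInstance, h1, BlindNTM.acceptsWithin_iff]
  simp only [List.mem_range, Nat.lt_succ_iff]
  constructor
  · rintro ⟨d, hd, hacc⟩
    have hs : (d 0).src = I.machine.start := (hd 0 (by omega)).2.1.symm
    refine ⟨fun i => (d i).raw, fun i hi => mem_runOptions.2 ⟨d i, (hd i hi).1, rfl, ?_, ?_⟩,
      (runInstance_clauses_iff hs).2 fun i hi => (hd i hi).2⟩
    · rintro rfl; exact hs
    · rintro rfl; exact hacc
  · rintro ⟨f, hf, hc⟩
    have h2 : ∀ i, ∃ δ : Transition I.machine.tapes I.machine.symbols I.machine.states, i ≤ k →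
        δ ∈ I.machine.deltaIdle ∧ δ.raw = f i ∧
      (i = 0 → δ.src = I.machine.start) ∧ (i = k → I.machine.accepting δ.src = true) := by
      intro i
      by_cases hi : i ≤ k
      · obtain ⟨δ, hδ⟩ := mem_runOptions.1 (hf i hi)
        exact ⟨δ, fun _ => hδ⟩
      -- An arbitrary value for the times after `k`, which are never used.
      · exact ⟨I.machine.idle I.machine.start, fun h => absurd h hi⟩
    choose d hd using h2
    have hs : (d 0).src = I.machine.start := (hd 0 (by omega)).2.2.1 rfl
    have happ := (runInstance_clauses_iff hs (k := k)).1 fun c hcl => by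
      obtain ⟨p, hp, h3⟩ := hc c hcl
      exact ⟨p, hp, by rw [(hd p hp).2.1]; exact h3⟩
    exact ⟨d, fun i hi => ⟨(hd i hi).1, happ i hi⟩, (hd k le_rfl).2.2.2 rfl⟩

/-- The `3 ^ k` move sequences are prepared from the parameter alone; given their list, the instance
is built in polynomial time. -/
theorem shortBlind_reducible_coloredHittingSet :
    FPTReducible ShortBlindMultiTapeNTM ColoredHittingSet := by
  obtain ⟨q, b, hb, hq⟩ := exists_prog_moveTuples
  have hR : PT (fun p : (BlindInstance × ℕ) × List (List ℕ) =>
      (runInstance p.1.1.raw p.1.2 p.2, p.1.2 + 1)) := by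
    fun_prop
  exact FPTReducible.of_aux (A := ShortBlindMultiTapeNTM) (B := ColoredHittingSet) hb hq hR
    (g := fun k => k + 1) Computable.succ (fun _ _ => le_rfl) fun I k => runInstance_yes_iff I k

end ParamW

theorem theorem1 : ParamW.WComplete 2 ParamW.ShortBlindMultiTapeNTM := by
  refine ⟨⟨2, ParamW.shortBlind_reducible_coloredHittingSet.trans
    ParamW.coloredHittingSet_reducible_circuitSat⟩, ?_⟩
  rintro A ⟨h, hA⟩
  exact (hA.trans (ParamW.circuitSat_reducible_coloredHittingSet h)).trans
    ParamW.coloredHittingSet_reducible_shortBlind
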